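/- Let $\mathbb{K}$ be a field of characteristic zero and $\mathcal{D}$ a set. **Com-PreLie bialgebras.** A (unitary) Com-PreLie algebra is a commutative, associative, unitary $\mathbb{K}$-algebra $(A,\cdot)$ with a bilinear product $\bullet$ such that $(a\bullet b)\bullet c-a\bullet(b\bullet c)=(a\bullet c)\bullet b-a\bullet(c\bullet b)$ and $(a\cdot b)\bullet c=(a\bullet c)\cdot b+a\cdot(b\bullet c)$. It is a Com-PreLie bialgebra if moreover $(A,\cdot,\Delta)$ is a bialgebra and $\Delta(a\bullet b)=a^{(1)}\otimes a^{(2)}\bullet b+a^{(1)}\bullet b^{(1)}\otimes a^{(2)}\cdot b^{(2)}$ for all $a,b\in A$. A Com-PreLie ideal is a subspace which is an ideal for both products. **Partitioned trees.** A partitioned forest is a finite rooted forest (edges oriented from the roots to the leaves) with a partition of its vertices into blocks such that two vertices of the same block are both roots or have the same direct ascendant. It is a partitioned tree if all its roots are in the same block; the empty forest $\emptyset$ is a partitioned tree. Let $\mathcal{PT}(\mathcal{D})$ be the set of isoclasses of partitioned trees with vertices decorated by $\mathcal{D}$, and $\mathcal{UPT}(\mathcal{D})=\mathcal{PT}(\mathbb{N}\times\mathcal{D})$.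 The product $T\cdot T'$ is the disjoint union, with the two blocks of roots joined into one. **The Com-PreLie algebra $UCP(\mathcal{D})$.** It is the vector space generated by $\mathcal{UPT}(\mathcal{D})$, with the product $\cdot$ extended bilinearly (unit $\emptyset$), and the bilinear product $\bullet$ given on trees as follows: if $T'\neq\emptyset$, $T\bullet T'$ is the sum over the vertices $s$ of $T$ of the trees obtained by adding edges from $s$ to all the roots of $T'$ (the blocks of $T$ and $T'$ being kept); $T\bullet\emptyset$ is the sum over the vertices $s$ of $T$ of the trees obtained by replacing the decoration $(i,d)$ of $s$ by $(i+1,d)$. **The coproduct.** An ideal of $T$ is a set $I$ of vertices such that, if $v\in I$ and there is an edge from $v$ to $w$, then $w\in I$. The tree $P^I(T)$ is the product of the partitioned trees of the restriction of $T$ to $I$. The tree $R^I(T)$ is the restriction of $T$ to the complement of $I$, the decoration $(i,d)$ of $v$ being replaced by $(i+\iota_I(v),d)$, where $\iota_I(v)$ is the number of blocks $C$ of $T$ included in $I$ such that there is an edge from $v$ to a vertex of $C$. Let $$\Delta(T)=\sum_{I\text{ ideal of }T}R^I(T)\otimes P^I(T),$$ extended linearly, and let $\varepsilon(T)=1$ if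 $T=\emptyset$ and $\varepsilon(T)=0$ otherwise. **Quotients.** Write $\bullet_x$ for the tree with one vertex decorated by $x$. Let $CP(\mathcal{D})=UCP(\mathcal{D})/I$, where $I$ is the Com-PreLie ideal generated by the elements $\bullet_{(1,d)}-\bullet_{(0,d)}$, $d\in\mathcal{D}$; a tree of $\mathcal{PT}(\mathcal{D})$ is seen in $CP(\mathcal{D})$ by identifying the decoration $d$ with $(0,d)$. Let $\mathcal{H}_{CK}^{\mathcal{D}}=CP(\mathcal{D})/J$, where $J$ is the Com-PreLie ideal generated by the elements $\bullet_d\bullet(F_1\times F_2)-\bullet_d\bullet(F_1\cdot F_2)$, for $d\in\mathcal{D}$ and $F_1,F_2\in\mathcal{PT}(\mathcal{D})$, with $a\bullet(b\times c)=(a\bullet b)\bullet c-a\bullet(b\bullet c)$. **The Connes–Kreimer Hopf algebra.** It is the vector space generated by the isoclasses of rooted forests $F$ decorated by $\mathcal{D}$, with the disjoint union as product, the coproduct $\Delta_{CK}(F)=\sum_{I}(F\setminus I)\otimes I$ (sum over the ideals $I$ of $F$, that is, over admissible cuts), and the counit equal to $1$ on the empty forest and $0$ on the other forests. For $d\in\mathcal{D}$,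 $B_d(F)$ is the tree obtained by grafting the trees of $F$ on a common root decorated by $d$. **Theorem.** 1. $(UCP(\mathcal{D}),\cdot,\bullet,\Delta)$ is a Com-PreLie bialgebra, with counit $\varepsilon$. 2. $CP(\mathcal{D})$ and $\mathcal{H}_{CK}^{\mathcal{D}}$ are Com-PreLie bialgebra quotients of $UCP(\mathcal{D})$: with the products induced by those of $UCP(\mathcal{D})$, they have coproducts and counits which make them Com-PreLie bialgebras and for which the projections $UCP(\mathcal{D})\to CP(\mathcal{D})\to\mathcal{H}_{CK}^{\mathcal{D}}$ are morphisms of Com-PreLie bialgebras. 3. $\mathcal{H}_{CK}^{\mathcal{D}}$ is the Connes–Kreimer Hopf algebra of decorated rooted trees: the Connes–Kreimer algebra above is a bialgebra with an antipode and satisfies $\Delta_{CK}\circ B_d(x)=(B_d\otimes Id)\circ\Delta_{CK}(x)+\emptyset\otimes B_d(x)$ for all $d\in\mathcal{D}$, and there is an isomorphism of bialgebras from $\mathcal{H}_{CK}^{\mathcal{D}}$ onto it, which sends the class of any $T\in\mathcal{UPT}(\mathcal{D})$ to its underlying rooted forest, obtained by forgetting the blocks and the integers in the decorations. -/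

import Mathlib

open scoped TensorProduct

universe u v w

namespace ComPreLie

/-! ### Com-PreLie algebras and bialgebras

The commutative, associative and unitary product is the multiplication of a commutative
`K`-algebra `A`; the preLie product is a bilinear map `b`, where `b x y` is `x • y`. -/

section Algebra

variable (K : Type w) {A : Type v} [Field K] [CommRing A] [Algebra K A]

/-- The axioms of a (right, unitary) Com-PreLie algebra. -/
structure IsComPreLieAlgebra (b : A →ₗ[K] A →ₗ[K] A) : Prop where
  preLie : ∀ x y z, b (b x y) z - b x (b y z) = b (b x z) y - b x (b z y)
  leibniz : ∀ x y z, b (x * y) z = b x z * y + x * b y z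

/-- `(A, ·, Δ)` is a bialgebra with counit `ε`. -/
structure IsBialgebra (Δ : A →ₗ[K] A ⊗[K] A) (ε : A →ₗ[K] K) : Prop where
  coassoc : (TensorProduct.assoc K A A A).toLinearMap ∘ₗ Δ.rTensor A ∘ₗ Δ = Δ.lTensor A ∘ₗ Δ
  rTensor_counit : ∀ x, ε.rTensor A (Δ x) = 1 ⊗ₜ[K] x
  lTensor_counit : ∀ x, ε.lTensor A (Δ x) = x ⊗ₜ[K] 1
  comul_one : Δ 1 = 1
  comul_mul : ∀ x y, Δ (x * y) = Δ x * Δ y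
  counit_one : ε 1 = 1
  counit_mul : ∀ x y, ε (x * y) = ε x * ε y

/-- Such a structure is a Mathlib bialgebra. -/
@[reducible] def IsBialgebra.toBialgebra {K : Type w} {A : Type v} [Field K] [CommRing A]
    [Algebra K A] {Δ : A →ₗ[K] A ⊗[K] A} {ε : A →ₗ[K] K} (h : IsBialgebra K Δ ε) :
    Bialgebra K A :=
  letI : Coalgebra K A :=
    { comul := Δ
      counit := ε
      coassoc := h.coassoc
      rTensor_counit_comp_comul := LinearMap.ext h.rTensor_counit
      lTensor_counit_comp_comul := LinearMap.ext h.lTensor_counit }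
  Bialgebra.mk' K A h.counit_one (h.counit_mul _ _) h.comul_one (h.comul_mul _ _)

/-- Com-PreLie bialgebras: the last axiom is
`Δ(x • y) = x⁽¹⁾ ⊗ (x⁽²⁾ • y) + (x⁽¹⁾ • y⁽¹⁾) ⊗ (x⁽²⁾ · y⁽²⁾)`. -/
structure IsComPreLieBialgebra (b : A →ₗ[K] A →ₗ[K] A) (Δ : A →ₗ[K] A ⊗[K] A) (ε : A →ₗ[K] K) :
    Prop extends IsComPreLieAlgebra K b, IsBialgebra K Δ ε where
  comul_bullet : ∀ x y, Δ (b x y) =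
    (b.flip y).lTensor A (Δ x) + TensorProduct.map₂ b (LinearMap.mul K A) (Δ x) (Δ y)

/-- `S` is an antipode of the bialgebra `(A, ·, Δ, ε)`. -/
structure IsAntipode (Δ : A →ₗ[K] A ⊗[K] A) (ε : A →ₗ[K] K) (S : A →ₗ[K] A) : Prop where
  mul_rTensor : ∀ x, LinearMap.mul' K A (S.rTensor A (Δ x)) = algebraMap K A (ε x)
  mul_lTensor : ∀ x, LinearMap.mul' K A (S.lTensor A (Δ x)) = algebraMap K A (ε x)

/-- The algebra morphism `φ` respects coproducts and counits. -/
structure IsBialgebraHom {B : Type*} [CommRing B] [Algebra K B]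
    (Δ : A →ₗ[K] A ⊗[K] A) (ε : A →ₗ[K] K) (Δ' : B →ₗ[K] B ⊗[K] B) (ε' : B →ₗ[K] K)
    (φ : A →ₐ[K] B) : Prop where
  map_comul : ∀ x, Δ' (φ x) = TensorProduct.map φ.toLinearMap φ.toLinearMap (Δ x)
  map_counit : ∀ x, ε' (φ x) = ε x

/-- Morphisms of Com-PreLie bialgebras. -/
structure IsComPreLieBialgebraHom {B : Type*} [CommRing B] [Algebra K B]
    (b : A →ₗ[K] A →ₗ[K] A) (Δ : A →ₗ[K] A ⊗[K] A) (ε : A →ₗ[K] K)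
    (b' : B →ₗ[K] B →ₗ[K] B) (Δ' : B →ₗ[K] B ⊗[K] B) (ε' : B →ₗ[K] K)
    (φ : A →ₐ[K] B) : Prop extends IsBialgebraHom K Δ ε Δ' ε' φ where
  map_bullet : ∀ x y, φ (b x y) = b' (φ x) (φ y)

variable {K}

/-- An ideal for both products. -/
def IsComPreLieIdeal (b : A →ₗ[K] A →ₗ[K] A) (I : Ideal A) : Prop :=
  ∀ x ∈ I, ∀ a, b x a ∈ I ∧ b a x ∈ I

/-- The Com-PreLie ideal generated by a set. -/
def idealSpan (b : A →ₗ[K] A →ₗ[K] A) (s : Set A) : Ideal A :=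
  sInf {I | IsComPreLieIdeal b I ∧ s ⊆ I}

theorem isComPreLieIdeal_idealSpan (b : A →ₗ[K] A →ₗ[K] A) (s : Set A) :
    IsComPreLieIdeal b (idealSpan b s) := by
  intro x hx a
  simp only [idealSpan, Submodule.mem_sInf, Set.mem_ofPred_eq] at hx ⊢
  exact ⟨fun I hI => (hI.1 x (hx I hI) a).1, fun I hI => (hI.1 x (hx I hI) a).2⟩

/-- The preLie product induced on the quotient by a Com-PreLie ideal. -/
noncomputable def quotientBullet (b : A →ₗ[K] A →ₗ[K] A) (I : Ideal A)
    (hI : IsComPreLieIdeal b I) : (A ⧸ I) →ₗ[K] (A ⧸ I) →ₗ[K] (A ⧸ I) :=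
  LinearMap.mk₂ K
    (fun x y => Quotient.liftOn₂' x y (fun a c => Ideal.Quotient.mk I (b a c)) (by
      intro a c a' c' h h'
      rw [Submodule.quotientRel_def] at h h'
      rw [Ideal.Quotient.eq]
      have e : b a c - b a' c' = b (a - a') c + b a' (c - c') := by
        simp only [map_sub, LinearMap.sub_apply]; abel
      rw [e]
      exact I.add_mem (hI _ h _).1 (hI _ h' _).2))
    (by
      rintro ⟨x⟩ ⟨y⟩ ⟨z⟩
      change Ideal.Quotient.mk I (b (x + y) z)
        = Ideal.Quotient.mk I (b x z) + Ideal.Quotient.mk I (b y z)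
      rw [← map_add, map_add, LinearMap.add_apply])
    (by
      rintro c ⟨x⟩ ⟨y⟩
      change Ideal.Quotient.mkₐ K I (b (c • x) y) = c • Ideal.Quotient.mkₐ K I (b x y)
      rw [← map_smul, map_smul, LinearMap.smul_apply])
    (by
      rintro ⟨x⟩ ⟨y⟩ ⟨z⟩
      change Ideal.Quotient.mk I (b x (y + z))
        = Ideal.Quotient.mk I (b x y) + Ideal.Quotient.mk I (b x z)
      rw [← map_add, map_add])
    (by
      rintro c ⟨x⟩ ⟨y⟩
      change Ideal.Quotient.mkₐ K I (b x (c • y)) = c • Ideal.Quotient.mkₐ K I (b x y)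
      rw [← map_smul, map_smul])

theorem quotientBullet_mk (b : A →ₗ[K] A →ₗ[K] A) (I : Ideal A)
    (hI : IsComPreLieIdeal b I) (x y : A) :
    quotientBullet b I hI (Ideal.Quotient.mkₐ K I x) (Ideal.Quotient.mkₐ K I y) =
      Ideal.Quotient.mkₐ K I (b x y) := rfl

end Algebra

/-! ### Decorated rooted forests -/

/-- A finite rooted forest with vertices decorated by `D`, given by the map sending a vertex to
its direct ascendant (`none` for a root); there is an edge from `v` to `w` when
`parent w = some v`. -/
structure RForest (D : Type u) where
  V : Type
  finite : Finite V
  parent : V → Option V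
  wf : WellFounded fun v w => parent w = some v
  deco : V → D

namespace RForest

variable {D : Type u} {E : Type v}

instance (F : RForest D) : Finite F.V := F.finite

noncomputable instance (F : RForest D) : Fintype F.V := Fintype.ofFinite _

/-- Isomorphisms of decorated rooted forests. -/
structure Iso (F G : RForest D) extends F.V ≃ G.V where
  map_parent : ∀ v, G.parent (toFun v) = (F.parent v).map toFun
  map_deco : ∀ v, G.deco (toFun v) = F.deco v

def Iso.refl (F : RForest D) : Iso F F where
  toEquiv := Equiv.refl _
  map_parent v := by simp
  map_deco v := rfl

def Iso.symm {F G : RForest D} (e : Iso F G) : Iso G F where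
  toEquiv := e.toEquiv.symm
  map_parent v := by
    obtain ⟨v, rfl⟩ := e.toEquiv.surjective v
    have := e.map_parent v
    simp only [Equiv.toFun_as_coe, Equiv.symm_apply_apply] at this ⊢
    rw [this]; cases F.parent v <;> simp
  map_deco v := by
    obtain ⟨v, rfl⟩ := e.toEquiv.surjective v
    have := e.map_deco v
    simp only [Equiv.toFun_as_coe, Equiv.symm_apply_apply] at this ⊢
    exact this.symm

def Iso.trans {F G H : RForest D} (e : Iso F G) (e' : Iso G H) : Iso F H where
  toEquiv := e.toEquiv.trans e'.toEquiv
  map_parent v := by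
    have h1 := e.map_parent v
    have h2 := e'.map_parent (e.toEquiv v)
    simp only [Equiv.toFun_as_coe, Equiv.trans_apply] at h1 h2 ⊢
    rw [h2, h1]; cases F.parent v <;> simp
  map_deco v := (e'.map_deco _).trans (e.map_deco v)

theorem Iso.parent_iff {F G : RForest D} (e : Iso F G) (v w : F.V) :
    G.parent (e.toEquiv w) = some (e.toEquiv v) ↔ F.parent w = some v := by
  have := e.map_parent w
  simp only [Equiv.toFun_as_coe] at this
  rw [this]; cases F.parent w <;> simp

theorem Iso.parent_none {F G : RForest D} (e : Iso F G) (w : F.V) :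
    G.parent (e.toEquiv w) = none ↔ F.parent w = none := by
  have := e.map_parent w
  simp only [Equiv.toFun_as_coe] at this
  rw [this]; cases F.parent w <;> simp

/-- The forest with no vertex. -/
def empty (D : Type u) : RForest D where
  V := Empty
  finite := inferInstance
  parent := Empty.elim
  wf := ⟨fun v => v.elim⟩
  deco := Empty.elim

/-- The disjoint union. -/
def disj (F G : RForest D) : RForest D where
  V := F.V ⊕ G.V
  finite := inferInstance
  parent := Sum.elim (fun v => (F.parent v).map Sum.inl) (fun w => (G.parent w).map Sum.inr)
  wf := by
    refine Subrelation.wf ?_ (Sum.lex_wf F.wf G.wf)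
    rintro (v | v) (w | w) h <;> simp at h ⊢ <;> exact h
  deco := Sum.elim F.deco G.deco

open Classical in
/-- The restriction to a set of vertices: an edge is kept when its ends are in the set. -/
noncomputable def restrict (F : RForest D) (S : Set F.V) : RForest D where
  V := S
  finite := inferInstance
  parent v := (F.parent v).bind fun w => if h : w ∈ S then some ⟨w, h⟩ else none
  wf := by
    refine Subrelation.wf ?_ (InvImage.wf (fun v : S => (v : F.V)) F.wf)
    intro v w h
    rw [Option.bind_eq_some_iff] at h
    obtain ⟨x, hx, h⟩ := h
    split_ifs at h
    cases h
    exact hx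
  deco v := F.deco v

theorem restrict_parent (F : RForest D) (S : Set F.V) (v w : S) :
    (F.restrict S).parent w = some v ↔ F.parent w = some (v : F.V) := by
  simp only [restrict, Option.bind_eq_some_iff]
  constructor
  · rintro ⟨x, hx, h⟩
    split_ifs at h
    cases h
    exact hx
  · intro h
    exact ⟨v, h, by simp⟩

/-- Change of decorations. -/
def mapDeco (f : D → E) (F : RForest D) : RForest E where
  V := F.V
  finite := F.finite
  parent := F.parent
  wf := F.wf
  deco v := f (F.deco v)

/-- Add a common root, decorated by `d`, below all the roots of `F`. -/
def graftRoot (d : D) (F : RForest D) : RForest D where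
  V := Option F.V
  finite := inferInstance
  parent x := x.map F.parent
  wf := by
    have h0 : Acc (fun v w : Option F.V => w.map F.parent = some v) none :=
      ⟨_, fun y hy => by simp at hy⟩
    refine ⟨fun x => ?_⟩
    cases x with
    | none => exact h0
    | some v =>
      induction v using F.wf.induction with
      | _ v ih =>
        refine ⟨_, fun y hy => ?_⟩
        simp only [Option.map_some, Option.some.injEq] at hy
        cases y with
        | none => exact h0
        | some w => exact ih w hy
  deco x := x.elim d F.deco

/-- Ideals: sets of vertices closed under taking children. -/
def IsIdeal (F : RForest D) (I : Set F.V) : Prop :=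
  ∀ v w, v ∈ I → F.parent w = some v → w ∈ I

/-- The set of ideals of `F`. -/
def Ideals (F : RForest D) : Type := {I : Set F.V // F.IsIdeal I}

instance (F : RForest D) : Finite F.Ideals := by unfold Ideals; infer_instance

noncomputable instance (F : RForest D) : Fintype F.Ideals := Fintype.ofFinite _

def Iso.disj {F F' G G' : RForest D} (e : Iso F F') (e' : Iso G G') :
    Iso (F.disj G) (F'.disj G') :=
  { toEquiv := e.toEquiv.sumCongr e'.toEquiv
    map_parent := by
      rintro (v | v)
      · have h : F'.parent (e.toEquiv v) = (F.parent v).map e.toEquiv := e.map_parent v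
        change (F'.parent (e.toEquiv v)).map Sum.inl =
          ((F.parent v).map Sum.inl).map (e.toEquiv.sumCongr e'.toEquiv)
        rw [h]; cases F.parent v <;> rfl
      · have h : G'.parent (e'.toEquiv v) = (G.parent v).map e'.toEquiv := e'.map_parent v
        change (G'.parent (e'.toEquiv v)).map Sum.inr =
          ((G.parent v).map Sum.inr).map (e.toEquiv.sumCongr e'.toEquiv)
        rw [h]; cases G.parent v <;> rfl
    map_deco := by
      rintro (v | v)
      · exact e.map_deco v
      · exact e'.map_deco v }

/-- Restriction of an isomorphism. -/
noncomputable def Iso.restrict {F G : RForest D} (e : Iso F G) (S : Set F.V) (S' : Set G.V)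
    (h : ∀ v, v ∈ S ↔ e.toEquiv v ∈ S') : Iso (F.restrict S) (G.restrict S') :=
  { toEquiv := e.toEquiv.subtypeEquiv h
    map_parent := fun w => by
      refine Option.ext fun x => ?_
      obtain ⟨v, rfl⟩ := (e.toEquiv.subtypeEquiv h).surjective x
      refine (G.restrict_parent S' _ _).trans ((e.parent_iff v.1 w.1).trans
        ((F.restrict_parent S v w).symm.trans ?_))
      change _ ↔ ((F.restrict S).parent w).map (e.toEquiv.subtypeEquiv h) =
        some (e.toEquiv.subtypeEquiv h v)
      cases (F.restrict S).parent w with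
      | none => exact iff_of_false nofun nofun
      | some y =>
        exact Option.some_inj.trans
          ((e.toEquiv.subtypeEquiv h).apply_eq_iff_eq.symm.trans Option.some_inj.symm)
    map_deco := fun v => e.map_deco v.1 }

/-- An isomorphism transports ideals. -/
def Iso.ideals {F G : RForest D} (e : Iso F G) : F.Ideals ≃ G.Ideals :=
  (Equiv.Set.congr e.toEquiv).subtypeEquiv (by
    intro I
    simp only [IsIdeal, Equiv.Set.congr_apply]
    constructor
    · intro h v w hv hw
      obtain ⟨v, rfl⟩ := e.toEquiv.surjective v
      obtain ⟨w, rfl⟩ := e.toEquiv.surjective w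
      rw [e.parent_iff] at hw
      simp only [e.toEquiv.injective.mem_set_image] at hv ⊢
      exact h v w hv hw
    · intro h v w hv hw
      have := h (e.toEquiv v) (e.toEquiv w)
      simp only [e.toEquiv.injective.mem_set_image, e.parent_iff] at this
      exact this hv hw)

/-- Associativity of the disjoint union. -/
def disjAssoc (F G H : RForest D) : Iso ((F.disj G).disj H) (F.disj (G.disj H)) where
  toEquiv := Equiv.sumAssoc F.V G.V H.V
  map_parent := by
    rintro ((v | v) | v)
    · change (F.parent v).map Sum.inl =
        (((F.parent v).map Sum.inl).map Sum.inl).map (Equiv.sumAssoc F.V G.V H.V)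
      cases F.parent v <;> rfl
    · change ((G.parent v).map Sum.inl).map Sum.inr =
        (((G.parent v).map Sum.inr).map Sum.inl).map (Equiv.sumAssoc F.V G.V H.V)
      cases G.parent v <;> rfl
    · change ((H.parent v).map Sum.inr).map Sum.inr =
        ((H.parent v).map Sum.inr).map (Equiv.sumAssoc F.V G.V H.V)
      cases H.parent v <;> rfl
  map_deco := by rintro ((v | v) | v) <;> rfl

/-- Commutativity of the disjoint union. -/
def disjComm (F G : RForest D) : Iso (F.disj G) (G.disj F) where
  toEquiv := Equiv.sumComm F.V G.V
  map_parent := by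
    rintro (v | v)
    · change (F.parent v).map Sum.inr = ((F.parent v).map Sum.inl).map (Equiv.sumComm F.V G.V)
      cases F.parent v <;> rfl
    · change (G.parent v).map Sum.inl = ((G.parent v).map Sum.inr).map (Equiv.sumComm F.V G.V)
      cases G.parent v <;> rfl
  map_deco := by rintro (v | v) <;> rfl

/-- The empty forest is a unit. -/
def disjEmpty (F : RForest D) : Iso (F.disj (empty D)) F where
  toEquiv := Equiv.sumEmpty F.V Empty
  map_parent := by
    rintro (v | v)
    · change F.parent v = ((F.parent v).map Sum.inl).map (Equiv.sumEmpty F.V Empty)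
      cases F.parent v <;> rfl
    · exact v.elim
  map_deco := by
    rintro (v | v)
    · rfl
    · exact v.elim

theorem Iso.mem_ideals {F G : RForest D} (e : Iso F G) (I : F.Ideals) (v : F.V) :
    v ∈ I.1 ↔ e.toEquiv v ∈ (e.ideals I).1 :=
  (e.toEquiv.injective.mem_set_image (s := I.1)).symm

end RForest

/-- Isomorphism of decorated rooted forests is an equivalence relation. -/
instance RForest.setoid (D : Type u) : Setoid (RForest D) where
  r F G := Nonempty (F.Iso G)
  iseqv := ⟨fun F => ⟨.refl F⟩, fun ⟨e⟩ => ⟨e.symm⟩, fun ⟨e⟩ ⟨e'⟩ => ⟨e.trans e'⟩⟩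

/-- Isoclasses of rooted forests decorated by `D`. -/
def RF (D : Type u) : Type (max 1 u) := Quotient (RForest.setoid D)

/-- The isoclass of a decorated rooted forest. -/
def RForest.cls {D : Type u} (F : RForest D) : RF D := Quotient.mk _ F

/-- The monoid of decorated rooted forests, under disjoint union. -/
instance (D : Type u) : CommMonoid (RF D) where
  mul := Quotient.map₂ RForest.disj (fun _ _ ⟨e⟩ _ _ ⟨e'⟩ => ⟨e.disj e'⟩)
  one := (RForest.empty D).cls
  mul_assoc := by
    rintro ⟨F⟩ ⟨G⟩ ⟨H⟩
    exact Quotient.sound ⟨F.disjAssoc G H⟩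
  mul_comm := by
    rintro ⟨F⟩ ⟨G⟩
    exact Quotient.sound ⟨F.disjComm G⟩
  one_mul := by
    rintro ⟨F⟩
    exact Quotient.sound ⟨((RForest.empty D).disjComm F).trans F.disjEmpty⟩
  mul_one := by
    rintro ⟨F⟩
    exact Quotient.sound ⟨F.disjEmpty⟩

/-! ### The Connes–Kreimer Hopf algebra -/

/-- The Connes–Kreimer algebra: the algebra of the monoid of decorated rooted forests. -/
abbrev CK (K : Type w) [Field K] (D : Type u) := MonoidAlgebra K (RF D)

namespace CK

variable (K : Type w) [Field K] {D : Type u}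

/-- The basis element given by a decorated rooted forest. -/
noncomputable def of (F : RForest D) : CK K D := MonoidAlgebra.single F.cls 1

theorem of_congr {F G : RForest D} (e : F.Iso G) : of K F = of K G := by
  unfold of
  rw [show F.cls = G.cls from Quotient.sound ⟨e⟩]

variable (D)

/-- `Δ(F) = ∑ (F ∖ I) ⊗ I`, the sum being over the ideals `I` of `F`; equivalently over the
admissible cuts of `F`, the total and the empty cut of each tree included. -/
noncomputable def comul : CK K D →ₗ[K] CK K D ⊗[K] CK K D :=
  (MonoidAlgebra.basis (RF D) K).constr K fun F =>
    Quotient.lift (s := RForest.setoid D)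
      (fun F : RForest D => ∑ I : F.Ideals, of K (F.restrict I.1ᶜ) ⊗ₜ[K] of K (F.restrict I.1))
      (by
        rintro F G ⟨e⟩
        refine Fintype.sum_equiv e.ideals _ _ fun I => ?_
        rw [of_congr K (e.restrict I.1 _ (e.mem_ideals I)),
          of_congr K (e.restrict I.1ᶜ (e.ideals I).1ᶜ fun v => not_congr (e.mem_ideals I v))]) F

/-- The counit: the coefficient of the empty forest. -/
noncomputable def counit : CK K D →ₗ[K] K := by
  classical
  exact (MonoidAlgebra.basis (RF D) K).constr K fun F => if F = 1 then 1 else 0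

variable {D}

/-- The operator grafting the trees of a forest on a common root decorated by `d`. -/
noncomputable def B (d : D) : CK K D →ₗ[K] CK K D :=
  (MonoidAlgebra.basis (RF D) K).constr K fun F =>
    Quotient.lift (s := RForest.setoid D) (fun F : RForest D => of K (F.graftRoot d))
      (by
        rintro F G ⟨e⟩
        refine of_congr K ⟨Equiv.optionCongr e.toEquiv, ?_, ?_⟩
        · rintro (_ | v)
          · rfl
          · have h : G.parent (e.toEquiv v) = (F.parent v).map e.toEquiv := e.map_parent v
            change some (G.parent (e.toEquiv v)) = some ((F.parent v).map e.toEquiv)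
            rw [h]
        · rintro (_ | v)
          · rfl
          · exact e.map_deco v) F

end CK

/-! ### Partitioned forests and trees -/

/-- A partitioned forest decorated by `D`: the blocks are the classes of `block`, and two vertices
in the same block are both roots or have the same direct ascendant. -/
structure PForest (D : Type u) extends RForest D where
  block : Setoid V
  block_parent : ∀ v w, block v w → parent v = parent w

/-- A partitioned tree: all the roots are in the same block. The empty forest is one. -/
structure PTree (D : Type u) extends PForest D where
  block_root : ∀ v w, parent v = none → parent w = none → block v w

namespace PForest

variable {D : Type u} {E : Type v}

/-- Isomorphisms of decorated partitioned forests. -/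
structure Iso (F G : PForest D) extends F.toRForest.Iso G.toRForest where
  map_block : ∀ v w, G.block (toFun v) (toFun w) ↔ F.block v w

def Iso.refl (F : PForest D) : Iso F F where
  toIso := .refl _
  map_block _ _ := Iff.rfl

def Iso.symm {F G : PForest D} (e : Iso F G) : Iso G F where
  toIso := e.toIso.symm
  map_block v w := by
    obtain ⟨v, rfl⟩ := e.toEquiv.surjective v
    obtain ⟨w, rfl⟩ := e.toEquiv.surjective w
    have := e.map_block v w
    simp only [RForest.Iso.symm, Equiv.toFun_as_coe, Equiv.symm_apply_apply] at this ⊢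
    exact this.symm

def Iso.trans {F G H : PForest D} (e : Iso F G) (e' : Iso G H) : Iso F H where
  toIso := e.toIso.trans e'.toIso
  map_block v w := (e'.map_block _ _).trans (e.map_block v w)

theorem Iso.block_iff {F G : PForest D} (e : Iso F G) (v w : F.V) :
    G.block (e.toEquiv v) (e.toEquiv w) ↔ F.block v w := e.map_block v w

/-- The disjoint union of partitioned forests. -/
def disj (F G : PForest D) : PForest D where
  toRForest := F.toRForest.disj G.toRForest
  block :=
    { r := Sum.LiftRel F.block G.block
      iseqv := by
        refine ⟨?_, ?_, ?_⟩
        · rintro (v | v)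
          · exact .inl (F.block.refl v)
          · exact .inr (G.block.refl v)
        · rintro _ _ (h | h)
          · exact .inl (F.block.symm h)
          · exact .inr (G.block.symm h)
        · rintro _ _ _ (h | h) (h' | h')
          · exact .inl (F.block.trans h h')
          · exact .inr (G.block.trans h h') }
  block_parent := by
    rintro _ _ (h | h)
    · simp [RForest.disj, F.block_parent _ _ h]
    · simp [RForest.disj, G.block_parent _ _ h]

/-- The restriction to a set of vertices, the blocks being replaced by their traces. -/
noncomputable def restrict (F : PForest D) (S : Set F.V) : PForest D where
  toRForest := F.toRForest.restrict S
  block := F.block.comap fun v : S => (v : F.V)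
  block_parent v w h := by
    have := F.block_parent _ _ h
    simp only [RForest.restrict]
    rw [this]

/-- The product of the partitioned trees which constitute a partitioned forest: all the blocks
of roots are joined into a single one. -/
def merge (F : PForest D) : PTree D where
  toRForest := F.toRForest
  block :=
    { r := fun v w => F.block v w ∨ (F.parent v = none ∧ F.parent w = none)
      iseqv := by
        refine ⟨fun v => .inl (F.block.refl v), ?_, ?_⟩
        · rintro v w (h | h)
          · exact .inl (F.block.symm h)
          · exact .inr h.symm
        · rintro x y z (h | h) (h' | h')
          · exact .inl (F.block.trans h h')
          · exact .inr ⟨(F.block_parent _ _ h).trans h'.1, h'.2⟩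
          · exact .inr ⟨h.1, (F.block_parent _ _ h').symm.trans h.2⟩
          · exact .inr ⟨h.1, h'.2⟩ }
  block_parent := by
    rintro v w (h | h)
    · exact F.block_parent _ _ h
    · rw [h.1, h.2]
  block_root v w hv hw := .inr ⟨hv, hw⟩

/-- For a vertex `v` and a set `I` of vertices, the number of blocks `C` included in `I` such that
there is an edge from `v` to a vertex of `C`. -/
noncomputable def blockCount (F : PForest D) (I : Set F.V) (v : F.V) : ℕ :=
  {C : Set F.V | C ∈ F.block.classes ∧ C ⊆ I ∧ ∃ w ∈ C, F.parent w = some v}.ncard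

theorem Iso.blockCount {F G : PForest D} (e : Iso F G) (I : Set F.V) (v : F.V) :
    G.blockCount (e.toEquiv '' I) (e.toEquiv v) = F.blockCount I v := by
  have key : ∀ C : Set F.V, e.toEquiv '' C ∈ G.block.classes ↔ C ∈ F.block.classes := by
    intro C
    simp only [Setoid.classes, Set.mem_ofPred_eq]
    constructor
    · rintro ⟨y, hy⟩
      obtain ⟨y, rfl⟩ := e.toEquiv.surjective y
      refine ⟨y, ?_⟩
      ext x
      rw [← e.toEquiv.injective.mem_set_image, hy]
      exact e.block_iff x y
    · rintro ⟨y, rfl⟩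
      refine ⟨e.toEquiv y, ?_⟩
      ext x
      obtain ⟨x, rfl⟩ := e.toEquiv.surjective x
      rw [e.toEquiv.injective.mem_set_image]
      exact (e.block_iff x y).symm
  unfold PForest.blockCount
  rw [← Set.ncard_image_of_injective _ e.toEquiv.injective.image_injective]
  congr 1
  ext C
  obtain ⟨C, rfl⟩ := (Equiv.Set.congr e.toEquiv).surjective C
  simp only [Equiv.Set.congr_apply]
  rw [e.toEquiv.injective.image_injective.mem_set_image]
  simp only [Set.mem_ofPred_eq, key, Set.image_subset_image_iff e.toEquiv.injective,
    Set.exists_mem_image, e.parent_iff]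

def Iso.disj {F F' G G' : PForest D} (e : Iso F F') (e' : Iso G G') :
    Iso (F.disj G) (F'.disj G') where
  toIso := e.toIso.disj e'.toIso
  map_block := by
    rintro (v | v) (w | w)
    · exact Sum.liftRel_inl_inl.trans ((e.map_block v w).trans Sum.liftRel_inl_inl.symm)
    · exact iff_of_false Sum.not_liftRel_inl_inr Sum.not_liftRel_inl_inr
    · exact iff_of_false Sum.not_liftRel_inr_inl Sum.not_liftRel_inr_inl
    · exact Sum.liftRel_inr_inr.trans ((e'.map_block v w).trans Sum.liftRel_inr_inr.symm)

/-- Restriction of an isomorphism. -/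
noncomputable def Iso.restrict {F G : PForest D} (e : Iso F G) (S : Set F.V) (S' : Set G.V)
    (h : ∀ v, v ∈ S ↔ e.toEquiv v ∈ S') : Iso (F.restrict S) (G.restrict S') where
  toIso := e.toIso.restrict S S' h
  map_block v w := e.map_block v.1 w.1

def Iso.merge {F G : PForest D} (e : Iso F G) : Iso F.merge.toPForest G.merge.toPForest where
  toIso := e.toIso
  map_block v w :=
    or_congr (e.map_block v w) (and_congr (e.parent_none v) (e.parent_none w))

end PForest

namespace PTree

variable {D : Type u} {E : Type v}

/-- The product `T · T'`: the disjoint union, where the two blocks of roots are joined. -/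
def prod (T T' : PTree D) : PTree D := (T.toPForest.disj T'.toPForest).merge

/-- The empty partitioned tree. -/
def empty (D : Type u) : PTree D where
  toRForest := RForest.empty D
  block := ⊥
  block_parent v := v.elim
  block_root v := v.elim

/-- The partitioned tree with a single vertex, decorated by `d`. -/
def point (d : D) : PTree D where
  V := Unit
  finite := inferInstance
  parent _ := none
  wf := ⟨fun _ => ⟨_, fun _ h => by simp at h⟩⟩
  deco _ := d
  block := ⊤
  block_parent _ _ _ := rfl
  block_root _ _ _ _ := trivial

/-- The grafting of `T'` on the vertex `s` of `T`: edges are added from `s` to the roots of `T'`,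
the block of roots of `T'` being a new block of the result. -/
def graft (T : PTree D) (s : T.V) (T' : PTree D) : PTree D where
  V := T.V ⊕ T'.V
  finite := inferInstance
  parent := Sum.elim (fun v => (T.parent v).map Sum.inl)
    (fun w => some ((T'.parent w).elim (Sum.inl s) Sum.inr))
  wf := by
    refine Subrelation.wf ?_ (Sum.lex_wf T.wf T'.wf)
    rintro (v | v) (w | w) h
    · simp at h ⊢; exact h
    · exact .sep _ _
    · simp at h
    · cases h' : T'.parent w <;> simp [h'] at h ⊢
      exact h
  deco := Sum.elim T.deco T'.deco
  block := (T.toPForest.disj T'.toPForest).block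
  block_parent := by
    rintro _ _ (h | h)
    · simp [T.block_parent _ _ h]
    · simp [T'.block_parent _ _ h]
  block_root := by
    rintro (v | v) (w | w) hv hw <;> simp at hv hw
    exact .inl (T.block_root v w hv hw)

/-- Change of decorations. -/
def mapDeco (f : D → E) (T : PTree D) : PTree E where
  toRForest := T.toRForest.mapDeco f
  block := T.block
  block_parent := T.block_parent
  block_root := T.block_root

open Classical in
/-- For a decoration `(i, d)` of the vertex `s`, replace it by `(i + 1, d)`. -/
noncomputable def raise (T : PTree (ℕ × D)) (s : T.V) : PTree (ℕ × D) where
  V := T.V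
  finite := T.finite
  parent := T.parent
  wf := T.wf
  deco v := if v = s then ((T.deco v).1 + 1, (T.deco v).2) else T.deco v
  block := T.block
  block_parent := T.block_parent
  block_root := T.block_root

/-- `P^I(T)`: the product of the partitioned trees of the restriction of `T` to `I`. -/
noncomputable def P (T : PTree D) (I : T.Ideals) : PTree D := (T.toPForest.restrict I.1).merge

/-- `R^I(T)`: the restriction of `T` to the complement of the ideal `I`, where the decoration
`(i, d)` of `v` becomes `(i + ι, d)`, `ι` being the number of blocks of `T` included in `I` whose
vertices are children of `v`. -/
noncomputable def R (T : PTree (ℕ × D)) (I : T.Ideals) : PTree (ℕ × D) where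
  V := (I.1ᶜ : Set T.V)
  finite := inferInstance
  parent := (T.toPForest.restrict I.1ᶜ).parent
  wf := (T.toPForest.restrict I.1ᶜ).wf
  deco v := ((T.deco v.1).1 + T.blockCount I.1 v.1, (T.deco v.1).2)
  block := (T.toPForest.restrict I.1ᶜ).block
  block_parent := (T.toPForest.restrict I.1ᶜ).block_parent
  block_root v w hv hw := by
    have key : ∀ x : (I.1ᶜ : Set T.V),
        (T.toPForest.restrict I.1ᶜ).parent x = none → T.parent x.1 = none := by
      intro x hx
      by_contra hne
      obtain ⟨y, hy⟩ := Option.ne_none_iff_exists'.mp hne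
      by_cases hyI : y ∈ I.1
      · exact x.2 (I.2 y x.1 hyI hy)
      · have := (T.toRForest.restrict_parent I.1ᶜ ⟨y, hyI⟩ x).2 hy
        simp only [PForest.restrict] at hx
        rw [hx] at this
        cases this
    exact T.block_root v.1 w.1 (key v hv) (key w hw)

/-- Isomorphisms of decorated partitioned trees. -/
abbrev Iso (T T' : PTree D) := T.toPForest.Iso T'.toPForest

def Iso.graft {T S T' S' : PTree D} (e : Iso T S) (e' : Iso T' S') (s : T.V) :
    Iso (T.graft s T') (S.graft (e.toEquiv s) S') where
  toEquiv := e.toEquiv.sumCongr e'.toEquiv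
  map_parent := by
    rintro (v | v)
    · exact (e.toIso.disj e'.toIso).map_parent (Sum.inl v)
    · have h : S'.parent (e'.toEquiv v) = (T'.parent v).map e'.toEquiv := e'.map_parent v
      change some ((S'.parent (e'.toEquiv v)).elim (Sum.inl (e.toEquiv s)) Sum.inr) =
        some (e.toEquiv.sumCongr e'.toEquiv ((T'.parent v).elim (Sum.inl s) Sum.inr))
      rw [h]; cases T'.parent v <;> rfl
  map_deco := (e.toIso.disj e'.toIso).map_deco
  map_block := (PForest.Iso.disj e e').map_block

noncomputable def Iso.raise {T S : PTree (ℕ × D)} (e : Iso T S) (s : T.V) :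
    Iso (T.raise s) (S.raise (e.toEquiv s)) where
  toEquiv := e.toEquiv
  map_parent := e.map_parent
  map_deco v := by
    have h : S.deco (e.toEquiv v) = T.deco v := e.map_deco v
    by_cases hv : v = s
    · exact (if_pos (congrArg e.toEquiv hv)).trans
        ((congrArg (fun p => (p.1 + 1, p.2)) h).trans (if_pos hv).symm)
    · exact (if_neg fun h' => hv (e.toEquiv.injective h')).trans (h.trans (if_neg hv).symm)
  map_block := e.map_block

noncomputable def Iso.P {T S : PTree D} (e : Iso T S) (I : T.Ideals) :
    Iso (T.P I) (S.P (e.toIso.ideals I)) :=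
  (PForest.Iso.restrict e I.1 (e.toIso.ideals I).1 (e.toIso.mem_ideals I)).merge

noncomputable def Iso.R {T S : PTree (ℕ × D)} (e : Iso T S) (I : T.Ideals) :
    Iso (T.R I) (S.R (e.toIso.ideals I)) :=
  let r := PForest.Iso.restrict e I.1ᶜ (e.toIso.ideals I).1ᶜ
    fun v => not_congr (e.toIso.mem_ideals I v)
  { toEquiv := r.toEquiv
    map_parent := r.map_parent
    map_deco := fun v => by
      have h1 : S.deco (e.toEquiv v.1) = T.deco v.1 := e.map_deco v.1
      have h2 := e.blockCount I.1 v.1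
      change ((S.deco (e.toEquiv v.1)).1 + S.blockCount (e.toEquiv '' I.1) (e.toEquiv v.1),
        (S.deco (e.toEquiv v.1)).2) = ((T.deco v.1).1 + T.blockCount I.1 v.1, (T.deco v.1).2)
      rw [h1, h2]
    map_block := r.map_block }

theorem prod_parent_inl (T T' : PTree D) (v : T.V) :
    (T.prod T').parent (Sum.inl v) = none ↔ T.parent v = none :=
  Option.map_eq_none_iff

theorem prod_parent_inr (T T' : PTree D) (v : T'.V) :
    (T.prod T').parent (Sum.inr v) = none ↔ T'.parent v = none :=
  Option.map_eq_none_iff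

theorem prod_block_inl (T T' : PTree D) (v w : T.V) :
    (T.prod T').block (Sum.inl v) (Sum.inl w) ↔ T.block v w := by
  constructor
  · rintro (h | ⟨hv, hw⟩)
    · exact Sum.liftRel_inl_inl.1 h
    · exact T.block_root v w ((T.prod_parent_inl T' v).1 hv) ((T.prod_parent_inl T' w).1 hw)
  · exact fun h => .inl (.inl h)

theorem prod_block_inr (T T' : PTree D) (v w : T'.V) :
    (T.prod T').block (Sum.inr v) (Sum.inr w) ↔ T'.block v w := by
  constructor
  · rintro (h | ⟨hv, hw⟩)
    · exact Sum.liftRel_inr_inr.1 h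
    · exact T'.block_root v w ((T.prod_parent_inr T' v).1 hv) ((T.prod_parent_inr T' w).1 hw)
  · exact fun h => .inl (.inr h)

theorem prod_block_inl_inr (T T' : PTree D) (v : T.V) (w : T'.V) :
    (T.prod T').block (Sum.inl v) (Sum.inr w) ↔ T.parent v = none ∧ T'.parent w = none := by
  rw [← T.prod_parent_inl T', ← T.prod_parent_inr T']
  constructor
  · rintro (h | h)
    · exact (Sum.not_liftRel_inl_inr h).elim
    · exact h
  · exact fun h => .inr h

theorem prod_block_inr_inl (T T' : PTree D) (v : T'.V) (w : T.V) :
    (T.prod T').block (Sum.inr v) (Sum.inl w) ↔ T'.parent v = none ∧ T.parent w = none := by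
  rw [← T.prod_parent_inl T', ← T.prod_parent_inr T']
  constructor
  · rintro (h | h)
    · exact (Sum.not_liftRel_inr_inl h).elim
    · exact h
  · exact fun h => .inr h

/-- Associativity of the product. -/
def prodAssoc (F G H : PTree D) : Iso ((F.prod G).prod H) (F.prod (G.prod H)) where
  toIso := F.toRForest.disjAssoc G.toRForest H.toRForest
  map_block := by
    rintro ((v | v) | v) ((w | w) | w)
    · exact (prod_block_inl _ _ _ _).trans
        ((prod_block_inl _ _ _ _).trans (prod_block_inl _ _ _ _)).symm
    · exact (prod_block_inl_inr _ _ _ _).trans ((and_congr Iff.rfl (prod_parent_inl _ _ _)).trans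
        ((prod_block_inl _ _ _ _).trans (prod_block_inl_inr _ _ _ _)).symm)
    · exact (prod_block_inl_inr _ _ _ _).trans ((and_congr Iff.rfl (prod_parent_inr _ _ _)).trans
        ((prod_block_inl_inr _ _ _ _).trans (and_congr (prod_parent_inl _ _ _) Iff.rfl)).symm)
    · exact (prod_block_inr_inl _ _ _ _).trans ((and_congr (prod_parent_inl _ _ _) Iff.rfl).trans
        ((prod_block_inl _ _ _ _).trans (prod_block_inr_inl _ _ _ _)).symm)
    · exact ((prod_block_inr _ _ _ _).trans (prod_block_inl _ _ _ _)).trans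
        ((prod_block_inl _ _ _ _).trans (prod_block_inr _ _ _ _)).symm
    · exact ((prod_block_inr _ _ _ _).trans (prod_block_inl_inr _ _ _ _)).trans
        ((prod_block_inl_inr _ _ _ _).trans (and_congr (prod_parent_inr _ _ _) Iff.rfl)).symm
    · exact (prod_block_inr_inl _ _ _ _).trans ((and_congr (prod_parent_inr _ _ _) Iff.rfl).trans
        ((prod_block_inr_inl _ _ _ _).trans (and_congr Iff.rfl (prod_parent_inl _ _ _))).symm)
    · exact ((prod_block_inr _ _ _ _).trans (prod_block_inr_inl _ _ _ _)).trans
        ((prod_block_inr_inl _ _ _ _).trans (and_congr Iff.rfl (prod_parent_inr _ _ _))).symm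
    · exact ((prod_block_inr _ _ _ _).trans (prod_block_inr _ _ _ _)).trans
        (prod_block_inr _ _ _ _).symm

/-- Commutativity of the product. -/
def prodComm (F G : PTree D) : Iso (F.prod G) (G.prod F) where
  toIso := F.toRForest.disjComm G.toRForest
  map_block := by
    rintro (v | v) (w | w)
    · exact (prod_block_inr _ _ _ _).trans (prod_block_inl _ _ _ _).symm
    · exact (prod_block_inr_inl _ _ _ _).trans (prod_block_inl_inr _ _ _ _).symm
    · exact (prod_block_inl_inr _ _ _ _).trans (prod_block_inr_inl _ _ _ _).symm
    · exact (prod_block_inl _ _ _ _).trans (prod_block_inr _ _ _ _).symm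

/-- The empty tree is a unit. -/
def prodEmpty (F : PTree D) : Iso (F.prod (empty D)) F where
  toIso := F.toRForest.disjEmpty
  map_block := by
    rintro (v | v) (w | w)
    · exact (prod_block_inl F (empty D) v w).symm
    all_goals first | exact v.elim | exact w.elim

end PTree

/-- Isomorphism of decorated partitioned trees is an equivalence relation. -/
instance PTree.setoid (D : Type u) : Setoid (PTree D) where
  r T S := Nonempty (T.Iso S)
  iseqv := ⟨fun _ => ⟨PForest.Iso.refl _⟩, fun ⟨e⟩ => ⟨PForest.Iso.symm e⟩,
    fun ⟨e⟩ ⟨e'⟩ => ⟨PForest.Iso.trans e e'⟩⟩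

/-- Isoclasses of partitioned trees decorated by `D`. -/
def PT (D : Type u) : Type (max 1 u) := Quotient (PTree.setoid D)

/-- The isoclass of a decorated partitioned tree. -/
def PTree.cls {D : Type u} (T : PTree D) : PT D := Quotient.mk _ T

/-- The monoid of decorated partitioned trees. -/
instance (D : Type u) : CommMonoid (PT D) where
  mul := Quotient.map₂ PTree.prod (fun _ _ ⟨e⟩ _ _ ⟨e'⟩ => ⟨(PForest.Iso.disj e e').merge⟩)
  one := (PTree.empty D).cls
  mul_assoc := by
    rintro ⟨F⟩ ⟨G⟩ ⟨H⟩
    exact Quotient.sound ⟨F.prodAssoc G H⟩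
  mul_comm := by
    rintro ⟨F⟩ ⟨G⟩
    exact Quotient.sound ⟨F.prodComm G⟩
  one_mul := by
    rintro ⟨F⟩
    exact Quotient.sound ⟨((PTree.empty D).prodComm F).trans F.prodEmpty⟩
  mul_one := by
    rintro ⟨F⟩
    exact Quotient.sound ⟨F.prodEmpty⟩

/-! ### The algebra `UCP(D)` -/

/-- The vector space generated by the partitioned trees decorated by `ℕ × D`, with the product
extending that of partitioned trees. -/
abbrev UCP (K : Type w) [Field K] (D : Type u) := MonoidAlgebra K (PT (ℕ × D))

namespace UCP

variable (K : Type w) [Field K] {D : Type u}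

/-- The basis element given by a decorated partitioned tree. -/
noncomputable def of (T : PTree (ℕ × D)) : UCP K D := MonoidAlgebra.single T.cls 1

theorem of_congr {T S : PTree (ℕ × D)} (e : T.Iso S) : of K T = of K S := by
  unfold of
  rw [show T.cls = S.cls from Quotient.sound ⟨e⟩]

open Classical in
/-- The preLie product of two trees: the sum of all graftings of `T'` on the vertices of `T` if
`T'` is not empty, and the sum of all `T[+1]_s` if `T'` is empty. -/
noncomputable def treeBullet (T T' : PTree (ℕ × D)) : UCP K D :=
  if IsEmpty T'.V then ∑ s : T.V, of K (T.raise s) else ∑ s : T.V, of K (T.graft s T')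

theorem treeBullet_congr {T S T' S' : PTree (ℕ × D)} (e : T.Iso S) (e' : T'.Iso S') :
    treeBullet K T T' = treeBullet K S S' := by
  unfold treeBullet
  rw [e'.toEquiv.isEmpty_congr]
  split_ifs
  · exact Fintype.sum_equiv e.toEquiv _ _ fun s => of_congr K (PTree.Iso.raise e s)
  · exact Fintype.sum_equiv e.toEquiv _ _ fun s => of_congr K (PTree.Iso.graft e e' s)

/-- `∑ R^I(T) ⊗ P^I(T)`, the sum being over the ideals of `T`. -/
noncomputable def treeComul (T : PTree (ℕ × D)) : UCP K D ⊗[K] UCP K D :=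
  ∑ I : T.Ideals, of K (T.R I) ⊗ₜ[K] of K (T.P I)

theorem treeComul_congr {T S : PTree (ℕ × D)} (e : T.Iso S) :
    treeComul K T = treeComul K S :=
  Fintype.sum_equiv e.toIso.ideals _ _ fun I => by
    rw [of_congr K (PTree.Iso.R e I), of_congr K (PTree.Iso.P e I)]

variable (D)

/-- The preLie product of `UCP(D)`. -/
noncomputable def bullet : UCP K D →ₗ[K] UCP K D →ₗ[K] UCP K D :=
  (MonoidAlgebra.basis (PT (ℕ × D)) K).constr K fun T =>
    (MonoidAlgebra.basis (PT (ℕ × D)) K).constr K fun T' =>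
      Quotient.lift₂ (s₁ := PTree.setoid _) (s₂ := PTree.setoid _) (treeBullet K)
        (fun _ _ _ _ ⟨e⟩ ⟨e'⟩ => treeBullet_congr K e e') T T'

/-- The coproduct of `UCP(D)`. -/
noncomputable def comul : UCP K D →ₗ[K] UCP K D ⊗[K] UCP K D :=
  (MonoidAlgebra.basis (PT (ℕ × D)) K).constr K fun T =>
    Quotient.lift (s := PTree.setoid _) (treeComul K) (fun _ _ ⟨e⟩ => treeComul_congr K e) T

/-- The counit of `UCP(D)`: the coefficient of the empty tree. -/
noncomputable def counit : UCP K D →ₗ[K] K := by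
  classical
  exact (MonoidAlgebra.basis (PT (ℕ × D)) K).constr K fun T => if T = 1 then 1 else 0

variable {D}

theorem bullet_of (T T' : PTree (ℕ × D)) :
    bullet K D (of K T) (of K T') = treeBullet K T T' := by
  have h : ∀ S : PTree (ℕ × D), of K S = MonoidAlgebra.basis (PT (ℕ × D)) K S.cls := fun _ => rfl
  rw [h, h, bullet, Module.Basis.constr_basis, Module.Basis.constr_basis]
  rfl

/-- On trees, `Δ(T)` is the sum over the ideals `I` of `T` of `R^I(T) ⊗ P^I(T)`. -/
theorem comul_of (T : PTree (ℕ × D)) :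
    comul K D (of K T) = ∑ I : T.Ideals, of K (T.R I) ⊗ₜ[K] of K (T.P I) := by
  have h : ∀ S : PTree (ℕ × D), of K S = MonoidAlgebra.basis (PT (ℕ × D)) K S.cls := fun _ => rfl
  rw [h, comul, Module.Basis.constr_basis]
  rfl

end UCP

/-! ### The quotients `CP(D)` and `H_CK^D` -/

/-- The Com-PreLie ideal `I_f` of `UCP(D)` for `f = Id`: it is generated by the elements
`•_(1,d) - •_(0,d)`. -/
noncomputable def idealId (K : Type w) [Field K] (D : Type u) : Ideal (UCP K D) :=
  idealSpan (UCP.bullet K D)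
    (Set.range fun d : D => UCP.of K (PTree.point (1, d)) - UCP.of K (PTree.point (0, d)))

/-- `CP(D) = UCP(D) / I_f` with `f = Id`. -/
def CP (K : Type w) [Field K] (D : Type u) := UCP K D ⧸ idealId K D

namespace CP

variable (K : Type w) [Field K] (D : Type u)

noncomputable instance : CommRing (CP K D) :=
  inferInstanceAs (CommRing (UCP K D ⧸ idealId K D))

noncomputable instance : Algebra K (CP K D) :=
  inferInstanceAs (Algebra K (UCP K D ⧸ idealId K D))

/-- The quotient map `UCP(D) → CP(D)`. -/
noncomputable def proj : UCP K D →ₐ[K] CP K D := Ideal.Quotient.mkₐ K (idealId K D)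

/-- The preLie product of `CP(D)`. -/
noncomputable def bullet : CP K D →ₗ[K] CP K D →ₗ[K] CP K D :=
  quotientBullet (UCP.bullet K D) (idealId K D) (isComPreLieIdeal_idealSpan _ _)

theorem bullet_proj (x y : UCP K D) :
    bullet K D (proj K D x) (proj K D y) = proj K D (UCP.bullet K D x y) := rfl

variable {D}

/-- The element of `CP(D)` given by a partitioned tree decorated by `D`: the decoration `d` is
identified with `(0, d)`. -/
noncomputable def of (T : PTree D) : CP K D := proj K D (UCP.of K (T.mapDeco fun d => (0, d)))

end CP

/-- The Com-PreLie ideal `J` of `CP(D)` generated by the elements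
`•_d • (F₁ × F₂) - •_d • (F₁ · F₂)`, where `a • (b × c) = (a • b) • c - a • (b • c)`. -/
noncomputable def idealJ (K : Type w) [Field K] (D : Type u) : Ideal (CP K D) :=
  idealSpan (CP.bullet K D)
    {x | ∃ (d : D) (F₁ F₂ : PTree D), x =
      (CP.bullet K D (CP.bullet K D (CP.of K (PTree.point d)) (CP.of K F₁)) (CP.of K F₂)
        - CP.bullet K D (CP.of K (PTree.point d)) (CP.bullet K D (CP.of K F₁) (CP.of K F₂)))
      - CP.bullet K D (CP.of K (PTree.point d)) (CP.of K F₁ * CP.of K F₂)}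

/-- `H_CK^D = CP(D) / J`. -/
def HCK (K : Type w) [Field K] (D : Type u) := CP K D ⧸ idealJ K D

namespace HCK

variable (K : Type w) [Field K] (D : Type u)

noncomputable instance : CommRing (HCK K D) :=
  inferInstanceAs (CommRing (CP K D ⧸ idealJ K D))

noncomputable instance : Algebra K (HCK K D) :=
  inferInstanceAs (Algebra K (CP K D ⧸ idealJ K D))

/-- The quotient map `CP(D) → H_CK^D`. -/
noncomputable def proj : CP K D →ₐ[K] HCK K D := Ideal.Quotient.mkₐ K (idealJ K D)

/-- The preLie product of `H_CK^D`. -/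
noncomputable def bullet : HCK K D →ₗ[K] HCK K D →ₗ[K] HCK K D :=
  quotientBullet (CP.bullet K D) (idealJ K D) (isComPreLieIdeal_idealSpan _ _)

theorem bullet_proj (x y : CP K D) :
    bullet K D (proj K D x) (proj K D y) = proj K D (CP.bullet K D x y) := rfl

end HCK

end ComPreLie

open ComPreLie

/-! The two cases of the preLie product are first made one. The tree `T.ins s T'` is the grafting of
`T'` on `s`, with the integer at `s` raised if `T'` is empty, so that `T • T'` is always the sum of
the insertions of `T'` at the vertices of `T`. The difference `(T • T') • T'' - T • (T' • T'')` then
only keeps the insertions of `T'` and `T''` at two vertices of `T`, which is symmetric in `T'` and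
`T''`. The Leibniz rule holds because the vertices of a product are those of its factors.

An ideal of `T.ins s T'` which contains `s` contains all of `T'`: `R` ignores `T'`, and `P` is an
insertion. An ideal which avoids `s` is a pair of ideals `I` of `T` and `J` of `T'`: `R` is the
insertion of `R^J(T')` in `R^I(T)`, and `P` is a product. The integers agree (`insL_blockCount`):
cutting the whole of a nonempty `T'` removes one block of children of `s`, and inserting the empty
tree `R^J(T')` raises `s` by one. Summing over `s` gives the axiom on `Δ(x • y)`.

Coassociativity and the counit axioms are not checked on trees. They are stable under both products
by formal computations such as `coassoc_bullet`, they hold for the primitive one-vertex trees, and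
these generate `UCP(D)` (`submodule_eq_top`). The generation comes from `PTree.induction`: a tree
with several roots is a product, and a tree with one root is one term of a product `S • T'` whose
other terms have fewer blocks of children of the root.

A quotient inherits the coproduct as soon as the generators of the ideal have coproduct and counit
vanishing in the quotient (`exists_quotient`). For `CP(D)` the generators are differences of
primitive elements with the same image. For `H_CK^D`, the defect `β(a, c) = d • (a × c) - d • (a ·
c)`, with `d` primitive, satisfies `Δ(β(a, c)) = 1 ⊗ β(a, c) + β(a⁽¹⁾, c⁽¹⁾) ⊗ a⁽²⁾c⁽²⁾`, and both
terms vanish in the quotient.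

Forgetting blocks and integers is a surjection from `UCP(D)` to the Connes–Kreimer algebra. It
transports the whole structure, the cocycle property included, and kills both ideals. The induced
map on `H_CK^D` is injective: the defining relation gives `B_d(F) = •_d • F` for every partition of
the forest `F` (`HCK.of_root`), so the class of a tree only depends on its underlying forest
(`HCK.of_eq_of_iso`). The antipode is a geometric series for the convolution product. -/

namespace ComPreLie

/-! ### Isomorphisms described by edges -/

/-- An isomorphism of forests is a bijection which respects edges and decorations. -/
def RForest.Iso.ofEdges {D : Type u} {F G : RForest D} (e : F.V ≃ G.V)
    (hp : ∀ v w, G.parent (e w) = some (e v) ↔ F.parent w = some v)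
    (hd : ∀ v, G.deco (e v) = F.deco v) : F.Iso G where
  toEquiv := e
  map_parent w := by
    refine Option.ext fun x => ?_
    obtain ⟨v, rfl⟩ := e.surjective x
    refine (hp v w).trans ?_
    simp only [Equiv.toFun_as_coe]
    cases F.parent w <;> simp
  map_deco := hd

/-- An isomorphism of partitioned forests is a bijection which respects edges, decorations and
blocks. -/
def PForest.Iso.ofEdges {D : Type u} {F G : PForest D} (e : F.V ≃ G.V)
    (hp : ∀ v w, G.parent (e w) = some (e v) ↔ F.parent w = some v)
    (hd : ∀ v, G.deco (e v) = F.deco v)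
    (hb : ∀ v w, G.block (e v) (e w) ↔ F.block v w) : F.Iso G where
  toIso := .ofEdges e hp hd
  map_block := hb

open Classical in
/-- The truth value of `p`, as an integer. -/
noncomputable def ind (p : Prop) : ℕ := if p then 1 else 0

@[simp] theorem ind_true : ind True = 1 := if_pos trivial

@[simp] theorem ind_false : ind False = 0 := if_neg not_false

namespace PTree

variable {D : Type u}

/-! ### Vertices of a product -/

section Prod

variable (T T' : PTree D)

/-- The inclusion of the vertices of the left factor. -/
def prodL (v : T.V) : (T.prod T').V := Sum.inl v

/-- The inclusion of the vertices of the right factor. -/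
def prodR (v : T'.V) : (T.prod T').V := Sum.inr v

/-- The vertices of a product. -/
def prodEquiv : T.V ⊕ T'.V ≃ (T.prod T').V := Equiv.refl _

variable {T T'}

-- With named inclusions, a case principle and simp rules for `parent`, `deco` and `block`, an
-- isomorphism is checked by cases and `simp`, the underlying sum type staying hidden. The same
-- pattern serves for insertions, `R`, `P`, restrictions and graftings.
@[elab_as_elim]
theorem prod_cases {p : (T.prod T').V → Prop} (hl : ∀ v, p (prodL T T' v))
    (hr : ∀ v, p (prodR T T' v)) (v) : p v := Sum.rec hl hr v

/-- Definition of a function on the vertices of a product. -/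
def prodElim {α : Sort*} (f : T.V → α) (g : T'.V → α) (v : (T.prod T').V) : α :=
  Sum.rec f g v

section
variable {α : Sort*} (f : T.V → α) (g : T'.V → α)
@[simp] theorem prodElim_L (v : T.V) : prodElim f g (prodL T T' v) = f v := rfl
@[simp] theorem prodElim_R (v : T'.V) : prodElim f g (prodR T T' v) = g v := rfl
end

@[simp] theorem prodL_inj {v w : T.V} : prodL T T' v = prodL T T' w ↔ v = w :=
  Sum.inl_injective.eq_iff

@[simp] theorem prodR_inj {v w : T'.V} : prodR T T' v = prodR T T' w ↔ v = w :=
  Sum.inr_injective.eq_iff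

@[simp] theorem prodL_ne {v : T.V} {w : T'.V} : prodL T T' v ≠ prodR T T' w := Sum.inl_ne_inr

@[simp] theorem prodR_ne {v : T.V} {w : T'.V} : prodR T T' w ≠ prodL T T' v := Sum.inr_ne_inl

@[simp] theorem prodL_parent (v : T.V) :
    (T.prod T').parent (prodL T T' v) = (T.parent v).map (prodL T T') := rfl

@[simp] theorem prodR_parent (v : T'.V) :
    (T.prod T').parent (prodR T T' v) = (T'.parent v).map (prodR T T') := rfl

@[simp] theorem prodL_deco (v : T.V) : (T.prod T').deco (prodL T T' v) = T.deco v := rfl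

@[simp] theorem prodR_deco (v : T'.V) : (T.prod T').deco (prodR T T' v) = T'.deco v := rfl

@[simp] theorem prodL_block (v w : T.V) :
    (T.prod T').block (prodL T T' v) (prodL T T' w) ↔ T.block v w := prod_block_inl _ _ _ _

@[simp] theorem prodR_block (v w : T'.V) :
    (T.prod T').block (prodR T T' v) (prodR T T' w) ↔ T'.block v w := prod_block_inr _ _ _ _

@[simp] theorem prodL_block_R (v : T.V) (w : T'.V) :
    (T.prod T').block (prodL T T' v) (prodR T T' w) ↔ T.parent v = none ∧ T'.parent w = none :=
  prod_block_inl_inr _ _ _ _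

@[simp] theorem prodR_block_L (v : T'.V) (w : T.V) :
    (T.prod T').block (prodR T T' v) (prodL T T' w) ↔ T'.parent v = none ∧ T.parent w = none :=
  prod_block_inr_inl _ _ _ _

end Prod

/-! ### Insertions

The insertion of `T'` at `s` is the grafting of `T'` on `s`, where the decoration of `s` is raised
if `T'` is empty: with it the preLie product has the same description for all pairs of trees. -/

/-- The insertion of `T'` at the vertex `s` of `T`. -/
noncomputable def ins (T : PTree (ℕ × D)) (s : T.V) (T' : PTree (ℕ × D)) : PTree (ℕ × D) where
  V := T.V ⊕ T'.V
  finite := inferInstance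
  parent := (T.graft s T').parent
  wf := (T.graft s T').wf
  deco := Sum.elim
    (fun v => ((T.deco v).1 + ind (v = s ∧ IsEmpty T'.V), (T.deco v).2)) T'.deco
  block := (T.graft s T').block
  block_parent := (T.graft s T').block_parent
  block_root := (T.graft s T').block_root

section Ins

variable (T : PTree (ℕ × D)) (s : T.V) (T' : PTree (ℕ × D))

/-- The inclusion of the vertices of the tree in which a tree is inserted. -/
def insL (v : T.V) : (T.ins s T').V := Sum.inl v

/-- The inclusion of the vertices of the inserted tree. -/
def insR (v : T'.V) : (T.ins s T').V := Sum.inr v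

/-- The vertices of an insertion. -/
def insEquiv : T.V ⊕ T'.V ≃ (T.ins s T').V := Equiv.refl _

variable {T s T'}

@[elab_as_elim]
theorem ins_cases {p : (T.ins s T').V → Prop} (hl : ∀ v, p (insL T s T' v))
    (hr : ∀ v, p (insR T s T' v)) (v) : p v := Sum.rec hl hr v

/-- Definition of a function on the vertices of an insertion. -/
def insElim {α : Sort*} (f : T.V → α) (g : T'.V → α) (v : (T.ins s T').V) : α :=
  Sum.rec f g v

section
variable {α : Sort*} (f : T.V → α) (g : T'.V → α)
@[simp] theorem insElim_L (v : T.V) : insElim f g (insL T s T' v) = f v := rfl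
@[simp] theorem insElim_R (v : T'.V) : insElim f g (insR T s T' v) = g v := rfl
end

@[simp] theorem insL_inj {v w : T.V} : insL T s T' v = insL T s T' w ↔ v = w :=
  Sum.inl_injective.eq_iff

@[simp] theorem insR_inj {v w : T'.V} : insR T s T' v = insR T s T' w ↔ v = w :=
  Sum.inr_injective.eq_iff

@[simp] theorem insL_ne {v : T.V} {w : T'.V} : insL T s T' v ≠ insR T s T' w := Sum.inl_ne_inr

@[simp] theorem insR_ne {v : T.V} {w : T'.V} : insR T s T' w ≠ insL T s T' v := Sum.inr_ne_inl

@[simp] theorem insL_parent (v : T.V) :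
    (T.ins s T').parent (insL T s T' v) = (T.parent v).map (insL T s T') := rfl

@[simp] theorem insR_parent (v : T'.V) : (T.ins s T').parent (insR T s T' v) =
    some ((T'.parent v).elim (insL T s T' s) (insR T s T')) := rfl

@[simp] theorem insL_deco (v : T.V) : (T.ins s T').deco (insL T s T' v) =
    ((T.deco v).1 + ind (v = s ∧ IsEmpty T'.V), (T.deco v).2) := rfl

@[simp] theorem insR_deco (v : T'.V) : (T.ins s T').deco (insR T s T' v) = T'.deco v := rfl

@[simp] theorem insL_block (v w : T.V) :
    (T.ins s T').block (insL T s T' v) (insL T s T' w) ↔ T.block v w := Sum.liftRel_inl_inl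

@[simp] theorem insR_block (v w : T'.V) :
    (T.ins s T').block (insR T s T' v) (insR T s T' w) ↔ T'.block v w := Sum.liftRel_inr_inr

@[simp] theorem insL_block_R (v : T.V) (w : T'.V) :
    ¬ (T.ins s T').block (insL T s T' v) (insR T s T' w) := Sum.not_liftRel_inl_inr

@[simp] theorem insR_block_L (v : T'.V) (w : T.V) :
    ¬ (T.ins s T').block (insR T s T' v) (insL T s T' w) := Sum.not_liftRel_inr_inl

@[simp] theorem isEmpty_ins : ¬ IsEmpty (T.ins s T').V := fun h => h.elim (insL T s T' s)

end Ins

/-- Inserting an empty tree raises a decoration. -/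
noncomputable def insIsoRaise (T : PTree (ℕ × D)) (s : T.V) (T' : PTree (ℕ × D))
    [IsEmpty T'.V] : Iso (T.ins s T') (T.raise s) :=
  .ofEdges (Equiv.sumEmpty T.V T'.V)
    (by
      rintro (v | v) (w | w)
      · change T.parent w = some v ↔ (T.parent w).map Sum.inl = some (Sum.inl v)
        simp
      all_goals exact isEmptyElim ‹T'.V›)
    (by
      rintro (v | v)
      · change (T.raise s).deco v = (T.ins s T').deco (insL T s T' v)
        by_cases h : v = s <;> simp [raise, h, ‹IsEmpty T'.V›]
      · exact isEmptyElim v)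
    (by
      rintro (v | v) (w | w)
      · exact (insL_block v w).symm
      all_goals exact isEmptyElim ‹T'.V›)

/-- Inserting a tree which is not empty is grafting it. -/
noncomputable def insIsoGraft (T : PTree (ℕ × D)) (s : T.V) (T' : PTree (ℕ × D))
    [Nonempty T'.V] : Iso (T.ins s T') (T.graft s T') :=
  .ofEdges (Equiv.refl _) (fun _ _ => Iff.rfl)
    (by
      rintro (v | v)
      · change T.deco v = (T.ins s T').deco (insL T s T' v)
        simp
      · rfl)
    (fun _ _ => Iff.rfl)

noncomputable def Iso.ins {T S T' S' : PTree (ℕ × D)} (e : Iso T S) (e' : Iso T' S') (s : T.V) :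
    Iso (T.ins s T') (S.ins (e.toEquiv s) S') where
  toEquiv := e.toEquiv.sumCongr e'.toEquiv
  map_parent := (Iso.graft e e' s).map_parent
  map_deco := by
    rintro (v | v)
    · have h : S.deco (e.toEquiv v) = T.deco v := e.map_deco v
      have h' : e.toEquiv v = e.toEquiv s ↔ v = s := e.toEquiv.apply_eq_iff_eq
      change (S.ins (e.toEquiv s) S').deco (insL S _ S' (e.toEquiv v)) =
        (T.ins s T').deco (insL T s T' v)
      simp [h, h', e'.toEquiv.isEmpty_congr]
    · exact e'.map_deco v
  map_block := (Iso.graft e e' s).map_block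

/-- Insertions at two vertices commute. -/
noncomputable def insInsL (T : PTree (ℕ × D)) (s s' : T.V) (T' T'' : PTree (ℕ × D)) :
    Iso ((T.ins s T').ins (insL T s T' s') T'') ((T.ins s' T'').ins (insL T s' T'' s) T') :=
  .ofEdges
    { toFun := insElim (insElim (fun v => insL _ _ _ (insL _ _ _ v)) (fun v => insR _ _ _ v))
        (fun v => insL _ _ _ (insR _ _ _ v))
      invFun := insElim (insElim (fun v => insL _ _ _ (insL _ _ _ v)) (fun v => insR _ _ _ v))
        (fun v => insL _ _ _ (insR _ _ _ v))
      left_inv := ins_cases (ins_cases (by simp) (by simp)) (by simp)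
      right_inv := ins_cases (ins_cases (by simp) (by simp)) (by simp) }
    (by
      refine ins_cases (ins_cases ?_ ?_) ?_ <;> intro v <;>
        refine ins_cases (ins_cases ?_ ?_) ?_ <;> intro w <;> simp
      all_goals first | cases T'.parent w | cases T''.parent w
      all_goals simp)
    (by
      refine ins_cases (ins_cases ?_ ?_) ?_ <;> intro v <;> simp
      -- Each of the two insertions may raise a vertex of `T`; the two increments commute.
      exact add_right_comm _ _ _)
    (by
      refine ins_cases (ins_cases ?_ ?_) ?_ <;> intro v <;>
        refine ins_cases (ins_cases ?_ ?_) ?_ <;> intro w <;> simp)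

/-- Insertion in the inserted tree. -/
noncomputable def insInsR (T : PTree (ℕ × D)) (s : T.V) (T' : PTree (ℕ × D)) (t : T'.V)
    (T'' : PTree (ℕ × D)) :
    Iso ((T.ins s T').ins (insR T s T' t) T'') (T.ins s (T'.ins t T'')) :=
  -- As `T'` contains `t`, neither `T'` nor `T'.ins t T''` is empty, so no vertex of `T` is raised;
  -- a raise due to an empty `T''` happens at `t` on both sides.
  haveI : Nonempty T'.V := ⟨t⟩
  .ofEdges
    { toFun := insElim (insElim (fun v => insL _ _ _ v) (fun v => insR _ _ _ (insL _ _ _ v)))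
        (fun v => insR _ _ _ (insR _ _ _ v))
      invFun := insElim (fun v => insL _ _ _ (insL _ _ _ v))
        (insElim (fun v => insL _ _ _ (insR _ _ _ v)) (fun v => insR _ _ _ v))
      left_inv := ins_cases (ins_cases (by simp) (by simp)) (by simp)
      right_inv := ins_cases (by simp) (ins_cases (by simp) (by simp)) }
    (by
      refine ins_cases (ins_cases ?_ ?_) ?_ <;> intro v <;>
        refine ins_cases (ins_cases ?_ ?_) ?_ <;> intro w <;> simp
      all_goals first | cases T'.parent w | cases T''.parent w
      all_goals simp)
    (by
      refine ins_cases (ins_cases ?_ ?_) ?_ <;> intro v <;> simp)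
    (by
      refine ins_cases (ins_cases ?_ ?_) ?_ <;> intro v <;>
        refine ins_cases (ins_cases ?_ ?_) ?_ <;> intro w <;> simp)

/-- Insertion in the left factor of a product. -/
noncomputable def prodIns (T S : PTree (ℕ × D)) (s : T.V) (T' : PTree (ℕ × D)) :
    Iso ((T.prod S).ins (prodL T S s) T') ((T.ins s T').prod S) :=
  .ofEdges
    { toFun := insElim (prodElim (fun v => prodL _ _ (insL _ _ _ v)) (fun v => prodR _ _ v))
        (fun v => prodL _ _ (insR _ _ _ v))
      invFun := prodElim (insElim (fun v => insL _ _ _ (prodL _ _ v)) (fun v => insR _ _ _ v))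
        (fun v => insL _ _ _ (prodR _ _ v))
      left_inv := ins_cases (prod_cases (by simp) (by simp)) (by simp)
      right_inv := prod_cases (ins_cases (by simp) (by simp)) (by simp) }
    (by
      refine ins_cases (prod_cases ?_ ?_) ?_ <;> intro v <;>
        refine ins_cases (prod_cases ?_ ?_) ?_ <;> intro w <;> simp
      all_goals cases T'.parent w
      all_goals simp)
    (by
      refine ins_cases (prod_cases ?_ ?_) ?_ <;> intro v <;> simp)
    (by
      refine ins_cases (prod_cases ?_ ?_) ?_ <;> intro v <;>
        refine ins_cases (prod_cases ?_ ?_) ?_ <;> intro w <;> simp)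

end PTree

/-! ### The Com-PreLie algebra `UCP(D)` -/

namespace UCP

open PTree

variable {K : Type w} [Field K] {D : Type u}

theorem of_eq_basis (T : PTree (ℕ × D)) :
    of K T = MonoidAlgebra.basis (PT (ℕ × D)) K T.cls := rfl

theorem of_mul (T T' : PTree (ℕ × D)) : of K T * of K T' = of K (T.prod T') := by
  unfold of
  rw [MonoidAlgebra.single_mul_single, one_mul]
  rfl

theorem one_eq : (1 : UCP K D) = of K (PTree.empty (ℕ × D)) := rfl

theorem of_isEmpty (T : PTree (ℕ × D)) [IsEmpty T.V] : of K T = 1 := by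
  rw [one_eq]
  exact of_congr K (PForest.Iso.ofEdges (Equiv.equivOfIsEmpty T.V Empty) (fun v => isEmptyElim v)
    (fun v => isEmptyElim v) (fun v => isEmptyElim v))

@[elab_as_elim]
theorem induction_on {p : UCP K D → Prop} (x : UCP K D) (of : ∀ T, p (of K T))
    (add : ∀ x y, p x → p y → p (x + y)) (smul : ∀ (c : K) x, p x → p (c • x)) : p x := by
  induction (MonoidAlgebra.basis (PT (ℕ × D)) K).mem_span x using Submodule.span_induction with
  | zero => simpa using smul 0 _ (of (PTree.empty _))
  | add x y _ _ hx hy => exact add x y hx hy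
  | smul c x _ hx => exact smul c x hx
  | mem x h =>
    obtain ⟨T, rfl⟩ := h
    obtain ⟨T, rfl⟩ := Quotient.exists_rep T
    exact of T

/-- The case distinction on the emptiness of `T'` is absorbed by the decorations of `ins`. -/
theorem bullet_of_eq_sum (T T' : PTree (ℕ × D)) :
    bullet K D (of K T) (of K T') = ∑ s : T.V, of K (T.ins s T') := by
  rw [bullet_of, treeBullet]
  split_ifs with h
  · exact Finset.sum_congr rfl fun s _ => (of_congr K (insIsoRaise T s T')).symm
  · rw [not_isEmpty_iff] at h
    exact Finset.sum_congr rfl fun s _ => (of_congr K (insIsoGraft T s T')).symm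

theorem sum_ins {M : Type*} [AddCommMonoid M] (T T' : PTree (ℕ × D)) (s : T.V)
    (f : (T.ins s T').V → M) :
    ∑ v, f v = ∑ v, f (insL T s T' v) + ∑ v, f (insR T s T' v) :=
  (Equiv.sum_comp (insEquiv T s T') f).symm.trans
    (Fintype.sum_sum_type _)

theorem sum_prod {M : Type*} [AddCommMonoid M] (T T' : PTree (ℕ × D))
    (f : (T.prod T').V → M) :
    ∑ v, f v = ∑ v, f (prodL T T' v) + ∑ v, f (prodR T T' v) :=
  (Equiv.sum_comp (prodEquiv T T') f).symm.trans
    (Fintype.sum_sum_type _)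

/-- Inserting `T''` at a vertex of `T'` inside `T.ins s T'` is inserting a term of `T' • T''` in
`T`. These terms cancel, and only the insertions at vertices of `T` remain. The formula also
evaluates the generators of the ideal `J`. -/
theorem bullet_bullet_sub (T T' T'' : PTree (ℕ × D)) :
    bullet K D (bullet K D (of K T) (of K T')) (of K T'')
      - bullet K D (of K T) (bullet K D (of K T') (of K T'')) =
    ∑ s : T.V, ∑ s' : T.V, of K ((T.ins s T').ins (insL T s T' s') T'') := by
  rw [sub_eq_iff_eq_add]
  simp only [bullet_of_eq_sum, map_sum, LinearMap.sum_apply, sum_ins, Finset.sum_add_distrib]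
  congr 1
  rw [Finset.sum_comm]
  exact Finset.sum_congr rfl fun t _ => Finset.sum_congr rfl fun s _ =>
    of_congr K (insInsR T s T' t T'')

theorem bullet_preLie (x y z : UCP K D) :
    bullet K D (bullet K D x y) z - bullet K D x (bullet K D y z) =
      bullet K D (bullet K D x z) y - bullet K D x (bullet K D z y) := by
  induction x using induction_on with
  | add x x' h h' =>
    simp only [map_add, LinearMap.add_apply, add_sub_add_comm, h, h']
  | smul c x h => simp only [map_smul, LinearMap.smul_apply, ← smul_sub, h]
  | of T =>
  induction y using induction_on with
  | add x x' h h' =>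
    simp only [map_add, LinearMap.add_apply, add_sub_add_comm, h, h']
  | smul c x h => simp only [map_smul, LinearMap.smul_apply, ← smul_sub, h]
  | of T' =>
  induction z using induction_on with
  | add x x' h h' =>
    simp only [map_add, LinearMap.add_apply, add_sub_add_comm, h, h']
  | smul c x h => simp only [map_smul, LinearMap.smul_apply, ← smul_sub, h]
  | of T'' =>
  -- The double sum over pairs of vertices of `T` is symmetric in the two inserted trees.
  rw [bullet_bullet_sub, bullet_bullet_sub, Finset.sum_comm]
  exact Finset.sum_congr rfl fun t _ => Finset.sum_congr rfl fun s _ =>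
    of_congr K (insInsL T s t T' T'')

theorem bullet_leibniz (x y z : UCP K D) :
    bullet K D (x * y) z = bullet K D x z * y + x * bullet K D y z := by
  induction x using induction_on with
  | add x x' h h' =>
    simp only [map_add, LinearMap.add_apply, add_mul, h, h']; abel
  | smul c x h => simp only [map_smul, LinearMap.smul_apply, smul_mul_assoc, h, smul_add]
  | of T =>
  induction y using induction_on with
  | add x x' h h' =>
    simp only [map_add, LinearMap.add_apply, mul_add, h, h']; abel
  | smul c x h =>
    simp only [map_smul, LinearMap.smul_apply, mul_smul_comm, h, smul_add]
  | of T' =>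
  induction z using induction_on with
  | add x x' h h' =>
    simp only [map_add, add_mul, mul_add, h, h']; abel
  | smul c x h => simp only [map_smul, smul_mul_assoc, mul_smul_comm, h, smul_add]
  | of T'' =>
  simp only [of_mul, bullet_of_eq_sum, sum_prod, Finset.sum_mul, Finset.mul_sum]
  congr 1
  · exact Finset.sum_congr rfl fun s _ => of_congr K (prodIns T T' s T'')
  · refine Finset.sum_congr rfl fun s _ => ?_
    -- Insertion in the right factor reduces to insertion in the left one by commutativity.
    rw [← of_mul, mul_comm, of_mul]
    refine (of_congr K ?_).trans (of_congr K (prodIns T' T s T''))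
    exact Iso.ins (prodComm T T') (PForest.Iso.refl T''.toPForest) (prodR T T' s)

theorem isComPreLieAlgebra : IsComPreLieAlgebra K (bullet K D) where
  preLie := bullet_preLie
  leibniz := bullet_leibniz

end UCP

/-- A forest which is not empty has a root. -/
theorem RForest.exists_root {D : Type u} (F : RForest D) [Nonempty F.V] :
    ∃ v, F.parent v = none := by
  by_contra! h
  have : ∀ v : F.V, False := by
    intro v
    induction v using F.wf.induction with
    | _ v ih =>
    obtain ⟨w, hw⟩ := Option.ne_none_iff_exists'.1 (h v)
    exact ih w hw
  exact this (Classical.arbitrary _)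

/-! ### Counting blocks -/

namespace PForest

variable {D : Type u} {E : Type v}

/-- `w` is a child of `v` and its block is included in `I`. -/
def IsChildIn (F : PForest D) (I : Set F.V) (v w : F.V) : Prop :=
  F.parent w = some v ∧ ∀ x, F.block x w → x ∈ I

/-- A block with one child of `v` consists of children of `v`, so the blocks counted are the classes
of the children of `v` whose class lies in `I`. -/
theorem blockCount_eq_ncard_image (F : PForest D) (I : Set F.V) (v : F.V) :
    F.blockCount I v = ((fun w => {x | F.block x w}) '' {w | F.IsChildIn I v w}).ncard := by
  unfold blockCount
  congr 1
  ext C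
  constructor
  · rintro ⟨⟨y, rfl⟩, hI, w, hw, hv⟩
    have hwy : F.block w y := hw
    refine ⟨y, ⟨?_, fun x hx => hI hx⟩, rfl⟩
    rw [← F.block_parent _ _ hwy, hv]
  · rintro ⟨w, ⟨hw, hI⟩, rfl⟩
    exact ⟨⟨w, rfl⟩, hI, w, F.block.refl w, hw⟩

theorem setOf_block_eq_iff (F : PForest D) (v w : F.V) :
    {x | F.block x v} = {x | F.block x w} ↔ F.block v w := by
  constructor
  · intro h
    have : v ∈ {x | F.block x v} := F.block.refl v
    rw [h] at this
    exact this
  · intro h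
    ext x
    exact ⟨fun h' => F.block.trans h' h, fun h' => F.block.trans h' (F.block.symm h)⟩

section

variable {F : PForest D} {G : PForest E} {I : Set F.V} {J : Set G.V} {v : F.V} {u : G.V}
  (f : F.V → G.V)

/-- When `f` preserves and reflects the block relation among the children of `v`, classes of
children correspond bijectively to classes of their images. The classes in `G` may be larger than
the images of those in `F`. -/
theorem ncard_image_block
    (hb : ∀ a b, F.parent a = some v → F.parent b = some v → (G.block (f a) (f b) ↔ F.block a b)) :
    ((fun w => {y | G.block y (f w)}) '' {w | F.IsChildIn I v w}).ncard = F.blockCount I v := by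
  rw [blockCount_eq_ncard_image]
  symm
  refine Set.ncard_congr (fun C _ => {y | ∃ a ∈ C, F.parent a = some v ∧ G.block y (f a)}) ?_ ?_ ?_
  · rintro _ ⟨w, hw, rfl⟩
    refine ⟨w, hw, ?_⟩
    ext y
    constructor
    · exact fun h => ⟨w, F.block.refl w, hw.1, h⟩
    · rintro ⟨a, ha, hav, h⟩
      exact G.block.trans h ((hb a w hav hw.1).2 ha)
  · rintro _ _ ⟨w, hw, rfl⟩ ⟨w', hw', rfl⟩ h
    have : f w ∈ {y | ∃ a ∈ {x | F.block x w'}, F.parent a = some v ∧ G.block y (f a)} := by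
      rw [← h]; exact ⟨w, F.block.refl w, hw.1, G.block.refl _⟩
    obtain ⟨a, ha, hav, h⟩ := this
    exact (F.setOf_block_eq_iff _ _).2 (F.block.trans ((hb w a hw.1 hav).1 h) ha)
  · rintro _ ⟨w, hw, rfl⟩
    refine ⟨_, ⟨w, hw, rfl⟩, ?_⟩
    ext y
    constructor
    · rintro ⟨a, ha, hav, h⟩
      exact G.block.trans h ((hb a w hav hw.1).2 ha)
    · exact fun h => ⟨w, F.block.refl w, hw.1, h⟩

/-- It is enough that `f` meets every block counted in `G`; it need not reach every vertex. -/
theorem blockCount_congr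
    (hb : ∀ a b, F.parent a = some v → F.parent b = some v → (G.block (f a) (f b) ↔ F.block a b))
    (hf : ∀ a, F.IsChildIn I v a → G.IsChildIn J u (f a))
    (hs : ∀ w, G.IsChildIn J u w → ∃ a, F.IsChildIn I v a ∧ G.block (f a) w) :
    G.blockCount J u = F.blockCount I v := by
  rw [← ncard_image_block f hb, blockCount_eq_ncard_image]
  congr 1
  ext C
  constructor
  · rintro ⟨w, hw, rfl⟩
    obtain ⟨a, ha, h⟩ := hs w hw
    exact ⟨a, ha, (G.setOf_block_eq_iff _ _).2 h⟩
  · rintro ⟨a, ha, rfl⟩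
    exact ⟨f a, hf a ha, rfl⟩

/-- Here `f` misses exactly one counted block, that of `z`. This is the situation of a grafted tree
whose roots form a new block of children. -/
theorem blockCount_eq_add_one
    (hb : ∀ a b, F.parent a = some v → F.parent b = some v → (G.block (f a) (f b) ↔ F.block a b))
    (hf : ∀ a, F.IsChildIn I v a → G.IsChildIn J u (f a))
    (z : G.V) (hz : G.IsChildIn J u z) (hfz : ∀ a, ¬ G.block (f a) z)
    (hs : ∀ w, G.IsChildIn J u w → (∃ a, F.IsChildIn I v a ∧ G.block (f a) w) ∨ G.block z w) :
    G.blockCount J u = F.blockCount I v + 1 := by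
  rw [← ncard_image_block f hb, blockCount_eq_ncard_image,
    ← Set.ncard_insert_of_notMem (a := {x | G.block x z})]
  · congr 1
    ext C
    constructor
    · rintro ⟨w, hw, rfl⟩
      obtain ⟨a, ha, h⟩ | h := hs w hw
      · exact .inr ⟨a, ha, (G.setOf_block_eq_iff _ _).2 h⟩
      · exact .inl ((G.setOf_block_eq_iff _ _).2 (G.block.symm h))
    · rintro (rfl | ⟨a, ha, rfl⟩)
      · exact ⟨z, hz, rfl⟩
      · exact ⟨f a, hf a ha, rfl⟩
  · rintro ⟨a, -, h⟩
    exact hfz a ((G.setOf_block_eq_iff _ _).1 h)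

end

/-- A bijective map which respects edges, decorations and blocks gives an isomorphism. -/
noncomputable def Iso.ofBijective {F G : PForest D} (e : F.V → G.V) (he : Function.Bijective e)
    (hp : ∀ v w, G.parent (e w) = some (e v) ↔ F.parent w = some v)
    (hd : ∀ v, G.deco (e v) = F.deco v)
    (hb : ∀ v w, G.block (e v) (e w) ↔ F.block v w) : F.Iso G :=
  .ofEdges (Equiv.ofBijective e he) hp hd hb

end PForest

namespace PTree

variable {D : Type u}

/-! ### Vertices of `R^I(T)` and `P^I(T)` -/

section R

variable (T : PTree (ℕ × D)) (I : T.Ideals)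

/-- The vertices of `R^I(T)`. -/
def RV (v : T.V) (h : v ∉ I.1) : (T.R I).V := ⟨v, h⟩

variable {T I}

@[elab_as_elim]
theorem R_cases {p : (T.R I).V → Prop} (hp : ∀ v h, p (RV T I v h)) (v) : p v := hp v.1 v.2

/-- Definition of a function on the vertices of `R^I(T)`. -/
def RElim {α : Sort*} (f : ∀ v, v ∉ I.1 → α) (v : (T.R I).V) : α := f v.1 v.2

@[simp] theorem RElim_RV {α : Sort*} (f : ∀ v, v ∉ I.1 → α) (v : T.V) (h : v ∉ I.1) :
    RElim f (RV T I v h) = f v h := rfl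

@[simp] theorem RV_inj {v w : T.V} {h : v ∉ I.1} {h' : w ∉ I.1} :
    RV T I v h = RV T I w h' ↔ v = w := Subtype.mk_eq_mk

@[simp] theorem RV_parent {v w : T.V} {h : v ∉ I.1} {h' : w ∉ I.1} :
    (T.R I).parent (RV T I w h') = some (RV T I v h) ↔ T.parent w = some v :=
  T.toRForest.restrict_parent _ _ _

-- Removing an ideal creates no root, since the parent of a vertex outside an ideal is outside it.
@[simp] theorem RV_parent_none {w : T.V} {h : w ∉ I.1} :
    (T.R I).parent (RV T I w h) = none ↔ T.parent w = none := by
  constructor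
  · intro h'
    cases hw : T.parent w with
    | none => rfl
    | some v =>
      have hv : v ∉ I.1 := fun hv => h (I.2 v w hv hw)
      rw [← RV_parent (h := hv) (h' := h), h'] at hw
      cases hw
  · intro h'
    cases hw : (T.R I).parent (RV T I w h) with
    | none => rfl
    | some v =>
      induction v using R_cases with
      | hp v hv =>
      rw [RV_parent, h'] at hw
      cases hw

@[simp] theorem RV_deco {v : T.V} {h : v ∉ I.1} : (T.R I).deco (RV T I v h) =
    ((T.deco v).1 + T.blockCount I.1 v, (T.deco v).2) := rfl

@[simp] theorem RV_block {v w : T.V} {h : v ∉ I.1} {h' : w ∉ I.1} :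
    (T.R I).block (RV T I v h) (RV T I w h') ↔ T.block v w := Iff.rfl

end R

section P

variable (T : PTree D) (I : T.Ideals)

/-- The vertices of `P^I(T)`. -/
def PV (v : T.V) (h : v ∈ I.1) : (T.P I).V := ⟨v, h⟩

variable {T I}

@[elab_as_elim]
theorem P_cases {p : (T.P I).V → Prop} (hp : ∀ v h, p (PV T I v h)) (v) : p v := hp v.1 v.2

/-- Definition of a function on the vertices of `P^I(T)`. -/
def PElim {α : Sort*} (f : ∀ v, v ∈ I.1 → α) (v : (T.P I).V) : α := f v.1 v.2

@[simp] theorem PElim_PV {α : Sort*} (f : ∀ v, v ∈ I.1 → α) (v : T.V) (h : v ∈ I.1) :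
    PElim f (PV T I v h) = f v h := rfl

@[simp] theorem PV_inj {v w : T.V} {h : v ∈ I.1} {h' : w ∈ I.1} :
    PV T I v h = PV T I w h' ↔ v = w := Subtype.mk_eq_mk

@[simp] theorem PV_parent {v w : T.V} {h : v ∈ I.1} {h' : w ∈ I.1} :
    (T.P I).parent (PV T I w h') = some (PV T I v h) ↔ T.parent w = some v :=
  T.toRForest.restrict_parent _ _ _

-- Contrary to `R`, the restriction to an ideal creates roots: the vertices cut from a parent
-- outside `I`.
@[simp] theorem PV_parent_none {w : T.V} {h : w ∈ I.1} :
    (T.P I).parent (PV T I w h) = none ↔ (T.parent w).elim True (· ∉ I.1) := by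
  cases hw : T.parent w with
  | none =>
    cases hw' : (T.P I).parent (PV T I w h) with
    | none => simp
    | some v =>
      induction v using P_cases with
      | hp v hv =>
      rw [PV_parent, hw] at hw'
      cases hw'
  | some v =>
    by_cases hv : v ∈ I.1
    · rw [PV_parent (h := hv) (h' := h) |>.2 hw]
      simpa using hv
    · cases hw' : (T.P I).parent (PV T I w h) with
      | none => simpa using hv
      | some x =>
        induction x using P_cases with
        | hp x hx =>
        rw [PV_parent, hw] at hw'
        cases hw'
        exact (hv hx).elim

@[simp] theorem PV_deco {v : T.V} {h : v ∈ I.1} : (T.P I).deco (PV T I v h) = T.deco v := rfl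

@[simp] theorem PV_block {v w : T.V} {h : v ∈ I.1} {h' : w ∈ I.1} :
    (T.P I).block (PV T I v h) (PV T I w h') ↔ T.block v w ∨
      ((T.parent v).elim True (· ∉ I.1) ∧ (T.parent w).elim True (· ∉ I.1)) := by
  rw [← PV_parent_none (h := h), ← PV_parent_none (h := h')]
  exact Iff.rfl

end P

end PTree

namespace PTree

variable {D : Type u}

/-! ### Ideals of a product -/

section Prod

variable {T T' : PTree (ℕ × D)}

/-- The union of two ideals. -/
def prodIdeal (I : T.Ideals) (J : T'.Ideals) : (T.prod T').Ideals :=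
  ⟨{v | prodElim (· ∈ I.1) (· ∈ J.1) v}, by
    refine prod_cases ?_ ?_ <;> intro v <;> refine prod_cases ?_ ?_ <;> intro w <;> simp
    · exact I.2 v w
    · exact J.2 v w⟩

@[simp] theorem prodL_mem {I : T.Ideals} {J : T'.Ideals} {v : T.V} :
    prodL T T' v ∈ (prodIdeal I J).1 ↔ v ∈ I.1 := Iff.rfl

@[simp] theorem prodR_mem {I : T.Ideals} {J : T'.Ideals} {v : T'.V} :
    prodR T T' v ∈ (prodIdeal I J).1 ↔ v ∈ J.1 := Iff.rfl

variable (T T') in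
/-- The ideals of a product are the unions of two ideals. -/
def prodIdealsEquiv : T.Ideals × T'.Ideals ≃ (T.prod T').Ideals where
  toFun p := prodIdeal p.1 p.2
  invFun I := (⟨{v | prodL T T' v ∈ I.1}, fun v w hv hw => I.2 _ _ hv (by simp [hw])⟩,
    ⟨{v | prodR T T' v ∈ I.1}, fun v w hv hw => I.2 _ _ hv (by simp [hw])⟩)
  left_inv _ := rfl
  right_inv I := by
    refine Subtype.ext (Set.ext ?_)
    refine prod_cases ?_ ?_ <;> intro v <;> rfl

/-- The product only joins blocks of roots, while the blocks counted at `v` consist of children of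
`v`. -/
theorem prodL_blockCount (I : T.Ideals) (J : T'.Ideals) (v : T.V) :
    (T.prod T').blockCount (prodIdeal I J).1 (prodL T T' v) = T.blockCount I.1 v := by
  refine PForest.blockCount_congr (prodL T T') (by simp) ?_ ?_
  · rintro a ⟨ha, h⟩
    refine ⟨by simp [ha], ?_⟩
    refine prod_cases ?_ ?_ <;> intro x <;> simp [ha]
    exact h x
  · refine prod_cases ?_ ?_ <;> rintro w ⟨hw, h⟩ <;> simp at hw
    exact ⟨w, ⟨hw, fun x hx => h (prodL T T' x) (by simpa using hx)⟩, by simp [Setoid.refl]⟩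

theorem prodR_blockCount (I : T.Ideals) (J : T'.Ideals) (v : T'.V) :
    (T.prod T').blockCount (prodIdeal I J).1 (prodR T T' v) = T'.blockCount J.1 v := by
  refine PForest.blockCount_congr (prodR T T') (by simp) ?_ ?_
  · rintro a ⟨ha, h⟩
    refine ⟨by simp [ha], ?_⟩
    refine prod_cases ?_ ?_ <;> intro x <;> simp [ha]
    exact h x
  · refine prod_cases ?_ ?_ <;> rintro w ⟨hw, h⟩ <;> simp at hw
    exact ⟨w, ⟨hw, fun x hx => h (prodR T T' x) (by simpa using hx)⟩, by simp [Setoid.refl]⟩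

/-- `R` is multiplicative. -/
noncomputable def prodIsoR (I : T.Ideals) (J : T'.Ideals) :
    Iso ((T.R I).prod (T'.R J)) ((T.prod T').R (prodIdeal I J)) :=
  .ofBijective
    (prodElim (RElim fun v h => RV _ _ (prodL T T' v) (mt prodL_mem.1 h))
      (RElim fun v h => RV _ _ (prodR T T' v) (mt prodR_mem.1 h)))
    ⟨by
      refine prod_cases (R_cases ?_) (R_cases ?_) <;> intro v hv <;>
        refine prod_cases (R_cases ?_) (R_cases ?_) <;> intro w hw <;> simp,
    by
      refine R_cases (prod_cases ?_ ?_)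
      · intro v h
        exact ⟨prodL _ _ (RV T I v h), rfl⟩
      · intro v h
        exact ⟨prodR _ _ (RV T' J v h), rfl⟩⟩
    (by
      refine prod_cases (R_cases ?_) (R_cases ?_) <;> intro v hv <;>
        refine prod_cases (R_cases ?_) (R_cases ?_) <;> intro w hw <;> simp)
    (by
      refine prod_cases (R_cases ?_) (R_cases ?_) <;> intro v hv <;>
        simp [prodL_blockCount, prodR_blockCount])
    (by
      refine prod_cases (R_cases ?_) (R_cases ?_) <;> intro v hv <;>
        refine prod_cases (R_cases ?_) (R_cases ?_) <;> intro w hw <;> simp)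

/-- `P` is multiplicative. -/
noncomputable def prodIsoP (I : T.Ideals) (J : T'.Ideals) :
    Iso ((T.P I).prod (T'.P J)) ((T.prod T').P (prodIdeal I J)) :=
  .ofBijective
    (prodElim (PElim fun v h => PV _ _ (prodL T T' v) (prodL_mem.2 h))
      (PElim fun v h => PV _ _ (prodR T T' v) (prodR_mem.2 h)))
    ⟨by
      refine prod_cases (P_cases ?_) (P_cases ?_) <;> intro v hv <;>
        refine prod_cases (P_cases ?_) (P_cases ?_) <;> intro w hw <;> simp,
    by
      refine P_cases (prod_cases ?_ ?_)
      · intro v h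
        exact ⟨prodL _ _ (PV T I v h), rfl⟩
      · intro v h
        exact ⟨prodR _ _ (PV T' J v h), rfl⟩⟩
    (by
      refine prod_cases (P_cases ?_) (P_cases ?_) <;> intro v hv <;>
        refine prod_cases (P_cases ?_) (P_cases ?_) <;> intro w hw <;> simp)
    (by
      refine prod_cases (P_cases ?_) (P_cases ?_) <;> intro v hv <;> simp)
    (by
      refine prod_cases (P_cases ?_) (P_cases ?_) <;> intro v hv <;>
        refine prod_cases (P_cases ?_) (P_cases ?_) <;> intro w hw <;>
        simp [Function.comp_def]
      all_goals
        rintro h h'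
        simp [h, h'])

end Prod

/-! ### Ideals of an insertion -/

section Ins

variable {T : PTree (ℕ × D)} {s : T.V} {T' : PTree (ℕ × D)}

/-- The union of an ideal `I` and of the vertices of the inserted tree. -/
def insIdealUniv (s : T.V) (T' : PTree (ℕ × D)) (I : T.Ideals) : (T.ins s T').Ideals :=
  ⟨{v | insElim (· ∈ I.1) (fun _ => True) v}, by
    refine ins_cases ?_ ?_ <;> intro v <;> refine ins_cases ?_ ?_ <;> intro w <;> simp
    exact I.2 v w⟩

/-- The union of an ideal `I`, which does not contain the vertex `s`, and of an ideal of the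
inserted tree. -/
def insIdeal (I : T.Ideals) (hs : s ∉ I.1) (J : T'.Ideals) : (T.ins s T').Ideals :=
  ⟨{v | insElim (· ∈ I.1) (· ∈ J.1) v}, by
    refine ins_cases ?_ ?_ <;> intro v <;> refine ins_cases ?_ ?_ <;> intro w <;> simp
    · exact I.2 v w
    · cases T'.parent w <;> simp
      rintro h rfl
      exact (hs h).elim
    · cases h : T'.parent w <;> simp
      rintro hv rfl
      exact J.2 _ _ hv h⟩

section
variable {I : T.Ideals} {J : T'.Ideals}

@[simp] theorem insL_mem_univ {v : T.V} :
    insL T s T' v ∈ (insIdealUniv s T' I).1 ↔ v ∈ I.1 := Iff.rfl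

@[simp] theorem insR_mem_univ {v : T'.V} : insR T s T' v ∈ (insIdealUniv s T' I).1 := trivial

@[simp] theorem insL_mem {hs : s ∉ I.1} {v : T.V} :
    insL T s T' v ∈ (insIdeal I hs J).1 ↔ v ∈ I.1 := Iff.rfl

@[simp] theorem insR_mem {hs : s ∉ I.1} {v : T'.V} :
    insR T s T' v ∈ (insIdeal I hs J).1 ↔ v ∈ J.1 := Iff.rfl

end

@[simp] theorem elim_eq_insL {o : Option T'.V} {v : T.V} :
    o.elim (insL T s T' s) (insR T s T') = insL T s T' v ↔ o = none ∧ s = v := by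
  cases o <;> simp

@[simp] theorem elim_eq_insR {o : Option T'.V} {v : T'.V} :
    o.elim (insL T s T' s) (insR T s T') = insR T s T' v ↔ o = some v := by
  cases o <;> simp

@[simp] theorem elim_mem_insIdeal {I : T.Ideals} {hs : s ∉ I.1} {J : T'.Ideals}
    {o : Option T'.V} : o.elim (insL T s T' s) (insR T s T') ∈ (insIdeal I hs J).1 ↔
      ¬ o.elim True (· ∉ J.1) := by
  cases o <;> simp [hs]

theorem elim_mem_insIdealUniv {I : T.Ideals} (hs : s ∈ I.1) {o : Option T'.V} :
    o.elim (insL T s T' s) (insR T s T') ∈ (insIdealUniv s T' I).1 := by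
  cases o <;> simp [hs]

/-- An ideal which contains all the roots contains all the vertices. -/
theorem mem_of_roots_mem (J : T'.Ideals) (h : ∀ v, T'.parent v = none → v ∈ J.1) (v : T'.V) :
    v ∈ J.1 := by
  induction v using T'.wf.induction with
  | _ v ih =>
  cases hv : T'.parent v with
  | none => exact h v hv
  | some w => exact J.2 w v (ih w hv) hv

/-- The only new block of children of a vertex of `T` is attached to `s`, which is in `I`, hence is
not `v`. -/
theorem insL_blockCount_univ (I : T.Ideals) (hs : s ∈ I.1) (v : T.V) (hv : v ∉ I.1) :
    (T.ins s T').blockCount (insIdealUniv s T' I).1 (insL T s T' v) = T.blockCount I.1 v := by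
  refine PForest.blockCount_congr (insL T s T') (by simp) ?_ ?_
  · rintro a ⟨ha, h⟩
    refine ⟨by simp [ha], ?_⟩
    refine ins_cases ?_ ?_ <;> intro x <;> simp
    exact h x
  · refine ins_cases ?_ ?_ <;> rintro w ⟨hw, h⟩ <;> simp at hw
    · exact ⟨w, ⟨hw, fun x hx => h (insL T s T' x) (by simpa using hx)⟩, by simp [Setoid.refl]⟩
    · cases hw' : T'.parent w <;> simp [hw'] at hw
      exact (hv (hw ▸ hs)).elim

/-- The block of roots of `T'` could only be counted at `s`, and only if it lies in `J`, which
forces `J` to be all of `T'`. -/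
theorem insL_blockCount_of_ne (I : T.Ideals) (hs : s ∉ I.1) (J : T'.Ideals) (v : T.V)
    (hv : v ≠ s ∨ ¬ (Nonempty T'.V ∧ ∀ x, x ∈ J.1)) :
    (T.ins s T').blockCount (insIdeal I hs J).1 (insL T s T' v) = T.blockCount I.1 v := by
  refine PForest.blockCount_congr (insL T s T') (by simp) ?_ ?_
  · rintro a ⟨ha, h⟩
    refine ⟨by simp [ha], ?_⟩
    refine ins_cases ?_ ?_ <;> intro x <;> simp
    exact h x
  · refine ins_cases ?_ ?_ <;> rintro w ⟨hw, h⟩ <;> simp at hw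
    · exact ⟨w, ⟨hw, fun x hx => h (insL T s T' x) (by simpa using hx)⟩, by simp [Setoid.refl]⟩
    · cases hw' : T'.parent w <;> simp [hw'] at hw
      obtain hv | hv := hv
      · exact (hv hw.symm).elim
      · refine (hv ⟨⟨w⟩, mem_of_roots_mem J fun x hx => ?_⟩).elim
        exact h (insR T s T' x) (by simpa using T'.block_root _ _ hx hw')

theorem insL_blockCount_self (I : T.Ideals) (hs : s ∉ I.1) (J : T'.Ideals)
    (h : Nonempty T'.V) (hJ : ∀ x, x ∈ J.1) :
    (T.ins s T').blockCount (insIdeal I hs J).1 (insL T s T' s) = T.blockCount I.1 s + 1 := by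
  -- Any root of `T'` represents the additional block.
  obtain ⟨z, hz⟩ := T'.toRForest.exists_root
  refine PForest.blockCount_eq_add_one (insL T s T') (by simp) ?_ (insR T s T' z) ?_ (by simp) ?_
  · rintro a ⟨ha, h⟩
    refine ⟨by simp [ha], ?_⟩
    refine ins_cases ?_ ?_ <;> intro x <;> simp
    exact h x
  · refine ⟨by simp [hz], ?_⟩
    refine ins_cases ?_ ?_ <;> intro x <;> simp [hJ]
  · refine ins_cases ?_ ?_ <;> rintro w ⟨hw, h⟩ <;> simp at hw
    · exact .inl ⟨w, ⟨hw, fun x hx => h (insL T s T' x) (by simpa using hx)⟩,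
        by simp [Setoid.refl]⟩
    · cases hw' : T'.parent w <;> simp [hw'] at hw
      exact .inr (by simpa using T'.block_root _ _ hz hw')

theorem insR_blockCount (I : T.Ideals) (hs : s ∉ I.1) (J : T'.Ideals) (v : T'.V) :
    (T.ins s T').blockCount (insIdeal I hs J).1 (insR T s T' v) = T'.blockCount J.1 v := by
  refine PForest.blockCount_congr (insR T s T') (by simp) ?_ ?_
  · rintro a ⟨ha, h⟩
    refine ⟨by simp [ha], ?_⟩
    refine ins_cases ?_ ?_ <;> intro x <;> simp
    exact h x
  · refine ins_cases ?_ ?_ <;> rintro w ⟨hw, h⟩ <;> simp at hw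
    cases hw' : T'.parent w <;> simp [hw'] at hw
    subst hw
    exact ⟨w, ⟨hw', fun x hx => h (insR T s T' x) (by simpa using hx)⟩, by simp [Setoid.refl]⟩

theorem isEmpty_R_iff (J : T'.Ideals) : IsEmpty (T'.R J).V ↔ ∀ x, x ∈ J.1 := by
  constructor
  · intro h x
    by_contra hx
    exact h.elim (RV T' J x hx)
  · intro h
    exact ⟨R_cases fun v hv => hv (h v)⟩

/-- The balance of integers on which the compatibility of `Δ` and `•` rests. If `J` is all of a
nonempty `T'`, the left side counts the block of roots of `T'` and the right side raises `s`,
`R^J(T')` being empty. If `T'` is empty, there is no such block and both sides raise `s`. Otherwise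
nothing happens at `s`. -/
theorem insL_blockCount (I : T.Ideals) (hs : s ∉ I.1) (J : T'.Ideals) (v : T.V) :
    ind (v = s ∧ IsEmpty T'.V) + (T.ins s T').blockCount (insIdeal I hs J).1 (insL T s T' v) =
      T.blockCount I.1 v + ind (v = s ∧ IsEmpty (T'.R J).V) := by
  rw [isEmpty_R_iff]
  by_cases hv : v = s
  · subst hv
    cases isEmpty_or_nonempty T'.V with
    | inl h =>
      rw [insL_blockCount_of_ne I hs J v (.inr fun h' => not_nonempty_iff.2 h h'.1)]
      simp [h, ind, add_comm]
    | inr h =>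
      by_cases hJ : ∀ x, x ∈ J.1
      · rw [insL_blockCount_self I hs J h hJ]
        simp [hJ]
      · rw [insL_blockCount_of_ne I hs J v (.inr (by simp [hJ]))]; simp [hJ]
  · rw [insL_blockCount_of_ne I hs J v (.inl hv)]; simp [hv]

/-- Since `s` survives, what remains of `T'` is still attached to it; the decorations agree by
`insL_blockCount`. -/
noncomputable def insIsoR (I : T.Ideals) (hs : s ∉ I.1) (J : T'.Ideals) :
    Iso ((T.R I).ins (RV T I s hs) (T'.R J)) ((T.ins s T').R (insIdeal I hs J)) :=
  .ofBijective
    (insElim (RElim fun v h => RV _ _ (insL T s T' v) (mt insL_mem.1 h))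
      (RElim fun v h => RV _ _ (insR T s T' v) (mt insR_mem.1 h)))
    ⟨by
      refine ins_cases (R_cases ?_) (R_cases ?_) <;> intro v hv <;>
        refine ins_cases (R_cases ?_) (R_cases ?_) <;> intro w hw <;> simp,
    by
      refine R_cases (ins_cases ?_ ?_)
      · intro v h
        exact ⟨insL _ _ _ (RV T I v h), rfl⟩
      · intro v h
        exact ⟨insR _ _ _ (RV T' J v h), rfl⟩⟩
    (by
      refine ins_cases (R_cases ?_) (R_cases ?_) <;> intro v hv <;>
        refine ins_cases (R_cases ?_) (R_cases ?_) <;> intro w hw <;> simp)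
    (by
      refine ins_cases (R_cases ?_) (R_cases ?_) <;> intro v hv
      · simp [add_assoc, insL_blockCount]
      · simp [insR_blockCount])
    (by
      refine ins_cases (R_cases ?_) (R_cases ?_) <;> intro v hv <;>
        refine ins_cases (R_cases ?_) (R_cases ?_) <;> intro w hw <;> simp)

/-- With `s` outside `I`, the edges from `s` to the roots of `T'` are cut, so the parts in `T` and
in `T'` are disconnected and their roots are joined in one block. -/
noncomputable def insIsoP (I : T.Ideals) (hs : s ∉ I.1) (J : T'.Ideals) :
    Iso ((T.P I).prod (T'.P J)) ((T.ins s T').P (insIdeal I hs J)) :=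
  .ofBijective
    (prodElim (PElim fun v h => PV _ _ (insL T s T' v) (insL_mem.2 h))
      (PElim fun v h => PV _ _ (insR T s T' v) (insR_mem.2 h)))
    ⟨by
      refine prod_cases (P_cases ?_) (P_cases ?_) <;> intro v hv <;>
        refine prod_cases (P_cases ?_) (P_cases ?_) <;> intro w hw <;> simp,
    by
      refine P_cases (ins_cases ?_ ?_)
      · intro v h
        exact ⟨prodL _ _ (PV T I v h), rfl⟩
      · intro v h
        exact ⟨prodR _ _ (PV T' J v h), rfl⟩⟩
    (by
      refine prod_cases (P_cases ?_) (P_cases ?_) <;> intro v hv <;>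
        refine prod_cases (P_cases ?_) (P_cases ?_) <;> intro w hw <;> simp
      rintro - rfl
      exact hs hv)
    (by
      refine prod_cases (P_cases fun v hv => ?_) (P_cases fun v hv => ?_)
      · have : v ≠ s := fun h => hs (h ▸ hv)
        simp [this]
      · simp)
    (by
      refine prod_cases (P_cases ?_) (P_cases ?_) <;> intro v hv <;>
        refine prod_cases (P_cases ?_) (P_cases ?_) <;> intro w hw <;>
        simp [Function.comp_def])

noncomputable def insIsoRUniv (I : T.Ideals) (hs : s ∈ I.1) :
    Iso (T.R I) ((T.ins s T').R (insIdealUniv s T' I)) :=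
  .ofBijective
    (RElim fun v h => RV _ _ (insL T s T' v) (mt insL_mem_univ.1 h))
    ⟨by
      refine R_cases fun v hv => R_cases fun w hw => ?_
      simp,
    by
      refine R_cases (ins_cases ?_ ?_)
      · intro v h
        exact ⟨RV T I v h, rfl⟩
      · intro v h
        exact (h trivial).elim⟩
    (by
      refine R_cases fun v hv => R_cases fun w hw => ?_
      simp)
    (by
      refine R_cases fun v hv => ?_
      have : v ≠ s := fun h => hv (h ▸ hs)
      simp [insL_blockCount_univ I hs v hv, this])
    (by
      refine R_cases fun v hv => R_cases fun w hw => ?_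
      simp)

/-- With `s` in `I`, all of `T'` stays attached to `s`, and its roots do not become roots of `P`. -/
noncomputable def insIsoPUniv (I : T.Ideals) (hs : s ∈ I.1) :
    Iso ((T.P I).ins (PV T I s hs) T') ((T.ins s T').P (insIdealUniv s T' I)) :=
  .ofBijective
    (insElim (PElim fun v h => PV _ _ (insL T s T' v) (insL_mem_univ.2 h))
      (fun v => PV _ _ (insR T s T' v) insR_mem_univ))
    ⟨by
      refine ins_cases (P_cases fun v hv => ?_) (fun v => ?_) <;>
        refine ins_cases (P_cases fun w hw => ?_) (fun w => ?_) <;> simp,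
    by
      refine P_cases (ins_cases ?_ ?_)
      · intro v h
        exact ⟨insL _ _ _ (PV T I v h), rfl⟩
      · intro v h
        exact ⟨insR _ _ _ v, rfl⟩⟩
    (by
      refine ins_cases (P_cases fun v hv => ?_) (fun v => ?_) <;>
        refine ins_cases (P_cases fun w hw => ?_) (fun w => ?_) <;> simp)
    (by
      refine ins_cases (P_cases fun v hv => ?_) (fun v => ?_) <;> simp)
    (by
      refine ins_cases (P_cases fun v hv => ?_) (fun v => ?_) <;>
        refine ins_cases (P_cases fun w hw => ?_) (fun w => ?_) <;>
        simp [elim_mem_insIdealUniv hs, Function.comp_def])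

end Ins

end PTree

/-! ### Sums over the ideals of an insertion -/

namespace PTree

variable {D : Type u}

open Classical in
/-- The ideals of an insertion. -/
noncomputable def insIdealsEquiv (T : PTree (ℕ × D)) (s : T.V) (T' : PTree (ℕ × D)) :
    {I : T.Ideals // s ∈ I.1} ⊕ {I : T.Ideals // s ∉ I.1} × T'.Ideals ≃ (T.ins s T').Ideals where
  toFun := Sum.elim (fun I => insIdealUniv s T' I.1) (fun p => insIdeal p.1.1 p.1.2 p.2)
  invFun X :=
    let I : T.Ideals := ⟨{v | insL T s T' v ∈ X.1}, fun v w hv hw => X.2 _ _ hv (by simp [hw])⟩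
    if h : s ∈ I.1 then .inl ⟨I, h⟩ else
      .inr ⟨⟨I, h⟩, ⟨{v | insR T s T' v ∈ X.1}, fun v w hv hw => X.2 _ _ hv (by simp [hw])⟩⟩
  left_inv := by
    rintro (⟨I, h⟩ | ⟨⟨I, h⟩, J⟩)
    · exact dif_pos h
    · exact dif_neg h
  right_inv X := by
    dsimp only
    split_ifs with h
    · refine Subtype.ext (Set.ext ?_)
      refine ins_cases (fun v => Iff.rfl) (fun v => iff_of_true trivial ?_)
      -- An ideal which contains `s` contains the roots of `T'`, then all the vertices above them.
      induction v using T'.wf.induction with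
      | _ v ih =>
      refine X.2 ((T'.parent v).elim (insL T s T' s) (insR T s T')) _ ?_ (by simp)
      cases hv : T'.parent v with
      | none => exact h
      | some w => exact ih w hv
    · refine Subtype.ext (Set.ext ?_)
      refine ins_cases (fun v => Iff.rfl) (fun v => Iff.rfl)

/-- Pairs of an ideal `I` and of a vertex of `I`. -/
def sigmaP (T : PTree (ℕ × D)) :
    (Σ s : T.V, {I : T.Ideals // s ∈ I.1}) ≃ (Σ I : T.Ideals, (T.P I).V) where
  toFun p := ⟨p.2.1, PV T p.2.1 p.1 p.2.2⟩
  invFun p := ⟨p.2.1, p.1, p.2.2⟩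
  left_inv _ := rfl
  right_inv _ := rfl

/-- Pairs of an ideal `I` and of a vertex which is not in `I`. -/
def sigmaR (T : PTree (ℕ × D)) :
    (Σ s : T.V, {I : T.Ideals // s ∉ I.1}) ≃ (Σ I : T.Ideals, (T.R I).V) where
  toFun p := ⟨p.2.1, RV T p.2.1 p.1 p.2.2⟩
  invFun p := ⟨p.2.1, p.1, p.2.2⟩
  left_inv _ := rfl
  right_inv _ := rfl

-- Exchanges the sums over vertices and ideals: the terms where the ideal contains the vertex are
-- indexed by the vertices of the trees `P^I(T)`.
open Classical in
theorem sum_sigmaP {M : Type*} [AddCommMonoid M] (T : PTree (ℕ × D))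
    (f : ∀ I : T.Ideals, (T.P I).V → M) :
    ∑ s : T.V, ∑ I : {I : T.Ideals // s ∈ I.1}, f I.1 (PV T I.1 s I.2) = ∑ I, ∑ v, f I v := by
  rw [← Fintype.sum_sigma', ← Fintype.sum_sigma']
  exact Fintype.sum_equiv (sigmaP T) _ _ fun _ => rfl

open Classical in
theorem sum_sigmaR {M : Type*} [AddCommMonoid M] (T : PTree (ℕ × D))
    (f : ∀ I : T.Ideals, (T.R I).V → M) :
    ∑ s : T.V, ∑ I : {I : T.Ideals // s ∉ I.1}, f I.1 (RV T I.1 s I.2) = ∑ I, ∑ v, f I v := by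
  rw [← Fintype.sum_sigma', ← Fintype.sum_sigma']
  exact Fintype.sum_equiv (sigmaR T) _ _ fun _ => rfl

end PTree

/-! ### Compatibility of the coproduct with the two products -/

namespace UCP

open PTree

variable {K : Type w} [Field K] {D : Type u}

theorem comul_mul (x y : UCP K D) : comul K D (x * y) = comul K D x * comul K D y := by
  induction x using induction_on with
  | add x x' h h' => rw [add_mul, map_add, h, h', map_add, add_mul]
  | smul c x h => rw [smul_mul_assoc, map_smul, h, map_smul, smul_mul_assoc]
  | of T =>
  induction y using induction_on with
  | add x x' h h' => rw [mul_add, map_add, h, h', map_add, mul_add]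
  | smul c x h => rw [mul_smul_comm, map_smul, h, map_smul, mul_smul_comm]
  | of T' =>
  rw [of_mul, comul_of, comul_of, comul_of, Finset.sum_mul_sum, ← Fintype.sum_prod_type']
  refine (Fintype.sum_equiv (prodIdealsEquiv T T') _ _ fun p => ?_).symm
  rw [Algebra.TensorProduct.tmul_mul_tmul, of_mul, of_mul]
  exact congrArg₂ _ (of_congr K (prodIsoR p.1 p.2)) (of_congr K (prodIsoP p.1 p.2))

-- The ideals are sorted according to whether they contain `s`; the two sums will become the two
-- terms of the axiom on `Δ(x • y)`.
open Classical in
theorem comul_ins (T : PTree (ℕ × D)) (s : T.V) (T' : PTree (ℕ × D)) :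
    comul K D (of K (T.ins s T')) =
      ∑ I : {I : T.Ideals // s ∈ I.1},
        of K (T.R I.1) ⊗ₜ[K] of K ((T.P I.1).ins (PV T I.1 s I.2) T') +
      ∑ I : {I : T.Ideals // s ∉ I.1}, ∑ J : T'.Ideals,
        of K ((T.R I.1).ins (RV T I.1 s I.2) (T'.R J)) ⊗ₜ[K] (of K (T.P I.1) * of K (T'.P J)) := by
  rw [comul_of, ← (insIdealsEquiv T s T').sum_comp, Fintype.sum_sum_type, Fintype.sum_prod_type]
  congr 1
  · refine Finset.sum_congr rfl fun I _ => ?_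
    exact congrArg₂ _ (of_congr K (insIsoRUniv I.1 I.2)).symm
      (of_congr K (insIsoPUniv I.1 I.2)).symm
  · refine Finset.sum_congr rfl fun I _ => Finset.sum_congr rfl fun J _ => ?_
    rw [of_mul]
    exact congrArg₂ _ (of_congr K (insIsoR I.1 I.2 J)).symm (of_congr K (insIsoP I.1 I.2 J)).symm

-- Summing `comul_ins` over `s`, the vertices in the ideal are those at which `T'` is inserted in
-- `P^I(T)`, and the others are those at which `R^J(T')` is inserted in `R^I(T)`.
open Classical in
theorem comul_bullet (x y : UCP K D) : comul K D (bullet K D x y) =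
    ((bullet K D).flip y).lTensor (UCP K D) (comul K D x) +
      TensorProduct.map₂ (bullet K D) (LinearMap.mul K (UCP K D)) (comul K D x) (comul K D y) := by
  induction x using induction_on with
  | add x x' h h' => simp only [map_add, LinearMap.add_apply, h, h']; abel
  | smul c x h => simp only [map_smul, LinearMap.smul_apply, h, smul_add]
  | of T =>
  induction y using induction_on with
  | add x x' h h' =>
    simp only [map_add, LinearMap.lTensor_add, LinearMap.add_apply, h, h']; abel
  | smul c x h =>
    simp only [map_smul, LinearMap.lTensor_smul, LinearMap.smul_apply, h, smul_add]
  | of T' =>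
  rw [bullet_of_eq_sum, map_sum]
  simp only [comul_ins, Finset.sum_add_distrib]
  congr 1
  · rw [comul_of, map_sum]
    simp only [LinearMap.lTensor_tmul, LinearMap.flip_apply, bullet_of_eq_sum,
      TensorProduct.tmul_sum]
    exact sum_sigmaP T fun I v => of K (T.R I) ⊗ₜ[K] of K ((T.P I).ins v T')
  · have h : ∀ I : T.Ideals, TensorProduct.map₂ (bullet K D) (LinearMap.mul K (UCP K D))
        (of K (T.R I) ⊗ₜ[K] of K (T.P I)) (comul K D (of K T')) =
        ∑ v : (T.R I).V, ∑ J : T'.Ideals,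
          of K ((T.R I).ins v (T'.R J)) ⊗ₜ[K] (of K (T.P I) * of K (T'.P J)) := by
      intro I
      rw [comul_of, map_sum, Finset.sum_comm]
      refine Finset.sum_congr rfl fun J _ => ?_
      rw [TensorProduct.map₂_apply_tmul, TensorProduct.map_tmul, bullet_of_eq_sum,
        TensorProduct.sum_tmul]
      rfl
    rw [comul_of, map_sum, LinearMap.sum_apply, Finset.sum_congr rfl fun I _ => h I]
    exact sum_sigmaR T fun I v => ∑ J : T'.Ideals,
      of K ((T.R I).ins v (T'.R J)) ⊗ₜ[K] (of K (T.P I) * of K (T'.P J))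

end UCP

/-! ### The root below a vertex -/

namespace RForest

variable {D : Type u} {E : Type v}

/-- The root of the tree which contains a given vertex. -/
noncomputable def rootOf (F : RForest D) : F.V → F.V :=
  F.wf.fix fun v ih => match h : F.parent v with
    | none => v
    | some w => ih w h

theorem rootOf_of_none {F : RForest D} {v : F.V} (h : F.parent v = none) : F.rootOf v = v := by
  rw [rootOf, WellFounded.fix_eq]
  split
  · rfl
  · simp_all

theorem rootOf_of_some {F : RForest D} {v w : F.V} (h : F.parent v = some w) :
    F.rootOf v = F.rootOf w := by
  rw [rootOf, WellFounded.fix_eq]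
  split
  · simp_all
  · rename_i heq
    cases heq.symm.trans h
    rfl

theorem parent_rootOf (F : RForest D) (v : F.V) : F.parent (F.rootOf v) = none := by
  induction v using F.wf.induction with
  | _ v ih =>
  cases hv : F.parent v with
  | none => rw [rootOf_of_none hv, hv]
  | some w => rw [rootOf_of_some hv, ih w hv]

theorem rootOf_equiv {F : RForest D} {G : RForest E} (e : F.V ≃ G.V)
    (he : ∀ v, G.parent (e v) = (F.parent v).map e) (v : F.V) :
    G.rootOf (e v) = e (F.rootOf v) := by
  induction v using F.wf.induction with
  | _ v ih =>
  cases hv : F.parent v with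
  | none => rw [rootOf_of_none hv, rootOf_of_none (by simp [he, hv])]
  | some w =>
    rw [rootOf_of_some hv, ← ih w hv, rootOf_of_some (w := e w) (by simp [he, hv])]

end RForest

namespace PForest

variable {D : Type u}

/-- Two vertices of a block either are roots, or have the same parent and thus the same root. -/
theorem rootOf_block {F : PForest D} {v w : F.V} (h : F.block v w) :
    F.block (F.rootOf v) (F.rootOf w) := by
  have hp := F.block_parent _ _ h
  cases hv : F.parent v with
  | none =>
    rw [RForest.rootOf_of_none hv, RForest.rootOf_of_none (hp ▸ hv)]
    exact h
  | some x =>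
    rw [RForest.rootOf_of_some hv, RForest.rootOf_of_some (v := w) (hp ▸ hv)]

/-! ### Vertices of disjoint unions, restrictions and graftings -/

section Disj

variable (F G : PForest D)

/-- The inclusion of the vertices of the left forest. -/
def disjL (v : F.V) : (F.disj G).V := Sum.inl v

/-- The inclusion of the vertices of the right forest. -/
def disjR (v : G.V) : (F.disj G).V := Sum.inr v

variable {F G}

@[elab_as_elim]
theorem disj_cases {p : (F.disj G).V → Prop} (hl : ∀ v, p (disjL F G v))
    (hr : ∀ v, p (disjR F G v)) (v) : p v := Sum.rec hl hr v

/-- Definition of a function on the vertices of a disjoint union. -/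
def disjElim {α : Sort*} (f : F.V → α) (g : G.V → α) (v : (F.disj G).V) : α := Sum.rec f g v

section
variable {α : Sort*} (f : F.V → α) (g : G.V → α)
@[simp] theorem disjElim_L (v : F.V) : disjElim f g (disjL F G v) = f v := rfl
@[simp] theorem disjElim_R (v : G.V) : disjElim f g (disjR F G v) = g v := rfl
end

@[simp] theorem disjL_inj {v w : F.V} : disjL F G v = disjL F G w ↔ v = w :=
  Sum.inl_injective.eq_iff

@[simp] theorem disjR_inj {v w : G.V} : disjR F G v = disjR F G w ↔ v = w :=
  Sum.inr_injective.eq_iff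

@[simp] theorem disjL_ne {v : F.V} {w : G.V} : disjL F G v ≠ disjR F G w := Sum.inl_ne_inr

@[simp] theorem disjR_ne {v : F.V} {w : G.V} : disjR F G w ≠ disjL F G v := Sum.inr_ne_inl

@[simp] theorem disjL_parent (v : F.V) :
    (F.disj G).parent (disjL F G v) = (F.parent v).map (disjL F G) := rfl

@[simp] theorem disjR_parent (v : G.V) :
    (F.disj G).parent (disjR F G v) = (G.parent v).map (disjR F G) := rfl

@[simp] theorem disjL_deco (v : F.V) : (F.disj G).deco (disjL F G v) = F.deco v := rfl

@[simp] theorem disjR_deco (v : G.V) : (F.disj G).deco (disjR F G v) = G.deco v := rfl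

@[simp] theorem disjL_block (v w : F.V) :
    (F.disj G).block (disjL F G v) (disjL F G w) ↔ F.block v w := Sum.liftRel_inl_inl

@[simp] theorem disjR_block (v w : G.V) :
    (F.disj G).block (disjR F G v) (disjR F G w) ↔ G.block v w := Sum.liftRel_inr_inr

@[simp] theorem disjL_block_R (v : F.V) (w : G.V) :
    ¬ (F.disj G).block (disjL F G v) (disjR F G w) := Sum.not_liftRel_inl_inr

@[simp] theorem disjR_block_L (v : G.V) (w : F.V) :
    ¬ (F.disj G).block (disjR F G v) (disjL F G w) := Sum.not_liftRel_inr_inl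

end Disj

section Restrict

variable (F : PForest D) (S : Set F.V)

/-- The vertices of a restriction. -/
def resV (v : F.V) (h : v ∈ S) : (F.restrict S).V := ⟨v, h⟩

/-- The vertices of a restriction where the blocks of roots are joined. -/
def mresV (v : F.V) (h : v ∈ S) : (F.restrict S).merge.V := ⟨v, h⟩

variable {F S}

@[elab_as_elim]
theorem res_cases {p : (F.restrict S).V → Prop} (hp : ∀ v h, p (resV F S v h)) (v) : p v :=
  hp v.1 v.2

@[elab_as_elim]
theorem mres_cases {p : (F.restrict S).merge.V → Prop} (hp : ∀ v h, p (mresV F S v h)) (v) :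
    p v := hp v.1 v.2

/-- The inclusion of the vertices of a restriction. -/
def resVal (v : (F.restrict S).V) : F.V := v.1

/-- The inclusion of the vertices of a restriction. -/
def mresVal (v : (F.restrict S).merge.V) : F.V := v.1

variable {v w : F.V} {h : v ∈ S} {h' : w ∈ S}

@[simp] theorem resVal_resV : resVal (resV F S v h) = v := rfl

@[simp] theorem mresVal_mresV : mresVal (mresV F S v h) = v := rfl

@[simp] theorem resV_inj : resV F S v h = resV F S w h' ↔ v = w := Subtype.mk_eq_mk

@[simp] theorem mresV_inj : mresV F S v h = mresV F S w h' ↔ v = w := Subtype.mk_eq_mk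

@[simp] theorem resV_parent :
    (F.restrict S).parent (resV F S w h') = some (resV F S v h) ↔ F.parent w = some v :=
  F.toRForest.restrict_parent _ _ _

@[simp] theorem mresV_parent :
    (F.restrict S).merge.parent (mresV F S w h') = some (mresV F S v h) ↔ F.parent w = some v :=
  F.toRForest.restrict_parent _ _ _

@[simp] theorem resV_parent_none :
    (F.restrict S).parent (resV F S v h) = none ↔ (F.parent v).elim True (· ∉ S) := by
  cases hv : F.parent v with
  | none => simp [restrict, RForest.restrict, resV, hv]
  | some w => simp [restrict, RForest.restrict, resV, hv]

@[simp] theorem mresV_parent_none :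
    (F.restrict S).merge.parent (mresV F S v h) = none ↔ (F.parent v).elim True (· ∉ S) :=
  resV_parent_none

@[simp] theorem resV_deco : (F.restrict S).deco (resV F S v h) = F.deco v := rfl

@[simp] theorem mresV_deco : (F.restrict S).merge.deco (mresV F S v h) = F.deco v := rfl

@[simp] theorem resV_block :
    (F.restrict S).block (resV F S v h) (resV F S w h') ↔ F.block v w := Iff.rfl

@[simp] theorem mresV_block :
    (F.restrict S).merge.block (mresV F S v h) (mresV F S w h') ↔ F.block v w ∨
      ((F.parent v).elim True (· ∉ S) ∧ (F.parent w).elim True (· ∉ S)) := by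
  rw [← mresV_parent_none (h := h), ← mresV_parent_none (h := h')]
  exact Iff.rfl

end Restrict

/-- The grafting of a partitioned tree on a vertex of a partitioned forest. -/
def graft (F : PForest D) (s : F.V) (T' : PTree D) : PForest D where
  V := F.V ⊕ T'.V
  finite := inferInstance
  parent := Sum.elim (fun v => (F.parent v).map Sum.inl)
    (fun w => some ((T'.parent w).elim (Sum.inl s) Sum.inr))
  wf := by
    refine Subrelation.wf ?_ (Sum.lex_wf F.wf T'.wf)
    rintro (v | v) (w | w) h
    · simp at h ⊢; exact h
    · exact .sep _ _
    · simp at h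
    · cases h' : T'.parent w <;> simp [h'] at h ⊢
      exact h
  deco := Sum.elim F.deco T'.deco
  block := (F.disj T'.toPForest).block
  block_parent := by
    rintro _ _ (h | h)
    · simp [F.block_parent _ _ h]
    · simp [T'.block_parent _ _ h]

section Graft

variable (F : PForest D) (s : F.V) (T' : PTree D)

/-- The inclusion of the vertices of the forest on which a tree is grafted. -/
def graftL (v : F.V) : (F.graft s T').V := Sum.inl v

/-- The inclusion of the vertices of the grafted tree. -/
def graftR (v : T'.V) : (F.graft s T').V := Sum.inr v

variable {F s T'}

@[elab_as_elim]
theorem graft_cases {p : (F.graft s T').V → Prop} (hl : ∀ v, p (graftL F s T' v))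
    (hr : ∀ v, p (graftR F s T' v)) (v) : p v := Sum.rec hl hr v

/-- Definition of a function on the vertices of a grafting. -/
def graftElim {α : Sort*} (f : F.V → α) (g : T'.V → α) (v : (F.graft s T').V) : α :=
  Sum.rec f g v

section
variable {α : Sort*} (f : F.V → α) (g : T'.V → α)
@[simp] theorem graftElim_L (v : F.V) : graftElim f g (graftL F s T' v) = f v := rfl
@[simp] theorem graftElim_R (v : T'.V) : graftElim f g (graftR F s T' v) = g v := rfl
end

@[simp] theorem graftL_inj {v w : F.V} : graftL F s T' v = graftL F s T' w ↔ v = w :=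
  Sum.inl_injective.eq_iff

@[simp] theorem graftR_inj {v w : T'.V} : graftR F s T' v = graftR F s T' w ↔ v = w :=
  Sum.inr_injective.eq_iff

@[simp] theorem graftL_ne {v : F.V} {w : T'.V} : graftL F s T' v ≠ graftR F s T' w :=
  Sum.inl_ne_inr

@[simp] theorem graftR_ne {v : F.V} {w : T'.V} : graftR F s T' w ≠ graftL F s T' v :=
  Sum.inr_ne_inl

@[simp] theorem graftL_parent (v : F.V) :
    (F.graft s T').parent (graftL F s T' v) = (F.parent v).map (graftL F s T') := rfl

@[simp] theorem graftR_parent (v : T'.V) : (F.graft s T').parent (graftR F s T' v) =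
    some ((T'.parent v).elim (graftL F s T' s) (graftR F s T')) := rfl

@[simp] theorem graftL_deco (v : F.V) : (F.graft s T').deco (graftL F s T' v) = F.deco v := rfl

@[simp] theorem graftR_deco (v : T'.V) : (F.graft s T').deco (graftR F s T' v) = T'.deco v := rfl

@[simp] theorem graftL_block (v w : F.V) :
    (F.graft s T').block (graftL F s T' v) (graftL F s T' w) ↔ F.block v w := Sum.liftRel_inl_inl

@[simp] theorem graftR_block (v w : T'.V) :
    (F.graft s T').block (graftR F s T' v) (graftR F s T' w) ↔ T'.block v w := Sum.liftRel_inr_inr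

@[simp] theorem graftL_block_R (v : F.V) (w : T'.V) :
    ¬ (F.graft s T').block (graftL F s T' v) (graftR F s T' w) := Sum.not_liftRel_inl_inr

@[simp] theorem graftR_block_L (v : T'.V) (w : F.V) :
    ¬ (F.graft s T').block (graftR F s T' v) (graftL F s T' w) := Sum.not_liftRel_inr_inl

end Graft

/-- The partitioned tree obtained by adding a common root to a partitioned forest. -/
def root (x : D) (F : PForest D) : PTree D where
  toRForest := F.toRForest.graftRoot x
  block :=
    { r := Option.Rel F.block
      iseqv := by
        refine ⟨?_, ?_, ?_⟩
        · rintro (_ | v)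
          · exact .none
          · exact .some (F.block.refl v)
        · rintro _ _ (h | _)
          · exact .some (F.block.symm h)
          · exact .none
        · rintro _ _ _ (h | _) (h' | _)
          · exact .some (F.block.trans h h')
          · exact .none }
  block_parent := by
    rintro _ _ (h | _)
    · exact congrArg some (F.block_parent _ _ h)
    · rfl
  block_root := by
    rintro (_ | v) (_ | w) hv hw
    · exact .none
    · cases hw
    · cases hv
    · cases hw

section Root

variable (x : D) (F : PForest D)

/-- The root of `root x F`. -/
def rootN : (root x F).V := none

/-- The vertices of `root x F` which are not its root. -/
def rootS (v : F.V) : (root x F).V := some v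

variable {x F}

@[elab_as_elim]
theorem root_cases {p : (root x F).V → Prop} (hn : p (rootN x F))
    (hs : ∀ v, p (rootS x F v)) (v) : p v := Option.rec hn hs v

/-- Definition of a function on the vertices of `root x F`. -/
def rootElim {α : Sort*} (a : α) (f : F.V → α) (v : (root x F).V) : α := Option.rec a f v

section
variable {α : Sort*} (a : α) (f : F.V → α)
@[simp] theorem rootElim_N : rootElim a f (rootN x F) = a := rfl
@[simp] theorem rootElim_S (v : F.V) : rootElim a f (rootS x F v) = f v := rfl
end

@[simp] theorem rootS_inj {v w : F.V} : rootS x F v = rootS x F w ↔ v = w :=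
  Option.some_inj

@[simp] theorem rootS_ne {v : F.V} : rootS x F v ≠ rootN x F := Option.some_ne_none v

@[simp] theorem rootN_ne {v : F.V} : rootN x F ≠ rootS x F v := (Option.some_ne_none v).symm

@[simp] theorem rootN_parent : (root x F).parent (rootN x F) = none := rfl

@[simp] theorem rootS_parent (v : F.V) : (root x F).parent (rootS x F v) =
    some ((F.parent v).elim (rootN x F) (rootS x F)) := by
  change some (F.parent v) = _
  cases F.parent v <;> rfl

@[simp] theorem rootN_deco : (root x F).deco (rootN x F) = x := rfl

@[simp] theorem rootS_deco (v : F.V) : (root x F).deco (rootS x F v) = F.deco v := rfl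

@[simp] theorem rootS_block (v w : F.V) :
    (root x F).block (rootS x F v) (rootS x F w) ↔ F.block v w :=
  ⟨fun h => by cases h; assumption, .some⟩

@[simp] theorem rootN_block : (root x F).block (rootN x F) (rootN x F) := .none

@[simp] theorem rootN_block_S (v : F.V) : ¬ (root x F).block (rootN x F) (rootS x F v) := nofun

@[simp] theorem rootS_block_N (v : F.V) : ¬ (root x F).block (rootS x F v) (rootN x F) := nofun

@[simp] theorem elim_eq_rootN {o : Option F.V} :
    o.elim (rootN x F) (rootS x F) = rootN x F ↔ o = none := by cases o <;> simp

@[simp] theorem elim_eq_rootS {o : Option F.V} {v : F.V} :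
    o.elim (rootN x F) (rootS x F) = rootS x F v ↔ o = some v := by cases o <;> simp

end Root

end PForest

namespace PForest

variable {D : Type u}

/-! ### Decompositions of forests -/

/-- The set `S` is a union of connected components and of blocks. -/
structure IsClosed (F : PForest D) (S : Set F.V) : Prop where
  parent : ∀ v w, F.parent w = some v → (w ∈ S ↔ v ∈ S)
  block : ∀ v w, F.block v w → (v ∈ S ↔ w ∈ S)

/-- Splitting a forest along a closed set. -/
noncomputable def splitIso (F : PForest D) (S : Set F.V) (hS : F.IsClosed S)
    (hr : ∀ v ∈ S, ∀ w ∈ S, F.parent v = none → F.parent w = none → F.block v w) :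
    Iso ((F.restrict Sᶜ).disj (F.restrict S).merge.toPForest) F :=
  .ofBijective (disjElim resVal mresVal)
    ⟨by
      refine disj_cases (res_cases fun v hv => ?_) (mres_cases fun v hv => ?_) <;>
        refine disj_cases (res_cases fun w hw => ?_) (mres_cases fun w hw => ?_) <;> simp
      · rintro rfl; exact hv hw
      · rintro rfl; exact hw hv,
    fun v => by
      by_cases hv : v ∈ S
      · exact ⟨disjR _ _ (mresV F S v hv), rfl⟩
      · exact ⟨disjL _ _ (resV F Sᶜ v hv), rfl⟩⟩
    (by
      refine disj_cases (res_cases fun v hv => ?_) (mres_cases fun v hv => ?_) <;>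
        refine disj_cases (res_cases fun w hw => ?_) (mres_cases fun w hw => ?_) <;> simp
      · intro h; exact hv ((hS.parent _ _ h).1 hw)
      · intro h; exact hw ((hS.parent _ _ h).2 hv))
    (by
      refine disj_cases (res_cases fun v hv => ?_) (mres_cases fun v hv => ?_) <;> simp)
    (by
      refine disj_cases (res_cases fun v hv => ?_) (mres_cases fun v hv => ?_) <;>
        refine disj_cases (res_cases fun w hw => ?_) (mres_cases fun w hw => ?_) <;> simp
      · intro h; exact hv ((hS.block _ _ h).2 hw)
      · intro h; exact hw ((hS.block _ _ h).1 hv)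
      -- Restricting to a closed set creates no root, so merging only joins roots of `F`, which `hr`
      -- puts in the same block already.
      · have key : ∀ x ∈ S, (F.parent x).elim True (· ∉ S) → F.parent x = none := by
          intro x hx h
          cases hx' : F.parent x with
          | none => rfl
          | some y =>
            rw [hx'] at h
            exact (h ((hS.parent _ _ hx').1 hx)).elim
        exact fun h h' => hr v hv w hw (key v hv h) (key w hw h'))

/-- For a root `r`, this set is the partitioned tree of `F` through `r`: the vertices above the
block of `r`. -/
theorem isClosed_block_rootOf (F : PForest D) (r : F.V) :
    F.IsClosed {v | F.block (F.rootOf v) r} where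
  parent v w h := by
    simp only [Set.mem_ofPred_eq]
    rw [RForest.rootOf_of_some h]
  block v w h := by
    have := rootOf_block h
    exact ⟨fun h' => F.block.trans (F.block.symm this) h', fun h' => F.block.trans this h'⟩

/-- The number of roots of a forest. -/
noncomputable def rootCount (F : PForest D) : ℕ := Nat.card {v // F.parent v = none}

/-- The roots of the grafted tree are no longer roots. Hence an induction on the number of roots
applies to graftings, in spite of their additional vertices. -/
theorem rootCount_graft_le (F : PForest D) (s : F.V) (T' : PTree D) :
    (F.graft s T').rootCount ≤ F.rootCount := by
  refine Nat.card_le_card_of_surjective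
    (fun v => ⟨graftL F s T' v.1, by simp [v.2]⟩) ?_
  rintro ⟨v, hv⟩
  induction v using graft_cases with
  | hl v => exact ⟨⟨v, by simpa using hv⟩, rfl⟩
  | hr v => simp at hv

theorem rootCount_restrict_lt (F : PForest D) (S : Set F.V) (hS : F.IsClosed S) (r : F.V)
    (hr : F.parent r = none) (hrS : r ∈ S) : (F.restrict Sᶜ).rootCount < F.rootCount := by
  have hp : ∀ v : {v // (F.restrict Sᶜ).parent v = none}, F.parent (resVal v.1) = none := by
    rintro ⟨v, hv⟩
    induction v using res_cases with
    | hp v h =>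
    rw [resV_parent_none] at hv
    cases hv' : F.parent v with
    | none => exact hv'
    | some w =>
      rw [hv'] at hv
      exact (hv (mt (hS.parent _ _ hv').2 h)).elim
  refine (Finite.card_subtype_lt (p := (· ≠ (⟨r, hr⟩ : {v // F.parent v = none})))
    (x := ⟨r, hr⟩) (by simp)).trans_le' ?_
  refine Nat.card_le_card_of_injective
    (fun v => ⟨⟨resVal v.1, hp v⟩, fun h => v.1.2 (?_ : resVal v.1 ∈ S)⟩) fun v w h => ?_
  · rw [Subtype.mk_eq_mk.1 h]
    exact hrS
  · exact Subtype.ext (Subtype.ext (Subtype.mk_eq_mk.1 (Subtype.mk_eq_mk.1 h)))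

/-- Induction on forests: a forest which is not empty is the disjoint union of a partitioned tree
and of a forest with less roots. -/
theorem induction {P : PForest D → Prop} (iso : ∀ {F G : PForest D}, F.Iso G → P F → P G)
    (empty : ∀ F : PForest D, IsEmpty F.V → P F)
    (disj : ∀ (F : PForest D) (T : PTree D), Nonempty T.V → P F →
      (∀ s, P (F.graft s T)) → P (F.disj T.toPForest)) (F : PForest D) : P F := by
  induction h : F.rootCount using Nat.strong_induction_on generalizing F with
  | _ n ih =>
  cases isEmpty_or_nonempty F.V with
  | inl h => exact empty F h
  | inr hF =>
    obtain ⟨r, hr⟩ := F.exists_root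
    have hS := F.isClosed_block_rootOf r
    have hrS : r ∈ {v | F.block (F.rootOf v) r} := by
      simp [RForest.rootOf_of_none hr, Setoid.refl]
    have hlt := h ▸ F.rootCount_restrict_lt _ hS r hr hrS
    refine iso (F.splitIso _ hS ?_) (disj _ _ ⟨mresV _ _ r hrS⟩ (ih _ hlt _ rfl) fun s => ?_)
    · intro v hv w hw hv' hw'
      simp only [Set.mem_ofPred_eq, RForest.rootOf_of_none hv', RForest.rootOf_of_none hw'] at hv hw
      exact F.block.trans hv (F.block.symm hw)
    -- Grafting the detached tree on the rest does not bring back the roots which were removed.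
    · exact ih _ ((rootCount_graft_le _ _ _).trans_lt hlt) _ rfl

end PForest

/-! ### Splitting a partitioned tree along one root -/

namespace PTree

open PForest

variable {D : Type u} {E : Type v}

/-- The vertices of the tree of a root, which is itself excluded. -/
def above (T : PTree D) (r : T.V) : Set T.V := {v | T.rootOf v = r ∧ v ≠ r}

/-- The vertices of the trees of the other roots. -/
def others (T : PTree D) (r : T.V) : Set T.V := {v | T.rootOf v ≠ r}

/-- Splitting a partitioned tree along the tree of a root. -/
noncomputable def splitIso (T : PTree D) (r : T.V) (hr : T.parent r = none) :
    Iso ((root (T.deco r) (T.toPForest.restrict (T.above r))).prod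
      (T.toPForest.restrict (T.others r)).merge) T :=
  have hrr : T.rootOf r = r := RForest.rootOf_of_none hr
  -- The other trees are kept whole, so their restriction has no new root.
  have hroot : ∀ {v}, v ∈ T.others r →
      ((T.parent v).elim True (· ∉ T.others r) ↔ T.parent v = none) := by
    intro v hv
    cases hv' : T.parent v with
    | none => simp
    | some w =>
      simp only [others, Set.mem_ofPred_eq, RForest.rootOf_of_some hv'] at hv
      simp [others, hv]
  have hne : ∀ {v}, v ∈ T.above r → T.parent v ≠ none := fun hv h =>
    hv.2 ((RForest.rootOf_of_none h).symm.trans hv.1)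
  -- Once `r` is removed, the roots of what is above it are exactly the children of `r`.
  have habove : ∀ {v}, v ∈ T.above r →
      (T.parent v = some r ↔ (T.parent v).elim True (· ∉ T.above r)) := by
    intro v hv
    cases hv' : T.parent v with
    | none => exact (hne hv hv').elim
    | some w =>
      have : T.rootOf w = r := (RForest.rootOf_of_some hv').symm.trans hv.1
      simp [above, this]
  have hp : ∀ {v w}, v ∈ T.others r → T.rootOf w = r → T.parent w ≠ some v := by
    intro v w hv hw h
    exact hv ((RForest.rootOf_of_some h).symm.trans hw)
  have hp' : ∀ {v w}, v ∈ T.others r → T.rootOf w = r → T.parent v ≠ some w := by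
    intro v w hv hw h
    exact hv ((RForest.rootOf_of_some h).trans hw)
  have hb : ∀ {v w}, T.block v w → w ∈ T.above r → T.rootOf v = r := by
    intro v w h hw
    have h' := T.block_parent _ _ h
    obtain ⟨x, hx⟩ := Option.ne_none_iff_exists'.1 (hne hw)
    rw [RForest.rootOf_of_some (h'.trans hx), ← RForest.rootOf_of_some hx, hw.1]
  have hrb : ∀ {w}, T.block r w ↔ T.parent w = none := fun {w} =>
    ⟨fun h => (T.block_parent _ _ h).symm.trans hr, fun h => T.block_root _ _ hr h⟩
  have hbr : ∀ {w}, T.block w r ↔ T.parent w = none := fun {w} =>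
    ⟨fun h => (T.block_parent _ _ h).trans hr, fun h => T.block_root _ _ h hr⟩
  .ofBijective (prodElim (rootElim r resVal) mresVal)
    ⟨by
      refine prod_cases (root_cases ?_ (res_cases fun v hv => ?_)) (mres_cases fun v hv => ?_) <;>
        refine prod_cases (root_cases ?_ (res_cases fun w hw => ?_))
          (mres_cases fun w hw => ?_) <;> simp
      · rintro rfl; exact hw hrr
      · rintro rfl; exact hw.2 rfl
      · rintro rfl; exact hv hrr
      · rintro rfl; exact hv hw.1
      · rintro rfl; exact hv.2 rfl
      · rintro rfl; exact hw hv.1,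
    fun v => by
      by_cases hv : T.rootOf v = r
      · by_cases hvr : v = r
        · exact ⟨prodL _ _ (rootN _ _), hvr.symm⟩
        · exact ⟨prodL _ _ (rootS _ _ (resV _ _ v ⟨hv, hvr⟩)), rfl⟩
      · exact ⟨prodR _ _ (mresV _ _ v hv), rfl⟩⟩
    (by
      refine prod_cases (root_cases ?_ (res_cases fun v hv => ?_)) (mres_cases fun v hv => ?_) <;>
        refine prod_cases (root_cases ?_ (res_cases fun w hw => ?_))
          (mres_cases fun w hw => ?_) <;> simp
      · simp [hr]
      · exact hp' hw hrr
      · exact habove hw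
      · simp [hr]
      · exact hp hv hw.1
      · simp [hr]
      · exact hp' hw hv.1)
    (by
      refine prod_cases (root_cases ?_ (res_cases fun v hv => ?_)) (mres_cases fun v hv => ?_) <;>
        simp)
    (by
      refine prod_cases (root_cases ?_ (res_cases fun v hv => ?_)) (mres_cases fun v hv => ?_) <;>
        refine prod_cases (root_cases ?_ (res_cases fun w hw => ?_))
          (mres_cases fun w hw => ?_) <;> simp
      · rw [hrb, hroot hw]
      · rw [hrb]; exact hne hw
      · rw [hbr, hroot hv]
      · rw [hroot hv, hroot hw]; exact T.block_root v w
      · exact fun h => hv (hb h hw)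
      · rw [hbr]; exact hne hv
      · exact fun h => hw (hb (T.block.symm h) hv))

end PTree

/-! ### Trees with a single root, and insertions in them -/

namespace PForest

open PTree

variable {D : Type u}

theorem Iso.card_eq {F G : PForest D} (e : Iso F G) : Nat.card F.V = Nat.card G.V :=
  Nat.card_congr e.toEquiv

theorem card_disj (F G : PForest D) : Nat.card (F.disj G).V = Nat.card F.V + Nat.card G.V :=
  Nat.card_sum

theorem card_graft (F : PForest D) (s : F.V) (T' : PTree D) :
    Nat.card (F.graft s T').V = Nat.card F.V + Nat.card T'.V :=
  Nat.card_sum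

theorem card_restrict_lt (F : PForest D) (S : Set F.V) (r : F.V) (hr : r ∉ S) :
    Nat.card (F.restrict S).V < Nat.card F.V :=
  Finite.card_subtype_lt hr

/-- Adding a root is compatible with isomorphisms. -/
def Iso.root {F G : PForest D} (e : Iso F G) (x : D) :
    PTree.Iso (root x F) (PForest.root x G) :=
  .ofEdges
    { toFun := rootElim (rootN _ _) (fun v => rootS _ _ (e.toEquiv v))
      invFun := rootElim (rootN _ _) (fun v => rootS _ _ (e.toEquiv.symm v))
      left_inv := root_cases (by simp) (by simp)
      right_inv := root_cases (by simp) (by simp) }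
    (by
      refine root_cases ?_ fun v => ?_ <;> refine root_cases ?_ fun w => ?_ <;>
        simp [e.parent_none, e.parent_iff])
    (by
      refine root_cases ?_ fun v => ?_
      · simp
      · simpa using e.map_deco v)
    (by
      refine root_cases ?_ fun v => ?_ <;> refine root_cases ?_ fun w => ?_ <;>
        simp [e.block_iff])

/-- The tree with a root and no other vertex. -/
def rootEmpty (x : D) (F : PForest D) [IsEmpty F.V] : PTree.Iso (root x F) (point x) :=
  .ofEdges
    { toFun := fun _ => ()
      invFun := fun _ => rootN x F
      left_inv := root_cases (by simp) isEmptyElim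
      right_inv := fun _ => rfl }
    (by
      refine root_cases ?_ isEmptyElim
      refine root_cases ?_ isEmptyElim
      simp [point])
    (root_cases rfl isEmptyElim)
    (by
      refine root_cases ?_ isEmptyElim
      refine root_cases ?_ isEmptyElim
      simp)

section

variable (x : ℕ × D) (F : PForest (ℕ × D)) (T' : PTree (ℕ × D)) [Nonempty T'.V]

/-- Inserting a tree at the root. -/
noncomputable def rootInsN :
    PTree.Iso ((root x F).ins (rootN x F) T') (root x (F.disj T'.toPForest)) :=
  .ofEdges
    { toFun := insElim (rootElim (rootN _ _) fun v => rootS _ _ (disjL _ _ v))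
        (fun v => rootS _ _ (disjR _ _ v))
      invFun := rootElim (insL _ _ _ (rootN _ _))
        (disjElim (fun v => insL _ _ _ (rootS _ _ v)) (fun v => insR _ _ _ v))
      left_inv := ins_cases (root_cases (by simp) (by simp)) (by simp)
      right_inv := root_cases (by simp) (disj_cases (by simp) (by simp)) }
    (by
      refine ins_cases (root_cases ?_ fun v => ?_) (fun v => ?_) <;>
        refine ins_cases (root_cases ?_ fun w => ?_) (fun w => ?_) <;> simp [-Option.elim_map])
    (by
      refine ins_cases (root_cases ?_ fun v => ?_) (fun v => ?_) <;> simp)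
    (by
      refine ins_cases (root_cases ?_ fun v => ?_) (fun v => ?_) <;>
        refine ins_cases (root_cases ?_ fun w => ?_) (fun w => ?_) <;> simp)

/-- Inserting a tree at a vertex which is not the root. -/
noncomputable def rootInsS (s : F.V) :
    PTree.Iso ((root x F).ins (rootS x F s) T') (root x (F.graft s T')) :=
  .ofEdges
    { toFun := insElim (rootElim (rootN _ _) fun v => rootS _ _ (graftL _ _ _ v))
        (fun v => rootS _ _ (graftR _ _ _ v))
      invFun := rootElim (insL _ _ _ (rootN _ _))
        (graftElim (fun v => insL _ _ _ (rootS _ _ v)) (fun v => insR _ _ _ v))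
      left_inv := ins_cases (root_cases (by simp) (by simp)) (by simp)
      right_inv := root_cases (by simp) (graft_cases (by simp) (by simp)) }
    (by
      refine ins_cases (root_cases ?_ fun v => ?_) (fun v => ?_) <;>
        refine ins_cases (root_cases ?_ fun w => ?_) (fun w => ?_) <;> simp [-Option.elim_map]
      all_goals cases T'.parent w <;> simp)
    (by
      refine ins_cases (root_cases ?_ fun v => ?_) (fun v => ?_) <;> simp)
    (by
      refine ins_cases (root_cases ?_ fun v => ?_) (fun v => ?_) <;>
        refine ins_cases (root_cases ?_ fun w => ?_) (fun w => ?_) <;> simp)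

end

end PForest

/-! ### An induction principle adapted to the two products -/

namespace PTree

open PForest

variable {D : Type u}

/-- Induction on partitioned trees. -/
theorem induction {P : PTree (ℕ × D) → Prop}
    (iso : ∀ {T S : PTree (ℕ × D)}, T.Iso S → P T → P S)
    (empty : ∀ T : PTree (ℕ × D), IsEmpty T.V → P T)
    (prod : ∀ T T' : PTree (ℕ × D), P T → P T' → P (T.prod T'))
    (point : ∀ x, P (point x))
    (ins : ∀ (S T' : PTree (ℕ × D)) (r : S.V), Nonempty T'.V → P S → P T' →
      (∀ s ≠ r, P (S.ins s T')) → P (S.ins r T')) (T : PTree (ℕ × D)) : P T := by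
  induction h : Nat.card T.V using Nat.strong_induction_on generalizing T with
  | _ n ih =>
  cases isEmpty_or_nonempty T.V with
  | inl h => exact empty T h
  | inr hT =>
    -- For one root, a second induction is made, on the number of roots of the forest `F` above it.
    -- Inserting `T'` at the root of `root x F` adds `T'` to this forest. The other insertions have
    -- the same number of vertices, but fewer trees directly above the root.
    have key : ∀ (x : ℕ × D) (F : PForest (ℕ × D)), Nat.card F.V < n → P (root x F) := by
      intro x F
      induction F using PForest.induction with
      | iso e hF =>
        intro h
        exact iso (e.root x) (hF (e.card_eq ▸ h))
      | empty F hF => exact fun _ => iso (rootEmpty x F).symm (point x)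
      | disj F T' hT' hF hs =>
        intro hn
        rw [card_disj] at hn
        refine iso (rootInsN x F T') (ins _ _ _ hT' (hF (by omega)) (ih _ (by omega) _ rfl) ?_)
        refine root_cases (fun h => (h rfl).elim) fun s _ => ?_
        exact iso (rootInsS x F T' s).symm (hs s (by rwa [card_graft]))
    obtain ⟨r, hr⟩ := T.toRForest.exists_root
    -- In general the tree is the product of the tree of `r` and of the rest. Neither the forest
    -- above `r` nor the rest contains `r`, so both have fewer than `n` vertices.
    refine iso (T.splitIso r hr) (prod _ _ (key _ _ ?_) (ih _ ?_ _ rfl))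
    · rw [← h]
      exact card_restrict_lt _ _ r fun h => h.2 rfl
    · rw [← h]
      exact card_restrict_lt T.toPForest _ r fun h => h (RForest.rootOf_of_none hr)

end PTree

/-! ### Generation by the one-vertex trees -/

namespace UCP

open PTree

variable {K : Type w} [Field K] {D : Type u}

/-- `UCP(D)` is generated by the trees with one vertex. -/
theorem submodule_eq_top (W : Submodule K (UCP K D)) (one : 1 ∈ W)
    (point : ∀ x, of K (point x) ∈ W) (mul : ∀ x ∈ W, ∀ y ∈ W, x * y ∈ W)
    (bullet : ∀ x ∈ W, ∀ y ∈ W, bullet K D x y ∈ W) : W = ⊤ := by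
  rw [eq_top_iff]
  rintro x -
  induction x using induction_on with
  | add x y hx hy => exact W.add_mem hx hy
  | smul c x hx => exact W.smul_mem c hx
  | of T =>
  induction T using PTree.induction with
  | iso e h => rwa [← of_congr K e]
  | empty T h => rwa [of_isEmpty]
  | prod T T' h h' => rw [← of_mul]; exact mul _ h _ h'
  | point x => exact point x
  | ins S T' r _ hS hT' hs =>
    classical
    have h := bullet _ hS _ hT'
    -- The product `S • T'` is in `W`, as are all its terms but the one at `r`; hence so is that
    -- one.
    rw [bullet_of_eq_sum, ← Finset.add_sum_erase _ _ (Finset.mem_univ r)] at h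
    refine (W.add_mem_iff_left (W.sum_mem fun s hs' => ?_)).1 h
    exact hs s (Finset.ne_of_mem_erase hs')

end UCP

/-! ### Com-PreLie bialgebras: coassociativity and quotients -/

section Abstract

variable {K : Type w} [Field K] {A : Type u} [CommRing A] [Algebra K A]
  {b : A →ₗ[K] A →ₗ[K] A} {Δ : A →ₗ[K] A ⊗[K] A} {ε : A →ₗ[K] K}

section Coassoc

theorem map₂_mul (x y : A ⊗[K] A) :
    TensorProduct.map₂ (LinearMap.mul K A) (LinearMap.mul K A) x y = x * y := by
  induction x with
  | zero => simp
  | add x x' h h' => simp [h, h', add_mul]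
  | tmul a a' =>
    induction y with
    | zero => simp
    | add y y' h h' => rw [map_add, h, h', mul_add]
    | tmul c c' => simp

/-- Both iterated coproducts are multiplicative. -/
theorem coassoc_mul (hm : ∀ x y, Δ (x * y) = Δ x * Δ y) {x y : A}
    (hx : TensorProduct.assoc K A A A (Δ.rTensor A (Δ x)) = Δ.lTensor A (Δ x))
    (hy : TensorProduct.assoc K A A A (Δ.rTensor A (Δ y)) = Δ.lTensor A (Δ y)) :
    TensorProduct.assoc K A A A (Δ.rTensor A (Δ (x * y))) = Δ.lTensor A (Δ (x * y)) := by
  have h1 : ∀ t u, Δ.rTensor A (t * u) = Δ.rTensor A t * Δ.rTensor A u := by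
    intro t u
    induction t with
    | zero => simp
    | add t t' h h' => simp [h, h', add_mul]
    | tmul a a' =>
      induction u with
      | zero => simp
      | add t t' h h' => simp [h, h', mul_add]
      | tmul c c' => simp [hm]
  have h2 : ∀ t u, Δ.lTensor A (t * u) = Δ.lTensor A t * Δ.lTensor A u := by
    intro t u
    induction t with
    | zero => simp
    | add t t' h h' => simp [h, h', add_mul]
    | tmul a a' =>
      induction u with
      | zero => simp
      | add t t' h h' => simp [h, h', mul_add]
      | tmul c c' => simp [hm]
  rw [hm, h1, h2, ← hx, ← hy]
  exact map_mul (Algebra.TensorProduct.assoc K K K A A A) _ _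

/-- Both iterated coproducts of `x • y` expand, by the axioms, to `x⁽¹⁾ ⊗ x⁽²⁾ ⊗ (x⁽³⁾ • y) + x⁽¹⁾ ⊗
(x⁽²⁾ • y⁽¹⁾) ⊗ x⁽³⁾y⁽²⁾ + (x⁽¹⁾ • y⁽¹⁾) ⊗ x⁽²⁾y⁽²⁾ ⊗ x⁽³⁾y⁽³⁾`, where the iterated coproducts of
`x` and `y` are unambiguous by hypothesis. -/
theorem coassoc_bullet (hm : ∀ x y, Δ (x * y) = Δ x * Δ y)
    (hb : ∀ x y, Δ (b x y) =
      (b.flip y).lTensor A (Δ x) + TensorProduct.map₂ b (LinearMap.mul K A) (Δ x) (Δ y))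
    {x y : A}
    (hx : TensorProduct.assoc K A A A (Δ.rTensor A (Δ x)) = Δ.lTensor A (Δ x))
    (hy : TensorProduct.assoc K A A A (Δ.rTensor A (Δ y)) = Δ.lTensor A (Δ y)) :
    TensorProduct.assoc K A A A (Δ.rTensor A (Δ (b x y))) = Δ.lTensor A (Δ (b x y)) := by
  let m := LinearMap.mul K A
  let α := TensorProduct.assoc K A A A
  -- In the three-term expansion, `M` produces the last term and `N` the middle one.
  let M := TensorProduct.map₂ b (TensorProduct.map₂ m m)
  let N : A ⊗[K] A →ₗ[K] A ⊗[K] (A ⊗[K] A) →ₗ[K] A ⊗[K] (A ⊗[K] A) :=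
    LinearMap.lTensorHom A ∘ₗ (TensorProduct.map₂ b m).flip
  have h1 : ∀ t, α (Δ.rTensor A ((b.flip y).lTensor A t)) =
      ((b.flip y).lTensor A).lTensor A (α (Δ.rTensor A t)) := by
    intro t
    induction t with
    | zero => simp
    | add t t' h h' => simp only [map_add, h, h']
    | tmul a a' =>
      simp only [LinearMap.rTensor_tmul, LinearMap.lTensor_tmul]
      induction Δ a with
      | zero => simp
      | add t t' h h' => simp only [TensorProduct.add_tmul, map_add, h, h']
      | tmul c c' => simp [α]
  have h2 : ∀ t u, α (Δ.rTensor A (TensorProduct.map₂ b m t u)) =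
      N u (α (Δ.rTensor A t)) + M (α (Δ.rTensor A t)) (α (Δ.rTensor A u)) := by
    intro t u
    induction t with
    | zero => simp
    | add t t' h h' => simp only [map_add, LinearMap.add_apply, h, h']; abel
    | tmul a a' =>
      induction u with
      | zero => simp
      | add u u' h h' =>
        simp only [map_add, LinearMap.add_apply, h, h']; abel
      | tmul c c' =>
        simp only [TensorProduct.map₂_apply_tmul, LinearMap.rTensor_tmul, TensorProduct.map_tmul,
          hb, TensorProduct.add_tmul, map_add]
        congr 1
        · induction Δ a with
          | zero => simp
          | add t t' h h' => simp only [TensorProduct.add_tmul, map_add, h, h']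
          | tmul d d' => simp [α, N]
        · induction Δ a with
          | zero => simp
          | add t t' h h' =>
            simp only [TensorProduct.add_tmul, map_add, LinearMap.add_apply, h, h']
          | tmul d d' =>
            induction Δ c with
            | zero => simp
            | add t t' h h' => simp only [TensorProduct.add_tmul, map_add, h, h']
            | tmul e e' => simp [α, M, m]
  have h3 : ∀ t, Δ.lTensor A ((b.flip y).lTensor A t) =
      ((b.flip y).lTensor A).lTensor A (Δ.lTensor A t) + N (Δ y) (Δ.lTensor A t) := by
    intro t
    induction t with
    | zero => simp
    | add t t' h h' => simp only [map_add, h, h']; abel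
    | tmul a a' => simp [hb, TensorProduct.tmul_add, N, m]
  have h4 : ∀ t u, Δ.lTensor A (TensorProduct.map₂ b m t u) =
      M (Δ.lTensor A t) (Δ.lTensor A u) := by
    intro t u
    induction t with
    | zero => simp
    | add t t' h h' => simp only [map_add, LinearMap.add_apply, h, h']
    | tmul a a' =>
      induction u with
      | zero => simp
      | add u u' h h' => simp only [map_add, h, h']
      | tmul c c' => simp [M, m, hm, map₂_mul]
  rw [hb, map_add, map_add, map_add]
  refine (congrArg₂ _ (h1 _) (h2 _ _)).trans (Eq.trans ?_ (congrArg₂ _ (h3 _) (h4 _ _)).symm)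
  rw [hx, hy]
  abel

end Coassoc

section Transfer

variable {B : Type v} [CommRing B] [Algebra K B] {b' : B →ₗ[K] B →ₗ[K] B}
  {Δ' : B →ₗ[K] B ⊗[K] B} {ε' : B →ₗ[K] K} (p : A →ₐ[K] B)

theorem map_lTensor_flip (hp : ∀ x y, p (b x y) = b' (p x) (p y)) (y : A) (t : A ⊗[K] A) :
    TensorProduct.map p.toLinearMap p.toLinearMap ((b.flip y).lTensor A t) =
      (b'.flip (p y)).lTensor B (TensorProduct.map p.toLinearMap p.toLinearMap t) := by
  induction t with
  | zero => simp
  | add t t' h h' => simp only [map_add, h, h']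
  | tmul a a' => simp [hp]

theorem map_map₂ (hp : ∀ x y, p (b x y) = b' (p x) (p y)) (t u : A ⊗[K] A) :
    TensorProduct.map p.toLinearMap p.toLinearMap
        (TensorProduct.map₂ b (LinearMap.mul K A) t u) =
      TensorProduct.map₂ b' (LinearMap.mul K B)
        (TensorProduct.map p.toLinearMap p.toLinearMap t)
        (TensorProduct.map p.toLinearMap p.toLinearMap u) := by
  induction t with
  | zero => simp
  | add t t' h h' => simp only [map_add, LinearMap.add_apply, h, h']
  | tmul a a' =>
    induction u with
    | zero => simp
    | add u u' h h' => simp only [map_add, h, h']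
    | tmul c c' => simp [hp]

theorem map_mul_tensor (t u : A ⊗[K] A) :
    TensorProduct.map p.toLinearMap p.toLinearMap (t * u) =
      TensorProduct.map p.toLinearMap p.toLinearMap t *
        TensorProduct.map p.toLinearMap p.toLinearMap u :=
  map_mul (Algebra.TensorProduct.map p p) t u

/-- The structure of Com-PreLie bialgebra goes through surjective morphisms. -/
theorem IsComPreLieBialgebra.of_surjective (hA : IsComPreLieBialgebra K b Δ ε)
    (hsurj : Function.Surjective p) (hom : IsComPreLieBialgebraHom K b Δ ε b' Δ' ε' p) :
    IsComPreLieBialgebra K b' Δ' ε' where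
  preLie := by
    intro x y z
    obtain ⟨x, rfl⟩ := hsurj x
    obtain ⟨y, rfl⟩ := hsurj y
    obtain ⟨z, rfl⟩ := hsurj z
    simp only [← hom.map_bullet, ← map_sub, hA.preLie x y z]
  leibniz := by
    intro x y z
    obtain ⟨x, rfl⟩ := hsurj x
    obtain ⟨y, rfl⟩ := hsurj y
    obtain ⟨z, rfl⟩ := hsurj z
    simp only [← hom.map_bullet, ← map_mul, ← map_add, hA.leibniz x y z]
  coassoc := by
    ext x
    obtain ⟨x, rfl⟩ := hsurj x
    have h := DFunLike.congr_fun hA.coassoc x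
    simp only [LinearMap.comp_apply, LinearEquiv.coe_coe] at h ⊢
    rw [hom.map_comul]
    have h1 : ∀ t, TensorProduct.assoc K B B B (Δ'.rTensor B
        (TensorProduct.map p.toLinearMap p.toLinearMap t)) =
        TensorProduct.map p.toLinearMap (TensorProduct.map p.toLinearMap p.toLinearMap)
          (TensorProduct.assoc K A A A (Δ.rTensor A t)) := by
      intro t
      induction t with
      | zero => simp
      | add t t' h h' => simp only [map_add, h, h']
      | tmul a a' =>
        simp only [TensorProduct.map_tmul, AlgHom.toLinearMap_apply, LinearMap.rTensor_tmul,
          hom.map_comul]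
        induction Δ a with
        | zero => simp
        | add t t' h h' => simp only [TensorProduct.add_tmul, map_add, h, h']
        | tmul c c' => simp
    have h2 : ∀ t, Δ'.lTensor B (TensorProduct.map p.toLinearMap p.toLinearMap t) =
        TensorProduct.map p.toLinearMap (TensorProduct.map p.toLinearMap p.toLinearMap)
          (Δ.lTensor A t) := by
      intro t
      induction t with
      | zero => simp
      | add t t' h h' => simp only [map_add, h, h']
      | tmul a a' => simp [hom.map_comul]
    rw [h1, h2, h]
  rTensor_counit := by
    intro x
    obtain ⟨x, rfl⟩ := hsurj x
    have h : ∀ t, ε'.rTensor B (TensorProduct.map p.toLinearMap p.toLinearMap t) =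
        p.toLinearMap.lTensor K (ε.rTensor A t) := by
      intro t
      induction t with
      | zero => simp
      | add t t' h h' => simp only [map_add, h, h']
      | tmul a a' => simp [hom.map_counit]
    rw [hom.map_comul, h, hA.rTensor_counit]
    simp
  lTensor_counit := by
    intro x
    obtain ⟨x, rfl⟩ := hsurj x
    have h : ∀ t, ε'.lTensor B (TensorProduct.map p.toLinearMap p.toLinearMap t) =
        p.toLinearMap.rTensor K (ε.lTensor A t) := by
      intro t
      induction t with
      | zero => simp
      | add t t' h h' => simp only [map_add, h, h']
      | tmul a a' => simp [hom.map_counit]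
    rw [hom.map_comul, h, hA.lTensor_counit]
    simp
  comul_one := by
    rw [← map_one p, hom.map_comul, hA.comul_one]
    simp [Algebra.TensorProduct.one_def]
  comul_mul := by
    intro x y
    obtain ⟨x, rfl⟩ := hsurj x
    obtain ⟨y, rfl⟩ := hsurj y
    rw [← map_mul, hom.map_comul, hom.map_comul, hom.map_comul, hA.comul_mul, map_mul_tensor]
  counit_one := by rw [← map_one p, hom.map_counit, hA.counit_one]
  counit_mul := by
    intro x y
    obtain ⟨x, rfl⟩ := hsurj x
    obtain ⟨y, rfl⟩ := hsurj y
    rw [← map_mul, hom.map_counit, hom.map_counit, hom.map_counit, hA.counit_mul]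
  comul_bullet := by
    intro x y
    obtain ⟨x, rfl⟩ := hsurj x
    obtain ⟨y, rfl⟩ := hsurj y
    rw [← hom.map_bullet, hom.map_comul, hom.map_comul, hom.map_comul, hA.comul_bullet, map_add,
      map_lTensor_flip p hom.map_bullet, map_map₂ p hom.map_bullet]

/-- The kernel of a morphism is a biideal, if it is generated by elements whose coproducts and
counits vanish in the image. -/
theorem comul_counit_eq_zero_of_mem_ker (hA : IsComPreLieBialgebra K b Δ ε)
    (hε : ∀ x y, ε (b x y) = 0) (hp : ∀ x y, p (b x y) = b' (p x) (p y)) {s : Set A}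
    (hker : RingHom.ker p = idealSpan b s)
    (hs : ∀ x ∈ s, TensorProduct.map p.toLinearMap p.toLinearMap (Δ x) = 0 ∧ ε x = 0)
    {x : A} (hx : p x = 0) :
    TensorProduct.map p.toLinearMap p.toLinearMap (Δ x) = 0 ∧ ε x = 0 := by
  -- These elements form a Com-PreLie ideal which contains the generators. The condition `p x = 0`
  -- has to be included, because the coproduct of `a • x` contains the term `a⁽¹⁾ ⊗ (a⁽²⁾ • x)`,
  -- with `x` itself.
  let I : Ideal A :=
    { carrier := {x | p x = 0 ∧ TensorProduct.map p.toLinearMap p.toLinearMap (Δ x) = 0 ∧ ε x = 0}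
      zero_mem' := by simp
      add_mem' := by
        rintro x y ⟨h1, h2, h3⟩ ⟨h1', h2', h3'⟩
        exact ⟨by rw [map_add, h1, h1', add_zero], by rw [map_add, map_add, h2, h2', add_zero],
          by rw [map_add, h3, h3', add_zero]⟩
      smul_mem' := by
        rintro a x ⟨h1, h2, h3⟩
        exact ⟨by rw [smul_eq_mul, map_mul, h1, mul_zero],
          by rw [smul_eq_mul, hA.comul_mul, map_mul_tensor, h2, mul_zero],
          by rw [smul_eq_mul, hA.counit_mul, h3, mul_zero]⟩ }
  have hI : idealSpan b s ≤ I := by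
    refine sInf_le ⟨?_, fun x hx => ⟨?_, hs x hx⟩⟩
    · rintro x ⟨h1, h2, h3⟩ a
      refine ⟨⟨?_, ?_, hε _ _⟩, ⟨?_, ?_, hε _ _⟩⟩
      · rw [hp, h1, map_zero, LinearMap.zero_apply]
      · rw [hA.comul_bullet, map_add, map_lTensor_flip p hp, map_map₂ p hp, h2]
        simp
      · rw [hp, h1, map_zero]
      · rw [hA.comul_bullet, map_add, map_lTensor_flip p hp, map_map₂ p hp, h2, h1]
        simp
    · have : x ∈ RingHom.ker p := by
        rw [hker]
        simp only [idealSpan, Submodule.mem_sInf]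
        exact fun J hJ => hJ.2 hx
      exact this
  exact (hI (hker ▸ (RingHom.mem_ker.2 hx))).2

/-- The quotient of a Com-PreLie bialgebra by the Com-PreLie ideal generated by elements whose
coproducts and counits vanish in the quotient is a Com-PreLie bialgebra. -/
theorem exists_quotient (hA : IsComPreLieBialgebra K b Δ ε)
    (hε : ∀ x y, ε (b x y) = 0) (hsurj : Function.Surjective p)
    (hp : ∀ x y, p (b x y) = b' (p x) (p y)) {s : Set A}
    (hker : RingHom.ker p = idealSpan b s)
    (hs : ∀ x ∈ s, TensorProduct.map p.toLinearMap p.toLinearMap (Δ x) = 0 ∧ ε x = 0) :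
    ∃ (Δ' : B →ₗ[K] B ⊗[K] B) (ε' : B →ₗ[K] K), IsComPreLieBialgebra K b' Δ' ε' ∧
      IsComPreLieBialgebraHom K b Δ ε b' Δ' ε' p := by
  -- The coproduct and the counit of the quotient are computed on representatives given by a linear
  -- section `g`. They do not depend on the choice, as `g (p x) - x` is in the kernel.
  obtain ⟨g, hg⟩ := p.toLinearMap.exists_rightInverse_of_surjective
    (LinearMap.range_eq_top.2 hsurj)
  have hg' : ∀ x, p (g (p x) - x) = 0 := fun x => by
    rw [map_sub, sub_eq_zero]
    exact DFunLike.congr_fun hg (p x)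
  have key := fun x => comul_counit_eq_zero_of_mem_ker p hA hε hp hker hs (hg' x)
  have hom : IsComPreLieBialgebraHom K b Δ ε b'
      (TensorProduct.map p.toLinearMap p.toLinearMap ∘ₗ Δ ∘ₗ g) (ε ∘ₗ g) p :=
    { map_comul := fun x => by
        have := (key x).1
        rwa [map_sub, map_sub, sub_eq_zero] at this
      map_counit := fun x => by
        have := (key x).2
        rwa [map_sub, sub_eq_zero] at this
      map_bullet := hp }
  exact ⟨_, _, hA.of_surjective p hsurj hom, hom⟩

end Transfer

end Abstract

/-! ### The bialgebra `UCP(D)` -/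

namespace PTree

variable {D : Type u}

instance : IsEmpty (PTree.empty D).V := inferInstanceAs (IsEmpty Empty)

@[simp] theorem point_parent (x : D) (v : (point x).V) : (point x).parent v = none := rfl

@[simp] theorem point_deco (x : D) (v : (point x).V) : (point x).deco v = x := rfl

@[simp] theorem point_block (x : D) (v w : (point x).V) : (point x).block v w := trivial

theorem cls_eq_one_iff (T : PTree D) : T.cls = 1 ↔ IsEmpty T.V := by
  constructor
  · intro h
    obtain ⟨e⟩ := Quotient.exact h
    exact e.toEquiv.isEmpty
  · intro h
    exact Quotient.sound ⟨PForest.Iso.ofEdges (Equiv.equivOfIsEmpty T.V Empty)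
      (fun v => isEmptyElim v) (fun v => isEmptyElim v) (fun v => isEmptyElim v)⟩

theorem isEmpty_prod_iff (T T' : PTree D) : IsEmpty (T.prod T').V ↔ IsEmpty T.V ∧ IsEmpty T'.V :=
  isEmpty_sum

theorem blockCount_empty (F : PForest D) (v : F.V) : F.blockCount ∅ v = 0 := by
  unfold PForest.blockCount
  refine (congrArg Set.ncard (Set.ext fun C => ?_)).trans (Set.ncard_empty _)
  simp only [Set.mem_ofPred_eq, Set.mem_empty_iff_false, iff_false, not_and]
  rintro - h ⟨w, hw, -⟩
  exact h hw

/-- `R^I(T)` for the empty ideal. -/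
noncomputable def isoREmpty (T : PTree (ℕ × D)) (I : T.Ideals) (h : I.1 = ∅) : Iso T (T.R I) :=
  have h' : ∀ v, v ∉ I.1 := fun v => h ▸ id
  .ofBijective (fun v => RV T I v (h' v))
    ⟨fun v w => by simp, R_cases fun v _ => ⟨v, rfl⟩⟩ (by simp)
    (fun v => by simp [h, blockCount_empty]) (by simp)

/-- `P^I(T)` for the ideal of all the vertices. -/
noncomputable def isoPUniv (T : PTree (ℕ × D)) (I : T.Ideals) (h : I.1 = Set.univ) :
    Iso T (T.P I) :=
  have h' : ∀ v, v ∈ I.1 := fun v => h ▸ trivial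
  .ofBijective (fun v => PV T I v (h' v))
    ⟨fun v w => by simp, P_cases fun v _ => ⟨v, rfl⟩⟩ (by simp) (fun v => by simp)
    (fun v w => by
      cases hv : T.parent v <;> cases hw : T.parent w <;> simp [h, hv, hw]
      exact T.block_root v w hv hw)

end PTree

namespace UCP

open PTree

variable {K : Type w} [Field K] {D : Type u}

theorem comul_one : comul K D 1 = 1 := by
  rw [one_eq, comul_of]
  have : Subsingleton (PTree.empty (ℕ × D)).Ideals :=
    inferInstanceAs (Subsingleton {I : Set (PTree.empty (ℕ × D)).V // _})
  rw [Fintype.sum_subsingleton _ ⟨∅, fun v => isEmptyElim v⟩]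
  have h1 : IsEmpty ((PTree.empty (ℕ × D)).R ⟨∅, fun v => isEmptyElim v⟩).V :=
    ⟨fun v => isEmptyElim v.1⟩
  have h2 : IsEmpty ((PTree.empty (ℕ × D)).P ⟨∅, fun v => isEmptyElim v⟩).V :=
    ⟨fun v => isEmptyElim v.1⟩
  rw [of_isEmpty, of_isEmpty]
  rfl

/-- The empty and the full set are the only ideals, so one-vertex trees are primitive. -/
theorem comul_point (x : ℕ × D) :
    comul K D (of K (point x)) = of K (point x) ⊗ₜ[K] 1 + 1 ⊗ₜ[K] of K (point x) := by
  have : Nonempty (point x).V := ⟨()⟩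
  let I : (point x).Ideals := ⟨∅, fun v w h _ => h⟩
  let J : (point x).Ideals := ⟨Set.univ, fun v w h _ => h⟩
  have hIJ : I ≠ J := fun h => by
    have := congrArg Subtype.val h
    exact Set.empty_ne_univ this
  rw [comul_of, Fintype.sum_eq_add I J hIJ]
  · have h1 : IsEmpty ((point x).P I).V := ⟨fun v => v.2⟩
    have h2 : IsEmpty ((point x).R J).V := ⟨fun v => v.2 trivial⟩
    rw [of_isEmpty ((point x).P I), of_isEmpty ((point x).R J), ← of_congr K (isoREmpty _ I rfl),
      ← of_congr K (isoPUniv _ J rfl)]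
  · rintro L ⟨hI, hJ⟩
    by_cases h : (() : (point x).V) ∈ L.1
    · exact (hJ (Subtype.ext (Set.eq_univ_of_forall fun _ => h))).elim
    · exact (hI (Subtype.ext (Set.eq_empty_of_forall_notMem fun _ => h))).elim

open Classical in
theorem counit_of (T : PTree (ℕ × D)) : counit K D (of K T) = if IsEmpty T.V then 1 else 0 := by
  rw [of_eq_basis, counit, Module.Basis.constr_basis]
  simp only [cls_eq_one_iff]

theorem counit_one : counit K D 1 = 1 := by
  rw [one_eq, counit_of]
  exact if_pos (inferInstanceAs (IsEmpty (PTree.empty (ℕ × D)).V))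

theorem counit_mul (x y : UCP K D) : counit K D (x * y) = counit K D x * counit K D y := by
  induction x using induction_on with
  | add x x' h h' => rw [add_mul, map_add, map_add, add_mul, h, h']
  | smul c x h => rw [smul_mul_assoc, map_smul, map_smul, smul_mul_assoc, h]
  | of T =>
    induction y using induction_on with
    | add x x' h h' => rw [mul_add, map_add, map_add, mul_add, h, h']
    | smul c x h => rw [mul_smul_comm, map_smul, map_smul, mul_smul_comm, h]
    | of T' =>
      rw [of_mul, counit_of, counit_of, counit_of, isEmpty_prod_iff]
      by_cases h : IsEmpty T.V <;> by_cases h' : IsEmpty T'.V <;> simp [h, h']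

theorem counit_bullet (x y : UCP K D) : counit K D (bullet K D x y) = 0 := by
  induction x using induction_on with
  | add x x' h h' => rw [map_add, LinearMap.add_apply, map_add, h, h', add_zero]
  | smul c x h => rw [map_smul, LinearMap.smul_apply, map_smul, h, smul_zero]
  | of T =>
    induction y using induction_on with
    | add x x' h h' => rw [map_add, map_add, h, h', add_zero]
    | smul c x h => rw [map_smul, map_smul, h, smul_zero]
    | of T' =>
      rw [bullet_of_eq_sum, map_sum]
      refine Finset.sum_eq_zero fun s _ => ?_
      rw [counit_of, if_neg (fun h => h.elim (insL T s T' s))]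

theorem counit_point (x : ℕ × D) : counit K D (of K (point x)) = 0 := by
  rw [counit_of, if_neg (fun h => h.elim ())]

/-- The coassociative elements form a subspace stable under both products which contains the
primitive one-vertex trees, and these generate everything. -/
theorem coassoc (x : UCP K D) :
    TensorProduct.assoc K _ _ _ ((comul K D).rTensor _ (comul K D x)) =
      (comul K D).lTensor _ (comul K D x) := by
  have h := submodule_eq_top (K := K) (D := D) (LinearMap.eqLocus
    ((TensorProduct.assoc K _ _ _).toLinearMap ∘ₗ (comul K D).rTensor _ ∘ₗ comul K D)
    ((comul K D).lTensor _ ∘ₗ comul K D)) ?_ ?_ ?_ ?_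
  · exact LinearMap.mem_eqLocus.1 (h ▸ Submodule.mem_top (x := x))
  · simp [comul_one, Algebra.TensorProduct.one_def]
  · intro x
    simp [comul_point, comul_one, Algebra.TensorProduct.one_def, TensorProduct.add_tmul,
      TensorProduct.tmul_add, add_assoc]
  · exact fun x hx y hy => coassoc_mul comul_mul hx hy
  · exact fun x hx y hy => coassoc_bullet comul_mul comul_bullet hx hy

theorem rTensor_counit (x : UCP K D) :
    (counit K D).rTensor _ (comul K D x) = 1 ⊗ₜ[K] x := by
  have h := submodule_eq_top (K := K) (D := D) (LinearMap.eqLocus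
    ((counit K D).rTensor _ ∘ₗ comul K D) (TensorProduct.mk K K (UCP K D) 1)) ?_ ?_ ?_ ?_
  · exact LinearMap.mem_eqLocus.1 (h ▸ Submodule.mem_top (x := x))
  · simp [comul_one, Algebra.TensorProduct.one_def, counit_one]
  · intro x
    simp [comul_point, counit_one, counit_point]
  · intro x hx y hy
    simp only [LinearMap.mem_eqLocus, LinearMap.comp_apply, TensorProduct.mk_apply] at hx hy ⊢
    have h : ∀ t u, (counit K D).rTensor (UCP K D) (t * u) =
        (counit K D).rTensor _ t * (counit K D).rTensor _ u := by
      intro t u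
      induction t with
      | zero => simp
      | add t t' h h' => simp [h, h', add_mul]
      | tmul a a' =>
        induction u with
        | zero => simp
        | add t t' h h' => simp [h, h', mul_add]
        | tmul c c' => simp [counit_mul]
    rw [comul_mul, h, hx, hy, Algebra.TensorProduct.tmul_mul_tmul, one_mul]
  · intro x hx y hy
    simp only [LinearMap.mem_eqLocus, LinearMap.comp_apply, TensorProduct.mk_apply] at hx hy ⊢
    have h1 : ∀ t, (counit K D).rTensor (UCP K D) (((bullet K D).flip y).lTensor _ t) =
        ((bullet K D).flip y).lTensor _ ((counit K D).rTensor _ t) := by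
      intro t
      induction t with
      | zero => simp
      | add t t' h h' => simp [h, h']
      | tmul a a' => simp
    -- The second term of `Δ(x • y)` has a preLie product on the left, where the counit vanishes.
    have h2 : ∀ t u, (counit K D).rTensor (UCP K D)
        (TensorProduct.map₂ (bullet K D) (LinearMap.mul K (UCP K D)) t u) = 0 := by
      intro t u
      induction t with
      | zero => simp
      | add t t' h h' => simp only [map_add, LinearMap.add_apply, h, h', add_zero]
      | tmul a a' =>
        induction u with
        | zero => simp
        | add t t' h h' => simp only [map_add, h, h', add_zero]
        | tmul c c' => simp [counit_bullet]
    rw [comul_bullet, map_add, h1, h2, hx, add_zero]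
    simp

theorem lTensor_counit (x : UCP K D) :
    (counit K D).lTensor _ (comul K D x) = x ⊗ₜ[K] 1 := by
  have h := submodule_eq_top (K := K) (D := D) (LinearMap.eqLocus
    ((counit K D).lTensor _ ∘ₗ comul K D) ((TensorProduct.mk K (UCP K D) K).flip 1)) ?_ ?_ ?_ ?_
  · exact LinearMap.mem_eqLocus.1 (h ▸ Submodule.mem_top (x := x))
  · simp [comul_one, Algebra.TensorProduct.one_def, counit_one]
  · intro x
    simp [comul_point, counit_one, counit_point]
  · intro x hx y hy
    simp only [LinearMap.mem_eqLocus, LinearMap.comp_apply, TensorProduct.mk_apply,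
      LinearMap.flip_apply] at hx hy ⊢
    have h : ∀ t u, (counit K D).lTensor (UCP K D) (t * u) =
        (counit K D).lTensor _ t * (counit K D).lTensor _ u := by
      intro t u
      induction t with
      | zero => simp
      | add t t' h h' => simp [h, h', add_mul]
      | tmul a a' =>
        induction u with
        | zero => simp
        | add t t' h h' => simp [h, h', mul_add]
        | tmul c c' => simp [counit_mul]
    rw [comul_mul, h, hx, hy, Algebra.TensorProduct.tmul_mul_tmul, one_mul]
  · intro x hx y hy
    simp only [LinearMap.mem_eqLocus, LinearMap.comp_apply, TensorProduct.mk_apply,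
      LinearMap.flip_apply] at hx hy ⊢
    -- On the right it is the first term which vanishes; the second one gives `x • y`.
    have h1 : ∀ t, (counit K D).lTensor (UCP K D) (((bullet K D).flip y).lTensor _ t) = 0 := by
      intro t
      induction t with
      | zero => simp
      | add t t' h h' => simp [h, h']
      | tmul a a' => simp [counit_bullet]
    have h2 : ∀ t u, (counit K D).lTensor (UCP K D)
        (TensorProduct.map₂ (bullet K D) (LinearMap.mul K (UCP K D)) t u) =
        TensorProduct.map₂ (bullet K D) (LinearMap.mul K K)
          ((counit K D).lTensor _ t) ((counit K D).lTensor _ u) := by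
      intro t u
      induction t with
      | zero => simp
      | add t t' h h' => simp only [map_add, LinearMap.add_apply, h, h']
      | tmul a a' =>
        induction u with
        | zero => simp
        | add t t' h h' => simp only [map_add, h, h']
        | tmul c c' => simp [counit_mul]
    rw [comul_bullet, map_add, h1, h2, hx, hy, zero_add]
    simp

theorem isComPreLieBialgebra :
    IsComPreLieBialgebra K (bullet K D) (comul K D) (counit K D) where
  toIsComPreLieAlgebra := isComPreLieAlgebra
  coassoc := LinearMap.ext coassoc
  rTensor_counit := rTensor_counit
  lTensor_counit := lTensor_counit
  comul_one := comul_one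
  comul_mul := comul_mul
  counit_one := counit_one
  counit_mul := counit_mul
  comul_bullet := comul_bullet

end UCP

/-! ### Changing the decorations -/

namespace PTree

variable {D : Type u} {E : Type v}

section MapV

variable (f : D → E) (T : PTree D)

/-- The vertices of a tree with new decorations. -/
def mapV (v : T.V) : (T.mapDeco f).V := v

variable {f T}

@[elab_as_elim]
theorem map_cases {p : (T.mapDeco f).V → Prop} (h : ∀ v, p (mapV f T v)) (v) : p v := h v

/-- Definition of a function on the vertices of a tree with new decorations. -/
def mapElim {α : Sort*} (g : T.V → α) (v : (T.mapDeco f).V) : α := g v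

@[simp] theorem mapElim_V {α : Sort*} (g : T.V → α) (v : T.V) :
    mapElim g (mapV f T v) = g v := rfl

@[simp] theorem mapV_inj {v w : T.V} : mapV f T v = mapV f T w ↔ v = w := Iff.rfl

@[simp] theorem mapV_parent (v : T.V) :
    (T.mapDeco f).parent (mapV f T v) = (T.parent v).map (mapV f T) := Option.map_id'.symm

@[simp] theorem mapV_deco (v : T.V) : (T.mapDeco f).deco (mapV f T v) = f (T.deco v) := rfl

@[simp] theorem mapV_block (v w : T.V) :
    (T.mapDeco f).block (mapV f T v) (mapV f T w) ↔ T.block v w := Iff.rfl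

end MapV

/-- Changing decorations is compatible with isomorphisms. -/
def Iso.mapDeco {T S : PTree D} (e : Iso T S) (f : D → E) : Iso (T.mapDeco f) (S.mapDeco f) where
  toEquiv := e.toEquiv
  map_parent := e.map_parent
  map_deco v := congrArg f (e.map_deco v)
  map_block := e.map_block

/-- Changing decorations is compatible with products. -/
noncomputable def prodMapDeco (T T' : PTree D) (f : D → E) :
    Iso ((T.mapDeco f).prod (T'.mapDeco f)) ((T.prod T').mapDeco f) :=
  .ofEdges
    { toFun := prodElim (mapElim fun v => mapV _ _ (prodL _ _ v))
        (mapElim fun v => mapV _ _ (prodR _ _ v))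
      invFun := mapElim (prodElim (fun v => prodL _ _ (mapV _ _ v))
        (fun v => prodR _ _ (mapV _ _ v)))
      left_inv := prod_cases (map_cases (by simp)) (map_cases (by simp))
      right_inv := map_cases (prod_cases (by simp) (by simp)) }
    (by
      refine prod_cases (map_cases fun v => ?_) (map_cases fun v => ?_) <;>
        refine prod_cases (map_cases fun w => ?_) (map_cases fun w => ?_) <;> simp)
    (by
      refine prod_cases (map_cases fun v => ?_) (map_cases fun v => ?_) <;> simp)
    (by
      refine prod_cases (map_cases fun v => ?_) (map_cases fun v => ?_) <;>
        refine prod_cases (map_cases fun w => ?_) (map_cases fun w => ?_) <;> simp)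

/-- The insertion of a tree which is not empty does not change the decorations. -/
noncomputable def insMapDeco (S T' : PTree (ℕ × D)) (s : S.V) [Nonempty T'.V]
    (f : ℕ × D → ℕ × D) :
    Iso ((S.mapDeco f).ins (mapV f S s) (T'.mapDeco f)) ((S.ins s T').mapDeco f) :=
  have : Nonempty (T'.mapDeco f).V := inferInstanceAs (Nonempty T'.V)
  .ofEdges
    { toFun := insElim (mapElim fun v => mapV _ _ (insL _ _ _ v))
        (mapElim fun v => mapV _ _ (insR _ _ _ v))
      invFun := mapElim (insElim (fun v => insL _ _ _ (mapV _ _ v))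
        (fun v => insR _ _ _ (mapV _ _ v)))
      left_inv := ins_cases (map_cases (by simp)) (map_cases (by simp))
      right_inv := map_cases (ins_cases (by simp) (by simp)) }
    (by
      refine ins_cases (map_cases fun v => ?_) (map_cases fun v => ?_) <;>
        refine ins_cases (map_cases fun w => ?_) (map_cases fun w => ?_) <;>
        simp [-Option.elim_map])
    (by
      refine ins_cases (map_cases fun v => ?_) (map_cases fun v => ?_) <;> simp)
    (by
      refine ins_cases (map_cases fun v => ?_) (map_cases fun v => ?_) <;>
        refine ins_cases (map_cases fun w => ?_) (map_cases fun w => ?_) <;> simp)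

end PTree

/-! ### The bialgebra `CP(D)` -/

theorem UCP.bullet_point_one {K : Type w} [Field K] {D : Type u} (i : ℕ) (d : D) :
    UCP.bullet K D (of K (PTree.point (i, d))) 1 = of K (PTree.point (i + 1, d)) := by
  have h : ∀ s, PTree.Iso ((PTree.point (i, d)).raise s) (PTree.point (i + 1, d)) := fun s =>
    .ofEdges (Equiv.refl Unit) (by simp [PTree.raise, PTree.point]) (by
      intro v
      exact (if_pos rfl).symm) (fun _ _ => Iff.rfl)
  have : Unique (PTree.point (i, d)).V := inferInstanceAs (Unique Unit)
  rw [one_eq, bullet_of, treeBullet, if_pos (inferInstanceAs (IsEmpty Empty)),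
    Fintype.sum_unique, of_congr K (h _)]

namespace CP

open PTree

variable {K : Type w} [Field K] {D : Type u}

theorem proj_surjective : Function.Surjective (proj K D) := Ideal.Quotient.mk_surjective

theorem ker_proj : RingHom.ker (proj K D) = idealId K D := Ideal.Quotient.mkₐ_ker K _

theorem proj_point_one (d : D) :
    proj K D (UCP.of K (point (1, d))) = proj K D (UCP.of K (point (0, d))) := by
  rw [← sub_eq_zero, ← map_sub, ← RingHom.mem_ker, ker_proj]
  simp only [idealId, idealSpan, Submodule.mem_sInf]
  exact fun I hI => hI.2 ⟨d, rfl⟩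

/-- Each generator of the ideal is the difference of two primitive elements which have the same
image in `CP(D)`. -/
theorem exists_bialgebra : ∃ (Δ : CP K D →ₗ[K] CP K D ⊗[K] CP K D) (ε : CP K D →ₗ[K] K),
    IsComPreLieBialgebra K (bullet K D) Δ ε ∧
    IsComPreLieBialgebraHom K (UCP.bullet K D) (UCP.comul K D) (UCP.counit K D)
      (bullet K D) Δ ε (proj K D) := by
  refine exists_quotient (proj K D) UCP.isComPreLieBialgebra UCP.counit_bullet proj_surjective
    (fun x y => (bullet_proj K D x y).symm) ker_proj ?_
  rintro _ ⟨d, rfl⟩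
  simp [UCP.comul_point, UCP.counit_point, proj_point_one]

/-- The operator `· • 1` sends `•_(i,d)` to `•_(i+1,d)`, and fixes the class of `•_(0,d)` by the
defining relation. -/
theorem proj_point (i : ℕ) (d : D) :
    proj K D (UCP.of K (point (i, d))) = proj K D (UCP.of K (point (0, d))) := by
  induction i with
  | zero => rfl
  | succ i ih =>
    rw [← UCP.bullet_point_one, ← bullet_proj, ih, bullet_proj, UCP.bullet_point_one,
      proj_point_one]

/-- Integers are irrelevant in `CP(D)`: resetting them commutes with products and with insertions of
nonempty trees, so `PTree.induction` reduces the claim to one vertex. -/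
theorem proj_of_eq_zero (T : PTree (ℕ × D)) :
    proj K D (UCP.of K T) = proj K D (UCP.of K (T.mapDeco fun x => (0, x.2))) := by
  induction T using PTree.induction with
  | iso e h => rw [← UCP.of_congr K e, h, UCP.of_congr K (Iso.mapDeco e _)]
  | empty T h =>
    have : IsEmpty (T.mapDeco fun x => ((0, x.2) : ℕ × D)).V := h
    rw [UCP.of_isEmpty, UCP.of_isEmpty]
  | prod T T' h h' =>
    rw [← UCP.of_congr K (prodMapDeco T T' _), ← UCP.of_mul, ← UCP.of_mul, map_mul, map_mul, h, h']
  | point x => exact proj_point x.1 x.2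
  | ins S T' r hT hS hT' hs =>
    classical
    have h := bullet_proj K D (UCP.of K S) (UCP.of K T')
    rw [hS, hT', bullet_proj, UCP.bullet_of_eq_sum, UCP.bullet_of_eq_sum, map_sum, map_sum] at h
    -- Both sums are the class of `S • T'`. The terms with `s ≠ r` agree by induction and cancel,
    -- which leaves those at `r`.
    have h' : ∑ s : S.V, proj K D (UCP.of K ((S.ins s T').mapDeco fun x => (0, x.2))) =
        ∑ s : S.V, proj K D (UCP.of K (S.ins s T')) := by
      rw [← h]
      exact Fintype.sum_equiv (Equiv.refl S.V) _ _ fun s =>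
        congrArg _ (UCP.of_congr K (insMapDeco S T' s _)).symm
    rw [← Finset.add_sum_erase _ _ (Finset.mem_univ r),
      ← Finset.add_sum_erase _ _ (Finset.mem_univ r),
      Finset.sum_congr rfl fun s hs' => (hs s (Finset.ne_of_mem_erase hs')).symm] at h'
    exact (add_right_cancel h').symm

theorem proj_of (T : PTree (ℕ × D)) : proj K D (UCP.of K T) = of K (T.mapDeco Prod.snd) :=
  proj_of_eq_zero T

@[elab_as_elim]
theorem induction_on {p : CP K D → Prop} (x : CP K D) (of : ∀ T, p (of K T))
    (add : ∀ x y, p x → p y → p (x + y)) (smul : ∀ (c : K) x, p x → p (c • x)) : p x := by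
  obtain ⟨x, rfl⟩ := proj_surjective x
  induction x using UCP.induction_on with
  | of T => rw [proj_of]; exact of _
  | add x y hx hy => rw [map_add]; exact add _ _ hx hy
  | smul c x hx => rw [map_smul]; exact smul _ _ hx

end CP

/-! ### The bialgebra `H_CK^D` -/

section Primitive

variable {K : Type w} [Field K] {A : Type u} [CommRing A] [Algebra K A]
  {b : A →ₗ[K] A →ₗ[K] A} {Δ : A →ₗ[K] A ⊗[K] A} {ε : A →ₗ[K] K}

theorem IsComPreLieAlgebra.one_bullet (h : IsComPreLieAlgebra K b) (x : A) : b 1 x = 0 := by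
  have := h.leibniz 1 1 x
  rw [mul_one, mul_one, one_mul] at this
  exact left_eq_add.1 this

/-- The coproduct of `d • a`, where `d` is primitive. -/
theorem IsComPreLieBialgebra.comul_primitive_bullet (h : IsComPreLieBialgebra K b Δ ε) {d : A}
    (hd : Δ d = d ⊗ₜ 1 + 1 ⊗ₜ d) (a : A) :
    Δ (b d a) = (b d).rTensor A (Δ a) + 1 ⊗ₜ b d a := by
  have h1 : ∀ t, TensorProduct.map₂ b (LinearMap.mul K A) (d ⊗ₜ 1 + 1 ⊗ₜ d) t =
      (b d).rTensor A t := by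
    intro t
    induction t with
    | zero => simp
    | add t t' h h' => rw [map_add _ t t', h, h', map_add]
    | tmul a a' => simp [h.one_bullet]
  rw [h.comul_bullet, hd, h1, add_comm]
  simp [h.one_bullet]

/-- The map `(a, c) ↦ d • (a × c) - d • (a · c)`. -/
noncomputable def bulletDefect (b : A →ₗ[K] A →ₗ[K] A) (d : A) : A →ₗ[K] A →ₗ[K] A :=
  LinearMap.mk₂ K (fun a c => b (b d a) c - b d (b a c) - b d (a * c))
    (fun a a' c => by simp only [map_add, LinearMap.add_apply, add_mul]; abel)
    (fun k a c => by simp only [map_smul, LinearMap.smul_apply, smul_mul_assoc, smul_sub])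
    (fun a c c' => by simp only [map_add, mul_add]; abel)
    (fun k a c => by simp only [map_smul, mul_smul_comm, smul_sub])

theorem bulletDefect_apply (d a c : A) :
    bulletDefect b d a c = b (b d a) c - b d (b a c) - b d (a * c) := rfl

/-- When the three products are expanded, the terms with `1` on the left collect into the first
summand. The terms `(d • a⁽¹⁾) ⊗ (a⁽²⁾ • c)` occur twice with opposite signs. In the rest the defect
acts on the left factors and the product on the right ones. -/
theorem IsComPreLieBialgebra.comul_bulletDefect (h : IsComPreLieBialgebra K b Δ ε) {d : A}
    (hd : Δ d = d ⊗ₜ 1 + 1 ⊗ₜ d) (a c : A) :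
    Δ (bulletDefect b d a c) = 1 ⊗ₜ bulletDefect b d a c +
      TensorProduct.map₂ (bulletDefect b d) (LinearMap.mul K A) (Δ a) (Δ c) := by
  have h1 : ∀ x t, TensorProduct.map₂ b (LinearMap.mul K A) (1 ⊗ₜ x) t = 0 := by
    intro x t
    induction t with
    | zero => simp
    | add t t' h h' => simp only [map_add, h, h', add_zero]
    | tmul a a' => simp [h.one_bullet]
  have h2 : ∀ t, (b.flip c).lTensor A ((b d).rTensor A t) =
      (b d).rTensor A ((b.flip c).lTensor A t) := by
    intro t
    induction t with
    | zero => simp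
    | add t t' h h' => simp only [map_add, h, h']
    | tmul a a' => simp
  have h3 : ∀ t u, TensorProduct.map₂ (bulletDefect b d) (LinearMap.mul K A) t u =
      TensorProduct.map₂ b (LinearMap.mul K A) ((b d).rTensor A t) u
        - (b d).rTensor A (TensorProduct.map₂ b (LinearMap.mul K A) t u)
        - (b d).rTensor A (t * u) := by
    intro t u
    induction t with
    | zero => simp
    | add t t' h h' => simp only [map_add, LinearMap.add_apply, h, h', add_mul]; abel
    | tmul a a' =>
      induction u with
      | zero => simp
      | add u u' h h' => simp only [map_add, h, h', mul_add]; abel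
      | tmul c c' => simp [bulletDefect_apply, TensorProduct.sub_tmul]
  rw [h3, bulletDefect_apply, map_sub, map_sub, h.comul_bullet (b d a) c,
    h.comul_primitive_bullet hd, h.comul_primitive_bullet hd, h.comul_primitive_bullet hd,
    h.comul_bullet a c, h.comul_mul]
  simp only [map_add, LinearMap.add_apply, h1, h2, LinearMap.lTensor_tmul, LinearMap.flip_apply,
    TensorProduct.tmul_sub]
  abel

end Primitive

namespace HCK

open PTree

variable {K : Type w} [Field K] {D : Type u}

theorem proj_surjective : Function.Surjective (proj K D) := Ideal.Quotient.mk_surjective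

theorem ker_proj : RingHom.ker (proj K D) = idealJ K D := Ideal.Quotient.mkₐ_ker K _

/-- The generators of `J` only involve trees; bilinearity extends the relation to all elements, as
is needed for the factors of coproducts. -/
theorem proj_bulletDefect (d : D) (a c : CP K D) :
    proj K D (bulletDefect (CP.bullet K D) (CP.of K (point d)) a c) = 0 := by
  induction a using CP.induction_on with
  | add x y hx hy => rw [map_add, LinearMap.add_apply, map_add, hx, hy, add_zero]
  | smul k x hx => rw [map_smul, LinearMap.smul_apply, map_smul, hx, smul_zero]
  | of T =>
  induction c using CP.induction_on with
  | add x y hx hy => rw [map_add, map_add, hx, hy, add_zero]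
  | smul k x hx => rw [map_smul, map_smul, hx, smul_zero]
  | of T' =>
    rw [← RingHom.mem_ker, ker_proj]
    simp only [idealJ, idealSpan, Submodule.mem_sInf]
    exact fun I hI => hI.2 ⟨d, T, T', rfl⟩

/-- By `comul_bulletDefect`, every term of the coproduct of a generator of `J` has a factor which is
again a defect, hence zero in the quotient. -/
theorem exists_bialgebra {Δ : CP K D →ₗ[K] CP K D ⊗[K] CP K D} {ε : CP K D →ₗ[K] K}
    (h : IsComPreLieBialgebra K (CP.bullet K D) Δ ε)
    (hom : IsComPreLieBialgebraHom K (UCP.bullet K D) (UCP.comul K D) (UCP.counit K D)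
      (CP.bullet K D) Δ ε (CP.proj K D)) :
    ∃ (Δ' : HCK K D →ₗ[K] HCK K D ⊗[K] HCK K D) (ε' : HCK K D →ₗ[K] K),
      IsComPreLieBialgebra K (bullet K D) Δ' ε' ∧
      IsComPreLieBialgebraHom K (CP.bullet K D) Δ ε (bullet K D) Δ' ε' (proj K D) := by
  have hε : ∀ x y, ε (CP.bullet K D x y) = 0 := by
    intro x y
    obtain ⟨x, rfl⟩ := CP.proj_surjective x
    obtain ⟨y, rfl⟩ := CP.proj_surjective y
    rw [CP.bullet_proj, hom.map_counit, UCP.counit_bullet]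
  refine exists_quotient (proj K D) h hε proj_surjective
    (fun x y => (bullet_proj K D x y).symm) ker_proj ?_
  rintro _ ⟨d, F₁, F₂, rfl⟩
  have hd : Δ (CP.of K (point d)) = CP.of K (point d) ⊗ₜ 1 + 1 ⊗ₜ CP.of K (point d) := by
    have : CP.of K (point d) = CP.proj K D (UCP.of K (point (0, d))) := rfl
    rw [this, hom.map_comul, UCP.comul_point]
    simp
  refine ⟨?_, by simp [hε]⟩
  change TensorProduct.map _ _
    (Δ (bulletDefect (CP.bullet K D) (CP.of K (point d)) (CP.of K F₁) (CP.of K F₂))) = 0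
  have key : ∀ t u, TensorProduct.map (proj K D).toLinearMap (proj K D).toLinearMap
      (TensorProduct.map₂ (bulletDefect (CP.bullet K D) (CP.of K (point d)))
        (LinearMap.mul K (CP K D)) t u) = 0 := by
    intro t u
    induction t with
    | zero => simp
    | add t t' h h' => simp only [map_add, LinearMap.add_apply, h, h', add_zero]
    | tmul a a' =>
      induction u with
      | zero => simp
      | add u u' h h' => simp only [map_add, h, h', add_zero]
      | tmul c c' => simp [proj_bulletDefect]
  rw [h.comul_bulletDefect hd, map_add, key, TensorProduct.map_tmul, AlgHom.toLinearMap_apply,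
    AlgHom.toLinearMap_apply, proj_bulletDefect, TensorProduct.tmul_zero, add_zero]

end HCK

namespace PForest

open PTree

variable {D : Type u}

/-! ### Vertices of the product of the trees of a forest -/

section MergeV

variable (F : PForest D)

/-- The vertices of the product of the trees of a forest. -/
def mergeV (v : F.V) : F.merge.V := v

variable {F}

@[elab_as_elim]
theorem merge_cases {p : F.merge.V → Prop} (h : ∀ v, p (mergeV F v)) (v) : p v := h v

/-- Definition of a function on the vertices of the product of the trees of a forest. -/
def mergeElim {α : Sort*} (g : F.V → α) (v : F.merge.V) : α := g v

@[simp] theorem mergeElim_V {α : Sort*} (g : F.V → α) (v : F.V) :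
    mergeElim g (mergeV F v) = g v := rfl

@[simp] theorem mergeV_inj {v w : F.V} : mergeV F v = mergeV F w ↔ v = w := Iff.rfl

@[simp] theorem mergeV_parent (v : F.V) :
    F.merge.parent (mergeV F v) = (F.parent v).map (mergeV F) := Option.map_id'.symm

@[simp] theorem mergeV_deco (v : F.V) : F.merge.deco (mergeV F v) = F.deco v := rfl

@[simp] theorem mergeV_block (v w : F.V) : F.merge.block (mergeV F v) (mergeV F w) ↔
    F.block v w ∨ (F.parent v = none ∧ F.parent w = none) := Iff.rfl

end MergeV

/-- The product of the trees of a disjoint union. -/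
noncomputable def mergeDisj (F : PForest D) (T : PTree D) :
    PTree.Iso (F.merge.prod T) (F.disj T.toPForest).merge :=
  .ofEdges
    { toFun := prodElim (mergeElim fun v => mergeV _ (disjL _ _ v)) fun v => mergeV _ (disjR _ _ v)
      invFun := mergeElim (disjElim (fun v => prodL _ _ (mergeV _ v)) fun v => prodR _ _ v)
      left_inv := prod_cases (merge_cases (by simp)) (by simp)
      right_inv := merge_cases (disj_cases (by simp) (by simp)) }
    (by
      refine prod_cases (merge_cases fun v => ?_) (fun v => ?_) <;>
        refine prod_cases (merge_cases fun w => ?_) (fun w => ?_) <;> simp)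
    (by
      refine prod_cases (merge_cases fun v => ?_) (fun v => ?_) <;> simp)
    (by
      refine prod_cases (merge_cases fun v => ?_) (fun v => ?_) <;>
        refine prod_cases (merge_cases fun w => ?_) (fun w => ?_) <;> simp
      exact T.block_root v w)

/-- Insertion in the product of the trees of a forest. -/
noncomputable def mergeIns (F : PForest (ℕ × D)) (s : F.V) (T : PTree (ℕ × D)) [Nonempty T.V] :
    PTree.Iso (F.merge.ins (mergeV F s) T) (F.graft s T).merge :=
  .ofEdges
    { toFun := insElim (mergeElim fun v => mergeV _ (graftL _ _ _ v))
        fun v => mergeV _ (graftR _ _ _ v)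
      invFun := mergeElim (graftElim (fun v => insL _ _ _ (mergeV _ v)) fun v => insR _ _ _ v)
      left_inv := ins_cases (merge_cases (by simp)) (by simp)
      right_inv := merge_cases (graft_cases (by simp) (by simp)) }
    (by
      refine ins_cases (merge_cases fun v => ?_) (fun v => ?_) <;>
        refine ins_cases (merge_cases fun w => ?_) (fun w => ?_) <;> simp [-Option.elim_map]
      all_goals cases T.parent w <;> simp)
    (by
      refine ins_cases (merge_cases fun v => ?_) (fun v => ?_) <;> simp)
    (by
      refine ins_cases (merge_cases fun v => ?_) (fun v => ?_) <;>
        refine ins_cases (merge_cases fun w => ?_) (fun w => ?_) <;> simp)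

end PForest

namespace UCP

open PTree PForest

variable {K : Type w} [Field K] {D : Type u}

theorem sum_root {M : Type*} [AddCommMonoid M] (x : D) (F : PForest D)
    (f : (root x F).V → M) : ∑ v, f v = f (rootN x F) + ∑ v, f (rootS x F v) := by
  let e : Option F.V ≃ (root x F).V := Equiv.refl _
  exact (Equiv.sum_comp e f).symm.trans (Fintype.sum_option fun v => f (e v))

end UCP

/-! ### Classes in `H_CK^D` depend only on the underlying forest -/

namespace HCK

open PTree PForest

variable (K : Type w) [Field K] {D : Type u}

/-- The class of a partitioned tree. -/
noncomputable def of (T : PTree (ℕ × D)) : HCK K D := proj K D (CP.proj K D (UCP.of K T))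

variable {K}

theorem of_congr {T S : PTree (ℕ × D)} (e : T.Iso S) : of K T = of K S := by
  rw [of, of, UCP.of_congr K e]

theorem of_mul (T S : PTree (ℕ × D)) : of K T * of K S = of K (T.prod S) := by
  rw [of, of, of, ← UCP.of_mul, map_mul, map_mul]

theorem of_isEmpty (T : PTree (ℕ × D)) [IsEmpty T.V] : of K T = 1 := by
  rw [of, UCP.of_isEmpty, map_one, map_one]

theorem of_eq_of_mapDeco {T S : PTree (ℕ × D)}
    (h : T.mapDeco (Prod.snd : ℕ × D → D) = S.mapDeco Prod.snd) : of K T = of K S := by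
  rw [of, of, CP.proj_of, CP.proj_of, h]

theorem bullet_of (T S : PTree (ℕ × D)) :
    bullet K D (of K T) (of K S) = ∑ s : T.V, of K (T.ins s S) := by
  simp only [of]
  rw [bullet_proj, CP.bullet_proj, UCP.bullet_of_eq_sum, map_sum, map_sum]

theorem bullet_point_one (x : ℕ × D) : bullet K D (of K (point x)) 1 = of K (point x) := by
  have h : of K (point (x.1 + 1, x.2)) = of K (point x) := of_eq_of_mapDeco rfl
  conv_rhs => rw [← h]
  rw [of, of, ← map_one (proj K D), ← map_one (CP.proj K D), bullet_proj, CP.bullet_proj,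
    UCP.bullet_point_one]

theorem point_bullet_bullet (x : ℕ × D) (a c : HCK K D) :
    bullet K D (bullet K D (of K (point x)) a) c =
      bullet K D (of K (point x)) (bullet K D a c) + bullet K D (of K (point x)) (a * c) := by
  obtain ⟨a, rfl⟩ := proj_surjective a
  obtain ⟨c, rfl⟩ := proj_surjective c
  have h := proj_bulletDefect x.2 a c
  have hx : of K (point x) = proj K D (CP.of K (point x.2)) := 
    congrArg (proj K D) (CP.proj_of (point x))
  rw [bulletDefect_apply, map_sub, map_sub, sub_sub, sub_eq_zero] at h
  rw [hx, bullet_proj, bullet_proj, bullet_proj, h, bullet_proj, ← map_mul, bullet_proj]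

/-- In `H_CK^D`, trees are obtained by grafting forests on their root. -/
theorem of_root (x : ℕ × D) (F : PForest (ℕ × D)) :
    of K (root x F) = bullet K D (of K (point x)) (of K F.merge) := by
  induction F using PForest.induction with
  | iso e h => rw [← of_congr (e.root x), h, of_congr e.merge]
  | empty F h =>
    have : IsEmpty F.merge.V := h
    rw [of_congr (rootEmpty x F), of_isEmpty F.merge, bullet_point_one]
  | disj F T hT hF hs =>
    -- The product `(•_x • F) • T` is written in two ways: as a sum of insertions, where the root
    -- gives the tree sought, and by the defining relation, as `•_x • (F • T) + •_x • (F · T)`. The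
    -- insertions at the vertices of `F` match `•_x • (F • T)` by the induction hypothesis on
    -- graftings, and cancel.
    have h1 := bullet_of (K := K) (root x F) T
    rw [UCP.sum_root, of_congr (rootInsN x F T), hF, point_bullet_bullet, of_mul,
      of_congr (mergeDisj F T), bullet_of, map_sum] at h1
    have h2 : ∑ s : F.V, of K ((root x F).ins (rootS x F s) T) =
        ∑ s : F.merge.V, bullet K D (of K (point x)) (of K (F.merge.ins s T)) := by
      refine Fintype.sum_equiv (Equiv.refl F.V) _ _ fun s => ?_
      rw [of_congr (rootInsS x F T s), hs]
      exact congrArg _ (of_congr (mergeIns F s T)).symm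
    rw [h2, add_comm] at h1
    exact (add_right_cancel h1).symm

/-- In `H_CK^D`, the class of a tree depends only on the underlying rooted forest. -/
theorem of_eq_of_iso {T S : PTree (ℕ × D)}
    (e : RForest.Iso (T.toRForest.mapDeco Prod.snd) (S.toRForest.mapDeco (Prod.snd : ℕ × D → D))) :
    of K T = of K S := by
  induction h : Nat.card T.V using Nat.strong_induction_on generalizing T S with
  | _ n ih =>
  cases isEmpty_or_nonempty T.V with
  | inl hT =>
    have : IsEmpty S.V := e.toEquiv.isEmpty_congr.1 hT
    rw [of_isEmpty, of_isEmpty]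
  | inr hT =>
    obtain ⟨r, hr⟩ := T.toRForest.exists_root
    let r' : S.V := e.toEquiv r
    have hr' : S.parent r' = none := (e.parent_none r).2 hr
    have hroot : ∀ v : T.V, S.rootOf (e.toEquiv v) = e.toEquiv (T.rootOf v) := fun v =>
      RForest.rootOf_equiv (F := T.toRForest) (G := S.toRForest) e.toEquiv e.map_parent v
    have hiff : ∀ v : T.V, S.rootOf (e.toEquiv v) = r' ↔ T.rootOf v = r := fun v => by
      rw [hroot]
      exact e.toEquiv.apply_eq_iff_eq
    -- By `splitIso` and `of_root`, the class of `T` is determined by the decoration of `r` and by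
    -- the classes of two trees with fewer vertices, between which `e` restricts to isomorphisms of
    -- underlying forests.
    have h1 : of K (T.toPForest.restrict (T.above r)).merge =
        of K (S.toPForest.restrict (S.above r')).merge :=
      ih _ (h ▸ card_restrict_lt _ _ r fun h => h.2 rfl)
        (e.restrict (T.above r) (S.above r') fun v =>
          (and_congr (hiff v) (not_congr e.toEquiv.apply_eq_iff_eq)).symm) rfl
    have h2 : of K (T.toPForest.restrict (T.others r)).merge =
        of K (S.toPForest.restrict (S.others r')).merge :=
      ih _ (h ▸ card_restrict_lt T.toPForest _ r fun h => h (RForest.rootOf_of_none hr))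
        (e.restrict (T.others r) (S.others r') fun v => (not_congr (hiff v)).symm) rfl
    have h3 : of K (point (T.deco r)) = of K (point (S.deco r')) := by
      refine of_eq_of_mapDeco ?_
      have : (S.deco r').2 = (T.deco r).2 := e.map_deco r
      change point (T.deco r).2 = point (S.deco r').2
      rw [this]
    rw [← of_congr (T.splitIso r hr), ← of_congr (S.splitIso r' hr'), ← of_mul, ← of_mul, of_root,
      of_root, h1, h2, h3]

end HCK

/-! ### Forgetting the blocks -/

namespace RForest

variable {D : Type u}

theorem cls_eq_one_iff (F : RForest D) : F.cls = 1 ↔ IsEmpty F.V := by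
  constructor
  · intro h
    obtain ⟨e⟩ := Quotient.exact h
    exact e.toEquiv.isEmpty_congr.2 (inferInstanceAs (IsEmpty Empty))
  · intro h
    exact Quotient.sound ⟨Iso.ofEdges (Equiv.equivOfIsEmpty F.V Empty) (fun v => isEmptyElim v)
      (fun v => isEmptyElim v)⟩

/-- The partitioned tree with blocks as small as possible, except for the block of roots. -/
def toPTree (F : RForest D) : PTree (ℕ × D) :=
  PForest.merge
    { toRForest := F.mapDeco fun d => (0, d)
      block := ⊥
      block_parent := fun _ _ h => congrArg _ h }

/-- The partitioned tree of a forest depends only on its isoclass. -/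
def Iso.toPTree {F G : RForest D} (e : Iso F G) : PTree.Iso F.toPTree G.toPTree :=
  PForest.Iso.merge
    { toEquiv := e.toEquiv
      map_parent := e.map_parent
      map_deco := fun v => congrArg (Prod.mk 0) (e.map_deco v)
      map_block := fun _ _ => e.toEquiv.apply_eq_iff_eq }

end RForest

namespace PTree

variable {D : Type u}

/-- The rooted forest obtained by forgetting the blocks and the integers. -/
def forget (T : PTree (ℕ × D)) : RForest D := T.toRForest.mapDeco Prod.snd

/-- Isomorphisms of underlying forests. -/
def forgetIso {T S : PTree (ℕ × D)} (e : T.V ≃ S.V)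
    (hp : ∀ v w, S.parent (e w) = some (e v) ↔ T.parent w = some v)
    (hd : ∀ v, (S.deco (e v)).2 = (T.deco v).2) : T.forget.Iso S.forget :=
  .ofEdges e hp hd

theorem forget_toPTree (F : RForest D) : F.toPTree.forget = F := rfl

/-- The underlying forest of a product. -/
def forgetProd (T S : PTree (ℕ × D)) : (T.prod S).forget.Iso (T.forget.disj S.forget) :=
  .ofEdges (Equiv.refl (T.V ⊕ S.V)) (fun _ _ => Iff.rfl) (by rintro (v | v) <;> rfl)

/-- The underlying forest of an insertion depends only on the underlying forests. -/
noncomputable def forgetIns (T S : PTree (ℕ × D)) (s : T.V) :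
    (T.ins s S).forget.Iso (PTree.ins T.forget.toPTree s S.forget.toPTree).forget :=
  .ofEdges (Equiv.refl (T.V ⊕ S.V)) (fun _ _ => Iff.rfl) (by rintro (v | v) <;> rfl)

/-- The insertion of two trees, one after the other, in a tree with a single vertex. -/
noncomputable def forgetPointIns (x : ℕ × D) (T S : PTree (ℕ × D)) (s s' : (point x).V) :
    (((point x).ins s T).ins (insL _ s T s') S).forget.Iso
      ((point x).ins s (T.prod S)).forget :=
  forgetIso
    { toFun := insElim (insElim (fun v => insL _ _ _ v) (fun v => insR _ _ _ (prodL _ _ v)))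
        (fun v => insR _ _ _ (prodR _ _ v))
      invFun := insElim (fun v => insL _ _ _ (insL _ _ _ v))
        (prodElim (fun v => insL _ _ _ (insR _ _ _ v)) (fun v => insR _ _ _ v))
      left_inv := ins_cases (ins_cases (by simp) (by simp)) (by simp)
      right_inv := ins_cases (by simp) (prod_cases (by simp) (by simp)) }
    (by
      obtain rfl : s = s' := rfl
      refine ins_cases (ins_cases ?_ ?_) ?_ <;> intro v <;>
        refine ins_cases (ins_cases ?_ ?_) ?_ <;> intro w <;> simp [-Option.elim_map])
    (by refine ins_cases (ins_cases ?_ ?_) ?_ <;> intro v <;> simp)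

/-- The underlying forest of an insertion in a tree with a single vertex. -/
noncomputable def forgetPoint (x : ℕ × D) (T : PTree (ℕ × D)) (s : (point x).V) :
    ((point x).ins s T).forget.Iso (T.forget.graftRoot x.2) :=
  .ofEdges
    { toFun := insElim (T := point x) (s := s) (T' := T) (fun _ => none) (fun v => some v)
      invFun := fun v => v.elim (insL (point x) s T s) (insR (point x) s T)
      left_inv := ins_cases (T := point x) (s := s) (T' := T) (fun _ => rfl) (fun _ => rfl)
      right_inv := fun v => by cases v <;> rfl }
    (by
      refine ins_cases (T := point x) (s := s) (T' := T) (fun v => ?_) (fun v => ?_) <;>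
        refine ins_cases (T := point x) (s := s) (T' := T) (fun w => ?_) (fun w => ?_)
      · exact iff_of_false nofun nofun
      · change some (T.parent w) = some none ↔
          some ((T.parent w).elim (insL (point x) s T s) (insR (point x) s T)) =
            some (insL (point x) s T v)
        obtain rfl : s = v := rfl
        cases T.parent w <;> simp
      · exact iff_of_false nofun nofun
      · change some (T.parent w) = some (some v) ↔
          some ((T.parent w).elim (insL (point x) s T s) (insR (point x) s T)) =
            some (insR (point x) s T v)
        cases T.parent w <;> simp)
    (ins_cases (T := point x) (s := s) (T' := T) (fun _ => rfl) (fun _ => rfl))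

end PTree

/-! ### The Connes–Kreimer algebra as an image of `UCP(D)` -/

namespace CK

open PTree

variable {K : Type w} [Field K] {D : Type u}

theorem of_eq_basis (F : RForest D) : of K F = MonoidAlgebra.basis (RF D) K F.cls := rfl

@[elab_as_elim]
theorem induction_on {p : CK K D → Prop} (x : CK K D) (of : ∀ F, p (of K F))
    (add : ∀ x y, p x → p y → p (x + y)) (smul : ∀ (c : K) x, p x → p (c • x)) : p x := by
  induction (MonoidAlgebra.basis (RF D) K).mem_span x using Submodule.span_induction with
  | zero => simpa using smul 0 _ (of (RForest.empty _))
  | add x y _ _ hx hy => exact add x y hx hy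
  | smul c x _ hx => exact smul c x hx
  | mem x h =>
    obtain ⟨F, rfl⟩ := h
    obtain ⟨F, rfl⟩ := Quotient.exists_rep F
    exact of F

theorem comul_of (F : RForest D) : comul K D (of K F) =
    ∑ I : F.Ideals, of K (F.restrict I.1ᶜ) ⊗ₜ[K] of K (F.restrict I.1) := by
  rw [of_eq_basis, comul, Module.Basis.constr_basis]
  rfl

open Classical in
theorem counit_of (F : RForest D) : counit K D (of K F) = if IsEmpty F.V then 1 else 0 := by
  rw [of_eq_basis, counit, Module.Basis.constr_basis]
  simp only [RForest.cls_eq_one_iff]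

theorem B_of (d : D) (F : RForest D) : B K d (of K F) = of K (F.graftRoot d) := by
  rw [of_eq_basis, B, Module.Basis.constr_basis]
  rfl

variable (K D)

/-- The algebra morphism from `UCP(D)` which forgets the blocks and the integers. -/
noncomputable def ofUCP : UCP K D →ₐ[K] CK K D :=
  MonoidAlgebra.mapDomainAlgHom K K
    { toFun := Quotient.map (sa := PTree.setoid (ℕ × D)) (sb := RForest.setoid D) forget
        fun _ _ ⟨e⟩ => ⟨(Iso.mapDeco e Prod.snd).toIso⟩
      map_one' := (RForest.cls_eq_one_iff _).2 (inferInstanceAs (IsEmpty Empty))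
      map_mul' := by
        rintro ⟨T⟩ ⟨S⟩
        exact Quotient.sound ⟨forgetProd T S⟩ }

/-- A linear section of `ofUCP`. -/
noncomputable def toUCP : CK K D →ₗ[K] UCP K D :=
  (MonoidAlgebra.basis (RF D) K).constr K fun F =>
    Quotient.lift (s := RForest.setoid D) (fun F : RForest D => UCP.of K F.toPTree)
      (fun _ _ ⟨e⟩ => UCP.of_congr K e.toPTree) F

/-- The preLie product on the Connes–Kreimer algebra. -/
noncomputable def bullet : CK K D →ₗ[K] CK K D →ₗ[K] CK K D :=
  ((UCP.bullet K D).compl₁₂ (toUCP K D) (toUCP K D)).compr₂ (ofUCP K D).toLinearMap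

variable {K D}

theorem ofUCP_of (T : PTree (ℕ × D)) : ofUCP K D (UCP.of K T) = of K T.forget :=
  MonoidAlgebra.mapDomain_single

theorem toUCP_of (F : RForest D) : toUCP K D (of K F) = UCP.of K F.toPTree := by
  rw [of_eq_basis, toUCP, Module.Basis.constr_basis]
  rfl

theorem ofUCP_toUCP (x : CK K D) : ofUCP K D (toUCP K D x) = x := by
  induction x using induction_on with
  | of F => rw [toUCP_of, ofUCP_of, forget_toPTree]
  | add x y hx hy => rw [map_add, map_add, hx, hy]
  | smul c x hx => rw [map_smul, map_smul, hx]

theorem ofUCP_surjective : Function.Surjective (ofUCP K D) := fun x => ⟨_, ofUCP_toUCP x⟩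

/-- The preLie product on forests is defined through the section `toUCP`; this choice does not
matter, as the forest underlying an insertion ignores blocks and integers. -/
theorem ofUCP_bullet (x y : UCP K D) :
    ofUCP K D (UCP.bullet K D x y) = bullet K D (ofUCP K D x) (ofUCP K D y) := by
  induction x using UCP.induction_on with
  | add x x' h h' => simp only [map_add, LinearMap.add_apply, h, h']
  | smul c x h => simp only [map_smul, LinearMap.smul_apply, h]
  | of T =>
  induction y using UCP.induction_on with
  | add x x' h h' => simp only [map_add, h, h']
  | smul c x h => simp only [map_smul, h]
  | of S =>
    change _ = ofUCP K D (UCP.bullet K D (toUCP K D _) (toUCP K D _))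
    rw [ofUCP_of, ofUCP_of, toUCP_of, toUCP_of, UCP.bullet_of_eq_sum, UCP.bullet_of_eq_sum,
      map_sum, map_sum]
    refine Fintype.sum_equiv (Equiv.refl T.V) _ _ fun s => ?_
    rw [ofUCP_of, ofUCP_of]
    exact of_congr K (forgetIns T S s)

/-- Ideals do not see the blocks, and once blocks and integers are forgotten `R^I` and `P^I` are
plain restrictions. -/
theorem comul_ofUCP (x : UCP K D) : comul K D (ofUCP K D x) =
    TensorProduct.map (ofUCP K D).toLinearMap (ofUCP K D).toLinearMap (UCP.comul K D x) := by
  induction x using UCP.induction_on with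
  | add x x' h h' => simp only [map_add, h, h']
  | smul c x h => simp only [map_smul, h]
  | of T =>
    rw [ofUCP_of, comul_of, UCP.comul_of, map_sum]
    refine Fintype.sum_equiv (Equiv.refl T.Ideals) _ _ fun I => ?_
    rw [TensorProduct.map_tmul, AlgHom.toLinearMap_apply, AlgHom.toLinearMap_apply, ofUCP_of,
      ofUCP_of]
    rfl

theorem counit_ofUCP (x : UCP K D) : counit K D (ofUCP K D x) = UCP.counit K D x := by
  induction x using UCP.induction_on with
  | add x x' h h' => simp only [map_add, h, h']
  | smul c x h => simp only [map_smul, h]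
  | of T =>
    rw [ofUCP_of, counit_of, UCP.counit_of]
    rfl

theorem isComPreLieBialgebraHom_ofUCP :
    IsComPreLieBialgebraHom K (UCP.bullet K D) (UCP.comul K D) (UCP.counit K D)
      (bullet K D) (comul K D) (counit K D) (ofUCP K D) where
  map_comul := comul_ofUCP
  map_counit := counit_ofUCP
  map_bullet := ofUCP_bullet

/-- All the axioms are transported from `UCP(D)` along a surjection. -/
theorem isComPreLieBialgebra :
    IsComPreLieBialgebra K (bullet K D) (comul K D) (counit K D) :=
  UCP.isComPreLieBialgebra.of_surjective _ ofUCP_surjective isComPreLieBialgebraHom_ofUCP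

theorem ofUCP_point_bullet (d : D) (x : UCP K D) :
    ofUCP K D (UCP.bullet K D (UCP.of K (point (0, d))) x) = B K d (ofUCP K D x) := by
  induction x using UCP.induction_on with
  | add x x' h h' => simp only [map_add, h, h']
  | smul c x h => simp only [map_smul, h]
  | of T =>
    have : Unique (point ((0, d) : ℕ × D)).V := inferInstanceAs (Unique Unit)
    rw [UCP.bullet_of_eq_sum, Fintype.sum_unique, ofUCP_of, ofUCP_of, B_of]
    exact of_congr K (forgetPoint _ _ _)

/-- The `1`-cocycle property of the grafting operators. -/
theorem comul_B (d : D) (x : CK K D) : comul K D (B K d x) =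
    (B K d).rTensor (CK K D) (comul K D x) + 1 ⊗ₜ[K] B K d x := by
  obtain ⟨x, rfl⟩ := ofUCP_surjective x
  have h : ∀ t, TensorProduct.map (ofUCP K D).toLinearMap (ofUCP K D).toLinearMap
      ((UCP.bullet K D (UCP.of K (point (0, d)))).rTensor (UCP K D) t) =
      (B K d).rTensor (CK K D)
        (TensorProduct.map (ofUCP K D).toLinearMap (ofUCP K D).toLinearMap t) := by
    intro t
    induction t with
    | zero => simp
    | add t t' h h' => simp only [map_add, h, h']
    | tmul a a' => simp [ofUCP_point_bullet]
  -- The operator `B_d` is the image of `•_d • ·`, and the cocycle identity is the coproduct of `d •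
  -- a` for a primitive `d`.
  rw [← ofUCP_point_bullet, comul_ofUCP, comul_ofUCP,
    UCP.isComPreLieBialgebra.comul_primitive_bullet (UCP.comul_point _), map_add, h]
  simp

end CK

/-! ### Antipodes -/

section Antipode

variable {K : Type w} [Field K] {A : Type u} [CommRing A] [Algebra K A]
  {Δ : A →ₗ[K] A ⊗[K] A} {ε : A →ₗ[K] K}

open Finset in
/-- A bialgebra with a basis such that `Δ(x) - x ⊗ 1` only has terms whose left factor has a degree
smaller than the one of `x` has an antipode. -/
theorem IsBialgebra.exists_antipode (h : IsBialgebra K Δ ε) {ι : Type v} (B : Module.Basis ι K A)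
    (deg : ι → ℕ)
    (hΔ : ∀ i, Δ (B i) ∈ Submodule.span K {t | ∃ j k, t = B j ⊗ₜ[K] B k ∧ deg j ≤ deg i ∧
      deg k ≤ deg i ∧ (B k = 1 ∨ deg j < deg i)}) : ∃ S, IsAntipode K Δ ε S := by
  let _ : Coalgebra K A :=
    { comul := Δ
      counit := ε
      coassoc := h.coassoc
      rTensor_counit_comp_comul := LinearMap.ext h.rTensor_counit
      lTensor_counit_comp_comul := LinearMap.ext h.lTensor_counit }
  let id' : WithConv (A →ₗ[K] A) := .toConv LinearMap.id
  -- In the convolution algebra, whose unit is the counit followed by the unit map, the antipode is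
  -- the inverse of `id = 1 - f`, that is the series `∑ f ^ n`.
  let f : WithConv (A →ₗ[K] A) := 1 - id'
  have hf : f 1 = 0 := by
    change algebraMap K A (ε 1) - 1 = 0
    rw [h.counit_one, map_one, sub_self]
  have hspan : ∀ {i} (L L' : A ⊗[K] A →ₗ[K] A), (∀ j k, deg j ≤ deg i → deg k ≤ deg i →
      (B k = 1 ∨ deg j < deg i) → L (B j ⊗ₜ B k) = L' (B j ⊗ₜ B k)) →
      L (Δ (B i)) = L' (Δ (B i)) := by
    intro i L L' hL
    refine (Submodule.span_le.2 ?_ : _ ≤ LinearMap.eqLocus L L') (hΔ i)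
    rintro _ ⟨j, k, rfl, h1, h2, h3⟩
    exact hL j k h1 h2 h3
  -- The series is locally finite. In `f ^ n * f`, a right factor `1` is killed by `f`; otherwise
  -- the left factor has a smaller degree and is killed by `f ^ n`.
  have hpow : ∀ n i, deg i < n → (f ^ n) (B i) = 0 := by
    intro n
    induction n with
    | zero => exact fun i hi => (Nat.not_lt_zero _ hi).elim
    | succ n ih =>
      intro i hi
      rw [pow_succ, LinearMap.convMul_apply]
      refine hspan (LinearMap.mul' K A ∘ₗ TensorProduct.map (f ^ n).ofConv f.ofConv) 0 ?_
      rintro j k - - (hk | hj)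
      · change (f ^ n) (B j) * f (B k) = 0
        rw [hk, hf, mul_zero]
      · change (f ^ n) (B j) * f (B k) = 0
        rw [ih j (by omega), zero_mul]
  let g : ℕ → WithConv (A →ₗ[K] A) := fun N => ∑ n ∈ range N, f ^ n
  -- The truncation depends on the degree; by `hS`, any longer truncation gives the same value. One
  -- truncation thus serves for all the factors of `Δ (B i)`, whose degrees are at most `deg i`, and
  -- the geometric sum telescopes to `1 - f ^ (deg i + 1)`.
  let S : A →ₗ[K] A := B.constr K fun i => g (deg i + 1) (B i)
  have hS : ∀ N i, deg i < N → S (B i) = g N (B i) := by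
    intro N i hi
    induction N, hi using Nat.le_induction with
    | base => exact B.constr_basis K _ i
    | succ N hN ih =>
      rw [ih]
      change _ = (∑ n ∈ range (N + 1), f ^ n) (B i)
      rw [sum_range_succ]
      change _ = g N (B i) + (f ^ N) (B i)
      rw [hpow N i hN, add_zero]
  have hid : id' = 1 - f := (sub_sub_cancel _ _).symm
  have hlast : ∀ i, (1 - f ^ (deg i + 1)) (B i) = algebraMap K A (ε (B i)) := by
    intro i
    change algebraMap K A (ε (B i)) - (f ^ (deg i + 1)) (B i) = _
    rw [hpow _ i (Nat.lt_succ_self _), sub_zero]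
  refine ⟨S, ⟨fun x => ?_, fun x => ?_⟩⟩
  · refine DFunLike.congr_fun (B.ext fun i => ?_ :
      LinearMap.mul' K A ∘ₗ S.rTensor A ∘ₗ Δ = Algebra.linearMap K A ∘ₗ ε) x
    refine Eq.trans ?_ (hlast i)
    rw [← geom_sum_mul_neg, ← hid]
    refine hspan (LinearMap.mul' K A ∘ₗ S.rTensor A)
      (LinearMap.mul' K A ∘ₗ TensorProduct.map (g (deg i + 1)).ofConv id'.ofConv) ?_
    intro j k hj _ _
    change S (B j) * B k = g (deg i + 1) (B j) * B k
    rw [hS _ j (Nat.lt_succ_of_le hj)]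
  · refine DFunLike.congr_fun (B.ext fun i => ?_ :
      LinearMap.mul' K A ∘ₗ S.lTensor A ∘ₗ Δ = Algebra.linearMap K A ∘ₗ ε) x
    refine Eq.trans ?_ (hlast i)
    rw [← mul_neg_geom_sum, ← hid]
    refine hspan (LinearMap.mul' K A ∘ₗ S.lTensor A)
      (LinearMap.mul' K A ∘ₗ TensorProduct.map id'.ofConv (g (deg i + 1)).ofConv) ?_
    intro j k _ hk _
    change B j * S (B k) = B j * g (deg i + 1) (B k)
    rw [hS _ k (Nat.lt_succ_of_le hk)]

end Antipode

namespace CK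

variable {K : Type w} [Field K] {D : Type u}

/-- Forests are graded by their number of vertices: either the ideal is empty and the right factor
is `1`, or the left factor has fewer vertices. -/
theorem exists_antipode : ∃ S, IsAntipode K (comul K D) (counit K D) S := by
  refine (isComPreLieBialgebra (K := K) (D := D)).toIsBialgebra.exists_antipode
    (MonoidAlgebra.basis (RF D) K)
    (Quotient.lift (s := RForest.setoid D) (fun F => Nat.card F.V)
      fun _ _ ⟨e⟩ => Nat.card_congr e.toEquiv) ?_
  rintro ⟨F⟩
  change comul K D (of K F) ∈ Submodule.span K _
  rw [comul_of]
  refine Submodule.sum_mem _ fun I _ => Submodule.subset_span ?_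
  refine ⟨_, _, rfl, Finite.card_subtype_le _, Finite.card_subtype_le _, ?_⟩
  obtain h | ⟨v, hv⟩ := I.1.eq_empty_or_nonempty
  · left
    have : IsEmpty (F.restrict I.1).V := by
      rw [h]
      exact ⟨fun v => v.2⟩
    exact congrArg (MonoidAlgebra.single · 1) ((RForest.cls_eq_one_iff _).2 this)
  · exact .inr (Finite.card_subtype_lt fun h => h hv)

end CK

/-! ### The Connes–Kreimer Hopf algebra as a quotient -/

theorem idealSpan_le_ker {K : Type w} [Field K] {A : Type u} [CommRing A] [Algebra K A]
    {B : Type v} [CommRing B] [Algebra K B] {b : A →ₗ[K] A →ₗ[K] A} {b' : B →ₗ[K] B →ₗ[K] B}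
    (p : A →ₐ[K] B) (hp : ∀ x y, p (b x y) = b' (p x) (p y)) {s : Set A}
    (hs : ∀ x ∈ s, p x = 0) : idealSpan b s ≤ RingHom.ker p := by
  refine sInf_le ⟨fun x hx a => ?_, hs⟩
  have hx : p x = 0 := hx
  constructor
  · change p _ = 0
    rw [hp, hx, map_zero, LinearMap.zero_apply]
  · change p _ = 0
    rw [hp, hx, map_zero]

namespace CK

open PTree

variable (K : Type w) [Field K] (D : Type u)

/-- The morphism induced by `ofUCP` on `CP(D)`. -/
noncomputable def ofCP : CP K D →ₐ[K] CK K D :=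
  Ideal.Quotient.liftₐ (idealId K D) (ofUCP K D) <| by
    refine idealSpan_le_ker (ofUCP K D) ofUCP_bullet ?_
    rintro _ ⟨d, rfl⟩
    rw [map_sub, ofUCP_of, ofUCP_of, sub_eq_zero]
    rfl

theorem ofCP_proj (x : UCP K D) : ofCP K D (CP.proj K D x) = ofUCP K D x := rfl

theorem ofCP_bullet (x y : CP K D) :
    ofCP K D (CP.bullet K D x y) = bullet K D (ofCP K D x) (ofCP K D y) := by
  obtain ⟨x, rfl⟩ := CP.proj_surjective x
  obtain ⟨y, rfl⟩ := CP.proj_surjective y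
  rw [CP.bullet_proj, ofCP_proj, ofCP_proj, ofCP_proj, ofUCP_bullet]

/-- The morphism induced by `ofUCP` on `H_CK^D`. -/
noncomputable def ofHCK : HCK K D →ₐ[K] CK K D :=
  Ideal.Quotient.liftₐ (idealJ K D) (ofCP K D) <| by
    refine idealSpan_le_ker (ofCP K D) (ofCP_bullet K D) ?_
    rintro _ ⟨d, F₁, F₂, rfl⟩
    simp only [CP.of, CP.bullet_proj, ← map_mul, ← map_sub]
    -- The tree `•_d` has a single vertex, so each side has one term: two blocks of children above
    -- the root on one side and a single block on the other. Their underlying forests coincide.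
    rw [ofCP_proj, UCP.bullet_bullet_sub, UCP.of_mul, UCP.bullet_of_eq_sum, map_sub, sub_eq_zero,
      map_sum, map_sum]
    refine Finset.sum_congr rfl fun s _ => ?_
    have : Unique ((point d).mapDeco fun d => ((0, d) : ℕ × D)).V := inferInstanceAs (Unique Unit)
    rw [Fintype.sum_unique, ofUCP_of, ofUCP_of]
    exact of_congr K (forgetPointIns (0, d) _ _ _ _)

theorem ofHCK_proj (x : CP K D) : ofHCK K D (HCK.proj K D x) = ofCP K D x := rfl

/-- The section `toUCP`, followed by the projections, is a left inverse: it replaces a tree by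
another one with the same underlying forest, which has the same class by `HCK.of_eq_of_iso`. -/
theorem ofHCK_injective : Function.Injective (ofHCK K D) := by
  refine Function.LeftInverse.injective
    (g := fun x => HCK.proj K D (CP.proj K D (toUCP K D x))) fun x => ?_
  obtain ⟨x, rfl⟩ := HCK.proj_surjective x
  obtain ⟨x, rfl⟩ := CP.proj_surjective x
  rw [ofHCK_proj, ofCP_proj]
  induction x using UCP.induction_on with
  | add x y hx hy => simp only [map_add, hx, hy]
  | smul c x hx => simp only [map_smul, hx]
  | of T =>
    rw [ofUCP_of]
    beta_reduce
    rw [toUCP_of]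
    exact HCK.of_eq_of_iso (.refl T.forget)

theorem ofHCK_surjective : Function.Surjective (ofHCK K D) := fun x =>
  ⟨HCK.proj K D (CP.proj K D (toUCP K D x)), ofUCP_toUCP x⟩

/-- The isomorphism from `H_CK^D` to the Connes–Kreimer Hopf algebra. -/
noncomputable def equivHCK : HCK K D ≃ₐ[K] CK K D :=
  AlgEquiv.ofBijective (ofHCK K D) ⟨ofHCK_injective K D, ofHCK_surjective K D⟩

end CK

end ComPreLie

/-! ### The main theorem -/

theorem mainTheorem6 (K : Type w) [Field K] [CharZero K] (D : Type u) :
    -- `UCP(D)` is a Com-PreLie bialgebra, with the coproduct `∑ R^I(T) ⊗ P^I(T)`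
    (∀ T : PTree (ℕ × D), UCP.comul K D (UCP.of K T) =
      ∑ I : T.Ideals, UCP.of K (T.R I) ⊗ₜ[K] UCP.of K (T.P I)) ∧
    IsComPreLieBialgebra K (UCP.bullet K D) (UCP.comul K D) (UCP.counit K D) ∧
    ∃ (ΔC : CP K D →ₗ[K] CP K D ⊗[K] CP K D) (εC : CP K D →ₗ[K] K)
      (ΔH : HCK K D →ₗ[K] HCK K D ⊗[K] HCK K D) (εH : HCK K D →ₗ[K] K),
      -- `CP(D)` is a Com-PreLie bialgebra quotient of `UCP(D)`
      IsComPreLieBialgebra K (CP.bullet K D) ΔC εC ∧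
      IsComPreLieBialgebraHom K (UCP.bullet K D) (UCP.comul K D) (UCP.counit K D)
        (CP.bullet K D) ΔC εC (CP.proj K D) ∧
      -- `H_CK^D` is a Com-PreLie bialgebra quotient of `CP(D)`, thus of `UCP(D)`
      IsComPreLieBialgebra K (HCK.bullet K D) ΔH εH ∧
      IsComPreLieBialgebraHom K (CP.bullet K D) ΔC εC
        (HCK.bullet K D) ΔH εH (HCK.proj K D) ∧
      -- the Connes–Kreimer algebra of decorated rooted trees is a Hopf algebra, whose coproduct
      -- has the 1-cocycle property with respect to the grafting operators
      IsBialgebra K (CK.comul K D) (CK.counit K D) ∧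
      (∃ S : CK K D →ₗ[K] CK K D, IsAntipode K (CK.comul K D) (CK.counit K D) S) ∧
      (∀ (d : D) (x : CK K D), CK.comul K D (CK.B K d x) =
        (CK.B K d).rTensor (CK K D) (CK.comul K D x) + 1 ⊗ₜ[K] CK.B K d x) ∧
      -- `H_CK^D` is this Hopf algebra, the quotient map forgetting the blocks
      ∃ Φ : HCK K D ≃ₐ[K] CK K D,
        (∀ T : PTree (ℕ × D), Φ (HCK.proj K D (CP.proj K D (UCP.of K T))) =
          CK.of K (T.toRForest.mapDeco Prod.snd)) ∧
        IsBialgebraHom K ΔH εH (CK.comul K D) (CK.counit K D)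
          (Φ : HCK K D →ₐ[K] CK K D) := by
  obtain ⟨ΔC, εC, hC, pC⟩ := CP.exists_bialgebra (K := K) (D := D)
  obtain ⟨ΔH, εH, hH, pH⟩ := HCK.exists_bialgebra hC pC
  refine ⟨UCP.comul_of K, UCP.isComPreLieBialgebra, ΔC, εC, ΔH, εH, hC, pC, hH, pH,
    CK.isComPreLieBialgebra.toIsBialgebra, CK.exists_antipode, CK.comul_B, CK.equivHCK K D,
    CK.ofUCP_of, ?_, ?_⟩
  · intro x
    obtain ⟨x, rfl⟩ := HCK.proj_surjective x
    obtain ⟨x, rfl⟩ := CP.proj_surjective x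
    -- On classes of elements of `UCP(D)` the isomorphism is `ofUCP`, so its compatibility with `Δ`
    -- and `ε` follows from that of `ofUCP` and of the two projections.
    change CK.comul K D (CK.ofUCP K D x) = _
    rw [CK.comul_ofUCP, pH.map_comul, pC.map_comul, TensorProduct.map_map,
      TensorProduct.map_map]
    rfl
  · intro x
    obtain ⟨x, rfl⟩ := HCK.proj_surjective x
    obtain ⟨x, rfl⟩ := CP.proj_surjective x
    change CK.counit K D (CK.ofUCP K D x) = _
    rw [CK.counit_ofUCP, pH.map_counit, pC.map_counit]
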